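/- Let $p_n$ denote the $n$-th prime ($p_1=2$). Call a real number $\vartheta$ an admissible level of distribution of the primes if for every $\varepsilon>0$ and every $A>0$ $$\sum_{q\le x^{\vartheta-\varepsilon}}\ \max_{\substack{a\\ (a,q)=1}}\ \Bigl|\sum_{\substack{p\equiv a\,(\mathrm{mod}\ q)\\ p\le x}}\log p-\frac{x}{\varphi(q)}\Bigr|\ \ll_{\varepsilon,A}\ \frac{x}{(\log x)^A}\qquad(x\ge 2),$$ where $p$ runs over primes. Let $J$ be the set of finite limit points of the sequence $\dfrac{p_{n+1}-p_n}{\log p_n}$, and, for a positive function $g$, let $J_g$ be the set of finite limit points of the sequence $\dfrac{p_{n+1}-p_n}{g(n)}$. **Theorem 4.** Let $g$ be a positive, monotonically increasing (not necessarily strictly) function on the integers $n\ge 2$ with $g(n)<\log n$ for all $n\ge 2$ and $\lim_{n\to\infty}g(n)=\infty$. Suppose that the primes have an admissible level of distribution $\vartheta>1/2$. Then there is a constant $c=c(g,\vartheta)>0$ such that $$[0,c]\subset J\qquad\text{and}\qquad [0,c]\subset J_g .$$ -/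

import Mathlib

open Filter Set

noncomputable section

/-- The sequence of primes with the usual indexing `p 1 = 2`, `p 2 = 3`, `p 3 = 5`, ...
(the value at the index `0` is irrelevant). -/
def primeSeq (n : ℕ) : ℕ := Nat.nth Nat.Prime (n - 1)

/-- The logarithmically weighted count of the primes `p ≤ x` with `p ≡ a (mod q)`. -/
def thetaMod (x : ℝ) (q : ℕ) (a : ZMod q) : ℝ :=
  ∑ p ∈ (Finset.Icc 1 ⌊x⌋₊).filter (fun p : ℕ => p.Prime ∧ (p : ZMod q) = a), Real.log p

/-- The largest error term `|∑_{p ≤ x, p ≡ a (mod q)} log p - x / φ(q)|` over the reduced residue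
classes `a` modulo `q`. For `q ≥ 1` this is a supremum over a finite nonempty set, so a maximum. -/
def maxError (x : ℝ) (q : ℕ) : ℝ :=
  ⨆ a : (ZMod q)ˣ, |thetaMod x q (a : ZMod q) - x / (Nat.totient q : ℝ)|

/-- `θ` is an admissible level of distribution of the primes: for all `ε > 0` and `A > 0`,
the sum of `maxError x q` over `1 ≤ q ≤ x ^ (θ - ε)` is `≪_{ε, A} x / (log x) ^ A`. -/
def HasLevelOfDistribution (θ : ℝ) : Prop :=
  ∀ ε : ℝ, 0 < ε → ∀ A : ℝ, 0 < A → ∃ C : ℝ, ∀ x : ℝ, 2 ≤ x →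
    ∑ q ∈ Finset.Icc 1 ⌊x ^ (θ - ε)⌋₊, maxError x q ≤ C * (x / Real.log x ^ A)

/-- The set of (finite) limit points of a real sequence. -/
def limitPoints (u : ℕ → ℝ) : Set ℝ := {t | MapClusterPt t atTop u}

/-- The limit points of the prime gaps normalized by `log p_n`. -/
def gapLimitPoints : Set ℝ :=
  limitPoints fun n => ((primeSeq (n + 1) : ℝ) - primeSeq n) / Real.log (primeSeq n)

/-- The limit points of the prime gaps normalized by a function `g` of the index `n`. -/
def gapLimitPointsWrt (g : ℕ → ℝ) : Set ℝ :=
  limitPoints fun n => ((primeSeq (n + 1) : ℝ) - primeSeq n) / g n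

end

/-! Both inclusions are instances of one statement, for a normalisation G that is monotone, tends to
infinity and satisfies G(n) ≤ log p_n: take G(n) = log p_n, and then G = g. Suppose no interval [0,
c] consists of limit points. Then there are points β_i > 0 and radii ε_i ≤ β_i such that the
normalised gaps eventually avoid the ε_i-neighbourhood of β_i, and β_j ≤ ε_i / 4 whenever j > i
(`exists_avoided_sequence`). Choose shifts h_i ≈ β_i G, with G evaluated near the index of x. For i
< j the difference h_i - h_j lies within ε_i G of β_i G whatever j is, so n + h_j and n + h_i can
never be consecutive primes. It remains to find consecutive primes n + h_j, n + h_i with both shifts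
in the tuple.

This is a Goldston–Pintz–Yıldırım argument (`exists_primes_in_tuple`). Let w(n) be the square of a
Selberg sum of dimension k with level R = x^η, where 2η < min(θ, 1), and restrict to n ≡ 1 mod W
with W the primorial of D. One shows that for some n the primes among the n + h_i outnumber by at
least two the primes n + s with s ≤ H outside the tuple; two neighbouring tuple primes then have no
prime between them. Otherwise an inequality between weighted sums would hold for every n, and it is
refuted on average.

Squarefree moduli are coded as sets of primes in (D, R]. Put L = log R and δ = φ(W)/W, let T be the
Riesz sum of order 2l and dimension k, and let T* be the one of order 2l + 2 with local factors (k -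
1)/(p - k). Diagonalising the quadratic forms, the sum of w is about (x/W) T (`selbergForm_main`),
while each tuple position contributes at least about (x/φ(W)) (δ/(l+1))² T*
(`le_selbergForm_prime`). No asymptotics for T and T* are needed: one-sided recursions give L T ≤ (1
+ small) δ T* when k = (2l+1)² (`eventually_mul_rieszSum_le`). The quotient of primes to weights is
thus at least about η ((2l+1)/(l+1))², which exceeds 1 for large l because η > 1/4; this is the use
of θ > 1/2. Positions outside the tuple contribute on average O(k) times the density of the weights
(`exists_sum_selbergForm_shift_le`), hence little when H ≤ c log x with c small. -/

/-! ### Diagonalisation of quadratic forms indexed by sets of primes -/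

/-- Sums over the supersets of `U` inside `P`. -/
theorem sum_superset_eq {ι M : Type*} [DecidableEq ι] [AddCommMonoid M] {P U : Finset ι}
    (hU : U ⊆ P) (f : Finset ι → M) :
    ∑ S ∈ P.powerset with U ⊆ S, f S = ∑ T ∈ (P \ U).powerset, f (U ∪ T) := by
  refine Finset.sum_nbij' (fun S => S \ U) (fun T => U ∪ T) ?_ ?_ ?_ ?_ ?_
  · intro S hS
    simp only [Finset.mem_filter, Finset.mem_powerset] at hS ⊢
    exact Finset.sdiff_subset_sdiff hS.1 le_rfl
  · intro T hT
    simp only [Finset.mem_filter, Finset.mem_powerset] at hT ⊢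
    exact ⟨Finset.union_subset hU (hT.trans Finset.sdiff_subset), Finset.subset_union_left⟩
  · intro S hS
    simp only [Finset.mem_filter, Finset.mem_powerset] at hS
    exact Finset.union_sdiff_of_subset hS.2
  · intro T hT
    simp only [Finset.mem_powerset] at hT
    exact Finset.union_sdiff_cancel_left (Finset.disjoint_of_subset_right hT Finset.disjoint_sdiff)
  · intro S hS
    simp only [Finset.mem_filter, Finset.mem_powerset] at hS
    rw [Finset.union_sdiff_of_subset hS.2]

theorem disjoint_of_mem_powerset_sdiff {ι : Type*} [DecidableEq ι] {P U T : Finset ι}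
    (hT : T ∈ (P \ U).powerset) : Disjoint U T :=
  Finset.disjoint_of_subset_right (Finset.mem_powerset.1 hT) Finset.disjoint_sdiff

theorem sum_powerset_prod_one_add {ι : Type*} [DecidableEq ι] (P : Finset ι) (f : ι → ℝ) :
    ∑ S ∈ P.powerset, ∏ p ∈ S, f p = ∏ p ∈ P, (1 + f p) :=
  (Finset.prod_one_add P).symm

/-- Diagonalisation of Selberg's quadratic form, for squarefree moduli coded as sets of primes. -/
theorem quadForm_diagonal {ι : Type*} [DecidableEq ι] (P : Finset ι) (g : ι → ℝ)
    (hg : ∀ p ∈ P, g p ≠ 0) (lam : Finset ι → ℝ) :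
    ∑ S ∈ P.powerset, ∑ T ∈ P.powerset, lam S * lam T * ∏ p ∈ S ∪ T, g p =
      ∑ U ∈ P.powerset, (∏ p ∈ U, (1 / g p - 1)) *
        (∑ S ∈ P.powerset with U ⊆ S, (∏ p ∈ S, g p) * lam S) ^ 2 := by
  -- With g extended multiplicatively, g(S ∪ T) = g(S) g(T) / g(S ∩ T), and 1/g(S ∩ T) expands as a
  -- sum over U ⊆ S ∩ T of ∏ (1/g - 1), which separates S from T.
  have key : ∀ S ∈ P.powerset, ∀ T ∈ P.powerset, lam S * lam T * ∏ p ∈ S ∪ T, g p =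
      ∑ U ∈ P.powerset, (∏ p ∈ U, (1 / g p - 1)) *
        ((if U ⊆ S then (∏ p ∈ S, g p) * lam S else 0) *
          (if U ⊆ T then (∏ p ∈ T, g p) * lam T else 0)) := by
    intro S hS T hT
    rw [Finset.mem_powerset] at hS hT
    have h1 : ∏ p ∈ S ∩ T, (1 / g p) =
        ∑ U ∈ P.powerset with U ⊆ S ∩ T, ∏ p ∈ U, (1 / g p - 1) := by
      have : P.powerset.filter (fun U => U ⊆ S ∩ T) = (S ∩ T).powerset := by
        ext U
        simp only [Finset.mem_filter, Finset.mem_powerset, and_iff_right_iff_imp]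
        exact fun h => h.trans (Finset.inter_subset_left.trans hS)
      rw [this, sum_powerset_prod_one_add]
      exact Finset.prod_congr rfl fun p _ => by ring
    have h2 : (∏ p ∈ S ∪ T, g p) = (∏ p ∈ S, g p) * (∏ p ∈ T, g p) * ∏ p ∈ S ∩ T, (1 / g p) := by
      have h3 : (∏ p ∈ S ∩ T, g p) * ∏ p ∈ S ∩ T, (1 / g p) = 1 := by
        rw [← Finset.prod_mul_distrib]
        exact Finset.prod_eq_one fun p hp =>
          mul_one_div_cancel (hg p (hS (Finset.inter_subset_left hp)))
      rw [← Finset.prod_union_inter, mul_assoc, h3, mul_one]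
    rw [h2, h1, Finset.sum_filter, Finset.mul_sum, Finset.mul_sum]
    refine Finset.sum_congr rfl fun U _ => ?_
    simp only [Finset.subset_inter_iff]
    by_cases a : U ⊆ S <;> by_cases b : U ⊆ T <;> simp [a, b]
    ring
  rw [Finset.sum_congr rfl fun S hS => Finset.sum_congr rfl fun T hT => key S hS T hT]
  simp_rw [fun S => Finset.sum_comm (s := P.powerset) (t := P.powerset) (f := fun T U =>
    (∏ p ∈ U, (1 / g p - 1)) * ((if U ⊆ S then (∏ p ∈ S, g p) * lam S else 0) *
          (if U ⊆ T then (∏ p ∈ T, g p) * lam T else 0)))]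
  rw [Finset.sum_comm]
  refine Finset.sum_congr rfl fun U _ => ?_
  simp_rw [← Finset.mul_sum]
  rw [← Finset.sum_mul, Finset.sum_filter, sq]

/-- Composition of the two triangular transformations of Selberg's sieve. -/
theorem sum_superset_mul_sum_superset {ι : Type*} [DecidableEq ι] {P U : Finset ι} (hU : U ⊆ P)
    (b : ι → ℝ) (z : Finset ι → ℝ) :
    ∑ S ∈ P.powerset with U ⊆ S, (∏ p ∈ S, -b p) * ∑ V ∈ P.powerset with S ⊆ V, z V =
      (∏ p ∈ U, -b p) * ∑ M ∈ (P \ U).powerset, z (U ∪ M) * ∏ p ∈ M, (1 - b p) := by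
  -- After exchanging the sums, the sum of ∏ (-b) over U ⊆ S ⊆ V factors as the product of -b over U
  -- times the product of 1 - b over V \ U.
  have h1 : ∀ V ∈ P.powerset,
      ∑ S ∈ P.powerset with U ⊆ S, (if S ⊆ V then (∏ p ∈ S, -b p) * z V else 0) =
      if U ⊆ V then (∏ p ∈ U, -b p) * (z V * ∏ p ∈ V \ U, (1 - b p)) else 0 := by
    intro V hV
    rw [Finset.mem_powerset] at hV
    split_ifs with hUV
    · rw [← Finset.sum_filter]
      have : (P.powerset.filter (fun S => U ⊆ S)).filter (fun S => S ⊆ V) =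
          V.powerset.filter (fun S => U ⊆ S) := by
        ext S
        simp only [Finset.mem_filter, Finset.mem_powerset]
        constructor
        · rintro ⟨⟨_, b⟩, c⟩; exact ⟨c, b⟩
        · rintro ⟨c, b⟩; exact ⟨⟨c.trans hV, b⟩, c⟩
      rw [this, sum_superset_eq hUV]
      have e : ∏ p ∈ V \ U, (1 - b p) = ∑ M ∈ (V \ U).powerset, ∏ p ∈ M, -b p := by
        rw [sum_powerset_prod_one_add]; exact Finset.prod_congr rfl fun p _ => by ring
      rw [e, Finset.mul_sum, Finset.mul_sum]
      refine Finset.sum_congr rfl fun M hM => ?_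
      rw [Finset.prod_union (disjoint_of_mem_powerset_sdiff hM)]
      ring
    · refine Finset.sum_eq_zero fun S hS => if_neg fun h => hUV ?_
      exact (Finset.mem_filter.1 hS).2.trans h
  simp_rw [Finset.mul_sum, Finset.sum_filter (p := fun V => _ ⊆ V) (s := P.powerset)]
  rw [← Finset.sum_filter]
  rw [Finset.sum_comm, Finset.sum_congr rfl h1, ← Finset.sum_filter, sum_superset_eq hU]
  refine Finset.sum_congr rfl fun M hM => ?_
  rw [Finset.union_sdiff_cancel_left (disjoint_of_mem_powerset_sdiff hM)]

/-! ### Riesz means by partial summation -/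

theorem intervalIntegrable_sub_pow_of_le (Z a : ℝ) (j : ℕ) :
    IntervalIntegrable (fun t => if a ≤ t then ((j : ℝ) + 1) * (Z - t) ^ j else 0)
      MeasureTheory.volume 0 Z := by
  have hc : IntervalIntegrable (fun t : ℝ => ((j : ℝ) + 1) * (Z - t) ^ j)
      MeasureTheory.volume 0 Z := (by fun_prop : Continuous _).intervalIntegrable _ _
  have e : (fun t => if a ≤ t then ((j : ℝ) + 1) * (Z - t) ^ j else 0) =
      (Set.Ici a).indicator fun t : ℝ => ((j : ℝ) + 1) * (Z - t) ^ j := by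
    funext t
    simp [Set.indicator, Set.mem_Ici]
  rw [e]
  exact ⟨hc.1.indicator measurableSet_Ici, hc.2.indicator measurableSet_Ici⟩

theorem integral_sub_pow_of_le {Z a : ℝ} (ha : 0 ≤ a) (hZ : 0 ≤ Z) (j : ℕ) :
    ∫ t in (0 : ℝ)..Z, (if a ≤ t then ((j : ℝ) + 1) * (Z - t) ^ j else 0) =
      (max 0 (Z - a)) ^ (j + 1) := by
  have prim : ∀ u : ℝ, ∫ t in u..Z, ((j : ℝ) + 1) * (Z - t) ^ j = (Z - u) ^ (j + 1) := by
    intro u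
    rw [intervalIntegral.integral_const_mul]
    rw [intervalIntegral.integral_comp_sub_left (fun x : ℝ => x ^ j) Z, integral_pow]
    have : (j : ℝ) + 1 ≠ 0 := by positivity
    field_simp
    simp
  have hi : ∀ u v : ℝ, IntervalIntegrable (fun t : ℝ => ((j : ℝ) + 1) * (Z - t) ^ j)
      MeasureTheory.volume u v := fun u v => (by fun_prop : Continuous _).intervalIntegrable u v
  rcases le_or_gt a Z with h | h
  · rw [max_eq_right (by linarith), ← prim a]
    have e1 : ∫ t in (0 : ℝ)..a, (if a ≤ t then ((j : ℝ) + 1) * (Z - t) ^ j else 0) = 0 := by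
      rw [intervalIntegral.integral_congr_ae (g := fun _ => (0 : ℝ))]
      · simp
      · have : ∀ᵐ t : ℝ ∂MeasureTheory.volume, t ≠ a := by
          simp [MeasureTheory.ae_iff]
        filter_upwards [this] with t ht h2
        rw [Set.uIoc_of_le ha] at h2
        exact if_neg (not_le.2 (lt_of_le_of_ne h2.2 ht))
    have e2 : ∫ t in a..Z, (if a ≤ t then ((j : ℝ) + 1) * (Z - t) ^ j else 0) =
        ∫ t in a..Z, ((j : ℝ) + 1) * (Z - t) ^ j := by
      refine intervalIntegral.integral_congr fun t ht => ?_
      rw [Set.uIcc_of_le h] at ht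
      exact if_pos ht.1
    have i0 := intervalIntegrable_sub_pow_of_le Z a j
    have i1 := i0.mono_set (Set.uIcc_subset_uIcc_left (Set.mem_uIcc.2 (Or.inl ⟨ha, h⟩)))
    have i2 := i0.mono_set (Set.uIcc_subset_uIcc_right (Set.mem_uIcc.2 (Or.inl ⟨ha, h⟩)))
    rw [← intervalIntegral.integral_add_adjacent_intervals i1 i2, e1, e2, zero_add]
  · rw [max_eq_left (by linarith), zero_pow (by omega)]
    rw [intervalIntegral.integral_congr (g := fun _ => (0 : ℝ))]
    · simp
    · intro t ht
      rw [Set.uIcc_of_le hZ] at ht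
      exact if_neg (by have := ht.2; linarith)

/-- Riesz means as integrals of the summatory function. -/
theorem sum_mul_riesz_eq {ι : Type*} (s : Finset ι) (c a : ι → ℝ) (ha : ∀ i ∈ s, 0 ≤ a i)
    {Z : ℝ} (hZ : 0 ≤ Z) (j : ℕ) :
    ∑ i ∈ s, c i * (max 0 (Z - a i)) ^ (j + 1) =
      ∫ t in (0 : ℝ)..Z, ((j : ℝ) + 1) * (Z - t) ^ j * ∑ i ∈ s with a i ≤ t, c i := by
  have h : ∀ t : ℝ, ((j : ℝ) + 1) * (Z - t) ^ j * ∑ i ∈ s with a i ≤ t, c i =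
      ∑ i ∈ s, c i * (if a i ≤ t then ((j : ℝ) + 1) * (Z - t) ^ j else 0) := by
    intro t
    rw [Finset.sum_filter, Finset.mul_sum]
    exact Finset.sum_congr rfl fun i _ => by split_ifs <;> ring
  simp_rw [h]
  rw [intervalIntegral.integral_finsetSum
    fun i _ => (intervalIntegrable_sub_pow_of_le Z (a i) j).const_mul (c i)]
  refine Finset.sum_congr rfl fun i hi => ?_
  rw [intervalIntegral.integral_const_mul, integral_sub_pow_of_le (ha i hi) hZ]

theorem intervalIntegrable_riesz {ι : Type*} (s : Finset ι) (c a : ι → ℝ) (Z : ℝ) (j : ℕ) :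
    IntervalIntegrable (fun t => ((j : ℝ) + 1) * (Z - t) ^ j * ∑ i ∈ s with a i ≤ t, c i)
      MeasureTheory.volume 0 Z := by
  have h : (fun t : ℝ => ((j : ℝ) + 1) * (Z - t) ^ j * ∑ i ∈ s with a i ≤ t, c i) =
      ∑ i ∈ s, fun t => c i * (if a i ≤ t then ((j : ℝ) + 1) * (Z - t) ^ j else 0) := by
    funext t
    rw [Finset.sum_filter, Finset.mul_sum, Finset.sum_apply]
    exact Finset.sum_congr rfl fun i _ => by split_ifs <;> ring
  rw [h]
  exact IntervalIntegrable.sum _ fun i _ => (intervalIntegrable_sub_pow_of_le Z (a i) j).const_mul _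

theorem integral_sub_pow_mul_affine (Z α C : ℝ) (j : ℕ) :
    ∫ t in (0 : ℝ)..Z, ((j : ℝ) + 1) * (Z - t) ^ j * (α * t + C) =
      α * Z ^ (j + 2) / (j + 2) + C * Z ^ (j + 1) := by
  have hj : (j : ℝ) + 1 ≠ 0 := by positivity
  have hj2 : (j : ℝ) + 2 ≠ 0 := by positivity
  have := intervalIntegral.integral_comp_sub_left
    (fun u : ℝ => ((j : ℝ) + 1) * u ^ j * (α * (Z - u) + C)) (a := 0) (b := Z) Z
  simp only [sub_sub_cancel] at this
  rw [this]
  have e : (fun u : ℝ => ((j : ℝ) + 1) * u ^ j * (α * (Z - u) + C)) = fun u =>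
      (((j : ℝ) + 1) * (α * Z + C)) * u ^ j - (((j : ℝ) + 1) * α) * u ^ (j + 1) := by
    funext u; ring
  simp only [sub_self, sub_zero]
  rw [e, intervalIntegral.integral_sub, intervalIntegral.integral_const_mul,
    intervalIntegral.integral_const_mul, integral_pow, integral_pow]
  · push_cast
    have : (j : ℝ) + 1 + 1 = j + 2 := by ring
    rw [this]
    field_simp
    ring
  · exact (by fun_prop : Continuous _).intervalIntegrable _ _
  · exact (by fun_prop : Continuous _).intervalIntegrable _ _

/-- Partial summation: a linear bound for the summatory function is integrated against (j)(Z -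
t)^(j-1), which turns α t into α Z^(j+1)/(j+1). The truncation `max 0 Z` allows negative Z, as
occurs for Z = L - logSum S. -/
theorem sum_mul_riesz_le {ι : Type*} (s : Finset ι) (c a : ι → ℝ) (ha : ∀ i ∈ s, 0 ≤ a i)
    {α C Z : ℝ} {j : ℕ} (hj : 1 ≤ j)
    (h : ∀ t : ℝ, 0 ≤ t → t ≤ Z → ∑ i ∈ s with a i ≤ t, c i ≤ α * t + C) :
    ∑ i ∈ s, c i * (max 0 (Z - a i)) ^ j ≤
      α * (max 0 Z) ^ (j + 1) / (j + 1) + C * (max 0 Z) ^ j := by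
  obtain ⟨j, rfl⟩ : ∃ i, j = i + 1 := ⟨j - 1, by omega⟩
  rcases le_or_gt 0 Z with hZ | hZ
  · rw [max_eq_right hZ, sum_mul_riesz_eq s c a ha hZ j]
    have := integral_sub_pow_mul_affine Z α C j
    push_cast
    rw [show (j : ℝ) + 1 + 1 = j + 2 by ring, show j + 1 + 1 = j + 2 by ring, ← this]
    refine intervalIntegral.integral_mono_on hZ (intervalIntegrable_riesz s c a Z j)
      ((by fun_prop : Continuous _).intervalIntegrable _ _) fun t ht => ?_
    have : 0 ≤ Z - t := by linarith [ht.2]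
    exact mul_le_mul_of_nonneg_left (h t ht.1 ht.2) (by positivity)
  · rw [max_eq_left hZ.le]
    simp only [ne_eq, Nat.add_eq_zero_iff, one_ne_zero, and_false, not_false_eq_true, zero_pow,
      mul_zero, zero_div, add_zero]
    refine Finset.sum_nonpos fun i hi => ?_
    rw [max_eq_left (by linarith [ha i hi])]
    simp

theorem le_sum_mul_riesz {ι : Type*} (s : Finset ι) (c a : ι → ℝ) (ha : ∀ i ∈ s, 0 ≤ a i)
    {α Z : ℝ} {j : ℕ} (hj : 1 ≤ j)
    (h : ∀ t : ℝ, 0 ≤ t → t ≤ Z → α * t ≤ ∑ i ∈ s with a i ≤ t, c i) :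
    α * (max 0 Z) ^ (j + 1) / (j + 1) ≤ ∑ i ∈ s, c i * (max 0 (Z - a i)) ^ j := by
  have := sum_mul_riesz_le s (fun i => -c i) a ha (α := -α) (C := 0) hj (Z := Z) (by
    intro t h0 h1
    rw [Finset.sum_neg_distrib]
    linarith [h t h0 h1])
  simp only [neg_mul, Finset.sum_neg_distrib, zero_mul, add_zero, neg_div] at this
  linarith

/-! ### Harmonic sums over products of sieve primes -/

/-- The primes in the interval `(D, R]`. -/
def sievePrimes (D R : ℕ) : Finset ℕ := (Finset.Icc 1 R).filter fun p => p.Prime ∧ D < p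

/-- The logarithm of the product of the elements of `S`. -/
noncomputable def logSum (S : Finset ℕ) : ℝ := ∑ p ∈ S, Real.log p

theorem mem_sievePrimes {D R p : ℕ} : p ∈ sievePrimes D R ↔ p ≤ R ∧ p.Prime ∧ D < p := by
  simp only [sievePrimes, Finset.mem_filter, Finset.mem_Icc]
  exact ⟨fun h => ⟨h.1.2, h.2⟩, fun h => ⟨⟨h.2.1.one_lt.le, h.1⟩, h.2⟩⟩

theorem logSum_nonneg (S : Finset ℕ) : 0 ≤ logSum S :=
  Finset.sum_nonneg fun _ _ => Real.log_natCast_nonneg _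

theorem logSum_eq_log_prod {S : Finset ℕ} (hS : ∀ p ∈ S, p.Prime) :
    logSum S = Real.log ((∏ p ∈ S, p : ℕ) : ℝ) := by
  rw [Nat.cast_prod, Real.log_prod]
  · rfl
  · exact fun p hp => by exact_mod_cast (hS p hp).ne_zero

theorem logSum_union {S T : Finset ℕ} (h : Disjoint S T) :
    logSum (S ∪ T) = logSum S + logSum T := Finset.sum_union h

theorem prod_primes_pos {S : Finset ℕ} (hS : ∀ p ∈ S, p.Prime) : 0 < ∏ p ∈ S, p :=
  Finset.prod_pos fun p hp => (hS p hp).pos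

theorem prod_le_floor_exp {S : Finset ℕ} (hS : ∀ p ∈ S, p.Prime) {t : ℝ} (h : logSum S ≤ t) :
    ∏ p ∈ S, p ≤ ⌊Real.exp t⌋₊ := by
  rw [Nat.le_floor_iff (Real.exp_pos t).le,
    ← Real.log_le_iff_le_exp (by exact_mod_cast prod_primes_pos hS), ← logSum_eq_log_prod hS]
  exact h

theorem logSum_le_of_prod_le {S : Finset ℕ} (hS : ∀ p ∈ S, p.Prime) {t : ℝ}
    (h : ∏ p ∈ S, p ≤ ⌊Real.exp t⌋₊) : logSum S ≤ t := by
  rw [logSum_eq_log_prod hS, Real.log_le_iff_le_exp (by exact_mod_cast prod_primes_pos hS)]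
  exact (Nat.le_floor_iff (Real.exp_pos t).le).1 h

theorem prod_injOn_primes {S T : Finset ℕ} (hS : ∀ p ∈ S, p.Prime) (hT : ∀ p ∈ T, p.Prime)
    (h : ∏ p ∈ S, p = ∏ p ∈ T, p) : S = T := by
  rw [← Nat.primeFactors_prod hS, h, Nat.primeFactors_prod hT]

/-- The pairs (A, S \ A) are exactly the disjoint pairs, so forgetting disjointness only adds
nonnegative terms. This is how a multiplicative convolution is bounded by a product of two sums. -/
theorem sum_powerset_split_le {ι : Type*} [DecidableEq ι] (P : Finset ι)
    (F : Finset ι → Finset ι → ℝ) (hF : ∀ A ∈ P.powerset, ∀ B ∈ P.powerset, 0 ≤ F A B) :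
    ∑ S ∈ P.powerset, ∑ A ∈ S.powerset, F A (S \ A) ≤
      ∑ A ∈ P.powerset, ∑ B ∈ P.powerset, F A B := by
  have h1 : ∑ S ∈ P.powerset, ∑ A ∈ S.powerset, F A (S \ A) =
      ∑ A ∈ P.powerset, ∑ S ∈ P.powerset with A ⊆ S, F A (S \ A) := by
    refine Finset.sum_comm' fun S A => ?_
    simp only [Finset.mem_powerset, Finset.mem_filter]
    exact ⟨fun h => ⟨h, h.2.trans h.1⟩, fun h => h.1⟩
  rw [h1]
  refine Finset.sum_le_sum fun A hA => ?_
  rw [sum_superset_eq (Finset.mem_powerset.1 hA)]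
  have : ∑ T ∈ (P \ A).powerset, F A ((A ∪ T) \ A) = ∑ T ∈ (P \ A).powerset, F A T :=
    Finset.sum_congr rfl fun T hT => by
      rw [Finset.union_sdiff_cancel_left (disjoint_of_mem_powerset_sdiff hT)]
  rw [this]
  exact Finset.sum_le_sum_of_subset_of_nonneg (Finset.powerset_mono.2 Finset.sdiff_subset)
    fun B hB _ => hF A hA B hB

theorem sum_inv_Icc_le (t : ℝ) (ht : 0 ≤ t) :
    ∑ n ∈ Finset.Icc 1 ⌊Real.exp t⌋₊, (1 : ℝ) / n ≤ 1 + t := by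
  have h := harmonic_floor_le_one_add_log (Real.exp t) (Real.one_le_exp ht)
  rw [Real.log_exp, harmonic_eq_sum_Icc] at h
  push_cast at h
  simpa [one_div] using h

/-- Pushing a sum over sets of primes forward to a sum over integers. -/
theorem sum_inv_prod_le {P : Finset ℕ} (hP : ∀ p ∈ P, p.Prime) (t : ℝ) (Q : ℕ → Prop)
    [DecidablePred Q] (hQ : ∀ S ∈ P.powerset, Q (∏ p ∈ S, p)) :
    ∑ S ∈ P.powerset with logSum S ≤ t, 1 / ∏ p ∈ S, (p : ℝ) ≤
      ∑ n ∈ (Finset.Icc 1 ⌊Real.exp t⌋₊).filter Q, (1 : ℝ) / n := by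
  have hp : ∀ S ∈ P.powerset.filter (fun S => logSum S ≤ t), ∀ p ∈ S, p.Prime := fun S hS p hpS =>
    hP p (Finset.mem_powerset.1 (Finset.mem_filter.1 hS).1 hpS)
  have h1 : ∑ S ∈ P.powerset with logSum S ≤ t, 1 / ∏ p ∈ S, (p : ℝ) =
      ∑ n ∈ (P.powerset.filter fun S => logSum S ≤ t).image (fun S => ∏ p ∈ S, p), (1 : ℝ) / n := by
    rw [Finset.sum_image]
    · exact Finset.sum_congr rfl fun S _ => by push_cast; rfl
    · intro S hS T hT h
      exact prod_injOn_primes (hp S hS) (hp T hT) h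
  rw [h1]
  refine Finset.sum_le_sum_of_subset_of_nonneg ?_ fun n _ _ => by positivity
  intro n hn
  obtain ⟨S, hS, rfl⟩ := Finset.mem_image.1 hn
  rw [Finset.mem_filter, Finset.mem_Icc]
  exact ⟨⟨prod_primes_pos (hp S hS), prod_le_floor_exp (hp S hS) (Finset.mem_filter.1 hS).2⟩,
    hQ S (Finset.mem_filter.1 hS).1⟩

theorem sum_inv_prod_le_one_add {P : Finset ℕ} (hP : ∀ p ∈ P, p.Prime) {t : ℝ} (ht : 0 ≤ t) :
    ∑ S ∈ P.powerset with logSum S ≤ t, 1 / ∏ p ∈ S, (p : ℝ) ≤ 1 + t := by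
  refine (sum_inv_prod_le hP t (fun _ => True) fun _ _ => trivial).trans ?_
  simpa using sum_inv_Icc_le t ht

/-- A divisor-function bound, by induction on K: (K+1)^|S| is the sum of K^|A| over A ⊆ S, and
splitting S into A and S \ A separates off one more harmonic sum, that is one more factor 1 + t. -/
theorem sum_pow_card_div_prod_le {P : Finset ℕ} (hP : ∀ p ∈ P, p.Prime) {t : ℝ} (ht : 0 ≤ t)
    (K : ℕ) :
    ∑ S ∈ P.powerset with logSum S ≤ t, (K : ℝ) ^ S.card / ∏ p ∈ S, (p : ℝ) ≤ (1 + t) ^ K := by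
  induction K with
  | zero =>
    rw [pow_zero, Finset.sum_filter]
    rw [Finset.sum_eq_single_of_mem ∅ (Finset.empty_mem_powerset P)]
    · simp only [Finset.card_empty, pow_zero, Finset.prod_empty, div_one]
      split_ifs <;> norm_num
    · intro S _ hS
      have : S.card ≠ 0 := by rwa [ne_eq, Finset.card_eq_zero]
      simp [this]
  | succ K ih =>
    set a : Finset ℕ → ℝ := fun S => if logSum S ≤ t then (K : ℝ) ^ S.card / ∏ p ∈ S, (p : ℝ) else 0
    set b : Finset ℕ → ℝ := fun S => if logSum S ≤ t then 1 / ∏ p ∈ S, (p : ℝ) else 0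
    have ha : ∀ S, 0 ≤ a S := fun S => by
      simp only [a]; split_ifs <;> positivity
    have hb : ∀ S, 0 ≤ b S := fun S => by
      simp only [b]; split_ifs <;> positivity
    have h1 : ∑ S ∈ P.powerset with logSum S ≤ t, ((K + 1 : ℕ) : ℝ) ^ S.card / ∏ p ∈ S, (p : ℝ) ≤
        ∑ S ∈ P.powerset, ∑ A ∈ S.powerset, a A * b (S \ A) := by
      rw [Finset.sum_filter]
      refine Finset.sum_le_sum fun S hS => ?_
      split_ifs with hSt
      · have e : ((K + 1 : ℕ) : ℝ) ^ S.card = ∑ A ∈ S.powerset, (K : ℝ) ^ A.card := by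
          have := sum_powerset_prod_one_add S fun _ => (K : ℝ)
          simp only [Finset.prod_const] at this
          rw [this]; push_cast; ring
        rw [e, Finset.sum_div]
        refine Finset.sum_le_sum fun A hA => ?_
        have hAS := Finset.mem_powerset.1 hA
        have hl : logSum S = logSum A + logSum (S \ A) := by
          rw [← logSum_union Finset.disjoint_sdiff, Finset.union_sdiff_of_subset hAS]
        have h1 : logSum A ≤ t := by linarith [logSum_nonneg (S \ A)]
        have h2 : logSum (S \ A) ≤ t := by linarith [logSum_nonneg A]
        simp only [a, b, h1, h2, if_true]
        rw [div_mul_div_comm, mul_one, mul_comm (∏ p ∈ A, (p : ℝ)), Finset.prod_sdiff hAS]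
      · exact Finset.sum_nonneg fun A _ => mul_nonneg (ha _) (hb _)
    refine h1.trans ((sum_powerset_split_le P (fun A B => a A * b B)
      fun A _ B _ => mul_nonneg (ha _) (hb _)).trans ?_)
    rw [← Finset.sum_mul_sum, pow_succ]
    refine mul_le_mul ?_ ?_ (Finset.sum_nonneg fun _ _ => hb _) (by positivity)
    · rw [← Finset.sum_filter]; exact ih
    · rw [← Finset.sum_filter]; exact sum_inv_prod_le_one_add hP ht

/-- The density of the integers coprime to `W`. -/
noncomputable def coprimeDensity (W : ℕ) : ℝ := (Nat.totient W : ℝ) / W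

/-- Integers below W contribute at most W. For n ≥ W, replace 1/n by 1/(W⌊n/W⌋); each value of the
quotient occurs for at most φ(W) integers coprime to W. -/
theorem sum_inv_coprime_le {W : ℕ} (hW : 0 < W) {t : ℝ} (ht : 0 ≤ t) :
    ∑ n ∈ (Finset.Icc 1 ⌊Real.exp t⌋₊).filter (fun n => n.Coprime W), (1 : ℝ) / n ≤
      coprimeDensity W * t + (W + 1) := by
  set N := ⌊Real.exp t⌋₊
  have hW' : (0 : ℝ) < W := by exact_mod_cast hW
  rw [← Finset.sum_filter_add_sum_filter_not _ (fun n => n < W)]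
  have h1 : ∑ n ∈ ((Finset.Icc 1 N).filter (fun n => n.Coprime W)).filter (fun n => n < W),
      (1 : ℝ) / n ≤ W := by
    calc _ ≤ ∑ n ∈ ((Finset.Icc 1 N).filter (fun n => n.Coprime W)).filter (fun n => n < W),
          (1 : ℝ) := by
          refine Finset.sum_le_sum fun n hn => ?_
          simp only [Finset.mem_filter, Finset.mem_Icc] at hn
          rw [div_le_one (by exact_mod_cast hn.1.1.1)]
          exact_mod_cast hn.1.1.1
      _ ≤ _ := by
          rw [Finset.sum_const, nsmul_eq_mul, mul_one]
          have : ((Finset.Icc 1 N).filter (fun n => n.Coprime W)).filter (fun n => n < W) ⊆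
              Finset.range W := fun n hn => Finset.mem_range.2 (Finset.mem_filter.1 hn).2
          exact_mod_cast (Finset.card_le_card this).trans (Finset.card_range W).le
  have h2 : ∑ n ∈ ((Finset.Icc 1 N).filter (fun n => n.Coprime W)).filter (fun n => ¬ n < W),
      (1 : ℝ) / n ≤ coprimeDensity W * (1 + t) := by
    set s := ((Finset.Icc 1 N).filter (fun n => n.Coprime W)).filter (fun n => ¬ n < W)
    set f : ℕ × ℕ → ℝ := fun x => 1 / (W * x.1)
    calc ∑ n ∈ s, (1 : ℝ) / n ≤ ∑ n ∈ s, f (n / W, n % W) := by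
          refine Finset.sum_le_sum fun n hn => ?_
          simp only [s, Finset.mem_filter, Finset.mem_Icc, not_lt] at hn
          have : 0 < n / W := Nat.div_pos hn.2 hW
          refine one_div_le_one_div_of_le (by positivity) ?_
          exact_mod_cast Nat.mul_div_le n W
      _ = ∑ x ∈ s.image (fun n => (n / W, n % W)), f x := by
          rw [Finset.sum_image]
          intro a _ b _ h
          simp only [Prod.mk.injEq] at h
          rw [← Nat.div_add_mod a W, ← Nat.div_add_mod b W, h.1, h.2]
      _ ≤ ∑ x ∈ Finset.Icc 1 N ×ˢ (Finset.range W).filter (fun r => W.Coprime r), f x := by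
          refine Finset.sum_le_sum_of_subset_of_nonneg ?_ fun _ _ _ => by positivity
          intro x hx
          obtain ⟨n, hn, rfl⟩ := Finset.mem_image.1 hx
          simp only [s, Finset.mem_filter, Finset.mem_Icc, not_lt] at hn
          simp only [Finset.mem_product, Finset.mem_Icc, Finset.mem_filter, Finset.mem_range]
          refine ⟨⟨Nat.div_pos hn.2 hW, (Nat.div_le_self _ _).trans hn.1.1.2⟩, Nat.mod_lt _ hW, ?_⟩
          have := hn.1.2
          rw [Nat.coprime_comm, Nat.Coprime, Nat.gcd_comm, Nat.gcd_comm n W] at *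
          rwa [Nat.gcd_comm, ← Nat.gcd_rec] 
      _ = coprimeDensity W * ∑ n ∈ Finset.Icc 1 N, (1 : ℝ) / n := by
          rw [Finset.sum_product]
          simp only [f, Finset.sum_const, nsmul_eq_mul]
          rw [Finset.mul_sum]
          refine Finset.sum_congr rfl fun n _ => ?_
          rw [coprimeDensity, Nat.totient_eq_card_coprime]
          rw [div_mul_div_comm, mul_one, mul_one_div]
      _ ≤ _ := mul_le_mul_of_nonneg_left (sum_inv_Icc_le t ht) (by unfold coprimeDensity; positivity)
  have h3 : coprimeDensity W ≤ 1 := by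
    rw [coprimeDensity, div_le_one hW']
    exact_mod_cast Nat.totient_le W
  linarith

theorem prime_of_mem_powerset_sievePrimes {D R : ℕ} {S : Finset ℕ}
    (hS : S ∈ (sievePrimes D R).powerset) : ∀ p ∈ S, p.Prime := fun _ hp =>
  (mem_sievePrimes.1 (Finset.mem_powerset.1 hS hp)).2.1

theorem coprime_primorial_of_mem {D R p : ℕ} (hp : p ∈ sievePrimes D R) :
    p.Coprime (primorial D) := by
  have h := mem_sievePrimes.1 hp
  rw [h.2.1.coprime_iff_not_dvd, h.2.1.dvd_primorial_iff]
  omega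

theorem prod_coprime_primorial {D R : ℕ} {S : Finset ℕ} (hS : S ∈ (sievePrimes D R).powerset) :
    (∏ p ∈ S, p).Coprime (primorial D) :=
  Nat.Coprime.prod_left fun _ hp => coprime_primorial_of_mem (Finset.mem_powerset.1 hS hp)

theorem prod_one_add_div_sq_le {D R : ℕ} (hD : 0 < D) {K : ℝ} (hK : 0 ≤ K) :
    ∏ p ∈ sievePrimes D R, (1 + K / (p : ℝ) ^ 2) ≤ Real.exp (K / D) := by
  calc ∏ p ∈ sievePrimes D R, (1 + K / (p : ℝ) ^ 2)
      ≤ ∏ p ∈ sievePrimes D R, Real.exp (K / (p : ℝ) ^ 2) := by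
        refine Finset.prod_le_prod (fun p _ => by positivity) fun p _ => ?_
        rw [add_comm]; exact Real.add_one_le_exp _
    _ = Real.exp (K * ∑ p ∈ sievePrimes D R, ((p : ℝ) ^ 2)⁻¹) := by
        rw [← Real.exp_sum, Finset.mul_sum]; rfl
    _ ≤ _ := by
        rw [Real.exp_le_exp, div_eq_mul_inv]
        refine mul_le_mul_of_nonneg_left ?_ hK
        rcases le_or_gt D R with h | h
        · have h1 := sum_Ioc_inv_sq_le_sub (α := ℝ) hD.ne' h
          have h2 : ∑ p ∈ sievePrimes D R, ((p : ℝ) ^ 2)⁻¹ ≤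
              ∑ p ∈ Finset.Ioc D R, ((p : ℝ) ^ 2)⁻¹ := by
            refine Finset.sum_le_sum_of_subset_of_nonneg ?_ fun _ _ _ => by positivity
            intro p hp
            have := mem_sievePrimes.1 hp
            exact Finset.mem_Ioc.2 ⟨this.2.2, this.1⟩
          have : (0 : ℝ) ≤ (R : ℝ)⁻¹ := by positivity
          linarith
        · have : sievePrimes D R = ∅ := by
            refine Finset.eq_empty_of_forall_notMem fun p hp => ?_
            have := mem_sievePrimes.1 hp
            omega
          rw [this]; simp

theorem prod_inv_one_sub_primorial (D : ℕ) :
    ∏ p ∈ (primorial D).primeFactors, (1 - (p : ℝ)⁻¹) = coprimeDensity (primorial D) := by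
  have h := Nat.totient_eq_mul_prod_factors (primorial D)
  have h' : (Nat.totient (primorial D) : ℝ) =
      (primorial D : ℝ) * ∏ p ∈ (primorial D).primeFactors, (1 - (p : ℝ)⁻¹) := by
    have := congrArg (fun q : ℚ => (q : ℝ)) h
    push_cast at this
    exact this
  have : (primorial D : ℝ) ≠ 0 := by exact_mod_cast primorial_ne_zero D
  rw [coprimeDensity, h']
  field_simp

theorem sum_inv_factored_le (Q : Finset ℕ) (hQ : ∀ p ∈ Q, p.Prime) (s : Finset ℕ)
    (hs : ∀ n ∈ s, n ∈ Nat.factoredNumbers Q) :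
    ∑ n ∈ s, (1 : ℝ) / n ≤ ∏ p ∈ Q, (1 - (p : ℝ)⁻¹)⁻¹ := by
  let f : ℕ →* ℝ :=
    { toFun := fun n => (n : ℝ)⁻¹
      map_one' := by simp
      map_mul' := fun a b => by push_cast; rw [mul_inv] }
  have hf : ∀ {p : ℕ}, p.Prime → ‖f p‖ < 1 := by
    intro p hp
    have : (1 : ℝ) < p := by exact_mod_cast hp.one_lt
    change ‖((p : ℝ))⁻¹‖ < 1
    rw [Real.norm_of_nonneg (by positivity)]
    exact inv_lt_one_of_one_lt₀ this
  obtain ⟨h1, h2⟩ := EulerProduct.summable_and_hasSum_factoredNumbers_prod_filter_prime_geometric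
    hf Q
  have h3 : Q.filter Nat.Prime = Q := Finset.filter_true_of_mem hQ
  rw [h3] at h2
  let s' : Finset (Nat.factoredNumbers Q) := s.attach.map
    ⟨fun n => ⟨n.1, hs n.1 n.2⟩, fun a b h => Subtype.ext (by simpa using h)⟩
  have h4 : ∑ n ∈ s, (1 : ℝ) / n = ∑ n ∈ s', f n := by
    rw [Finset.sum_map, ← Finset.sum_attach]
    exact Finset.sum_congr rfl fun n _ => one_div _
  rw [h4]
  exact sum_le_hasSum s' (fun n _ => by change (0 : ℝ) ≤ ((n : ℕ) : ℝ)⁻¹; positivity) h2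

/-- Group the integers n ≤ e^t by the set M of their prime factors in (D, R] outside U. Since e^t ≤
R, the remaining cofactor n / ∏ M is built from primes dividing W or lying in U or M, so its
harmonic sum is at most the Euler product over these primes. That product supplies W/φ(W) and the
factors p/(p - 1) on U, and turns 1/∏ M into the product of 1/(p - 1). -/
theorem le_sum_prod_inv_sub_one {D R : ℕ} {U : Finset ℕ} (hR : 0 < R)
    (hU : U ⊆ sievePrimes D R) {t : ℝ} (htR : t ≤ Real.log R) :
    coprimeDensity (primorial D) * t ≤
      (∏ p ∈ U, (p : ℝ) / (p - 1)) *
        ∑ M ∈ (sievePrimes D R \ U).powerset with logSum M ≤ t, ∏ p ∈ M, 1 / ((p : ℝ) - 1) := by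
  set P := sievePrimes D R
  set W := primorial D
  set N := ⌊Real.exp t⌋₊
  have hWp : ∀ p ∈ W.primeFactors, p.Prime := fun p hp => Nat.prime_of_mem_primeFactors hp
  have hPp : ∀ p ∈ P, p.Prime := fun p hp => (mem_sievePrimes.1 hp).2.1
  have hgt : ∀ p : ℕ, p.Prime → (1 : ℝ) < p := fun p hp => by exact_mod_cast hp.one_lt
  have hNR : N ≤ R := by
    have : Real.exp t ≤ R := by
      rw [← Real.exp_log (show (0 : ℝ) < R by exact_mod_cast hR)]
      exact Real.exp_le_exp.2 htR
    exact Nat.floor_le_of_le this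
  have hWU : Disjoint W.primeFactors U := by
    rw [Finset.disjoint_left]
    intro p hp hpU
    have h1 := (hWp p hp).dvd_primorial_iff.1 (Nat.dvd_of_mem_primeFactors hp)
    have h2 := (mem_sievePrimes.1 (hU hpU)).2.2
    omega
  have hmain : t ≤ ∑ M ∈ (P \ U).powerset with logSum M ≤ t,
      (∏ p ∈ W.primeFactors, (1 - (p : ℝ)⁻¹)⁻¹) * (∏ p ∈ U, (p : ℝ) / (p - 1)) *
        ∏ p ∈ M, 1 / ((p : ℝ) - 1) := by
    have h1 : t ≤ ∑ n ∈ Finset.Icc 1 N, (1 : ℝ) / n := by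
      have h := log_le_harmonic_floor (Real.exp t) (Real.exp_pos t).le
      rw [Real.log_exp, harmonic_eq_sum_Icc] at h
      push_cast at h
      simpa [one_div] using h
    refine h1.trans ?_
    rw [← Finset.sum_fiberwise_of_maps_to (t := (P \ U).powerset)
      (g := fun n => (P \ U) ∩ n.primeFactors) fun n _ =>
        Finset.mem_powerset.2 Finset.inter_subset_left, Finset.sum_filter]
    refine Finset.sum_le_sum fun M hM => ?_
    have hMP : ∀ p ∈ M, p.Prime := fun p hp =>
      hPp p (Finset.mem_sdiff.1 (Finset.mem_powerset.1 hM hp)).1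
    have hdvd : ∀ n ∈ (Finset.Icc 1 N).filter (fun n => (P \ U) ∩ n.primeFactors = M),
        ∏ p ∈ M, p ∣ n := by
      intro n hn
      rw [Finset.mem_filter, Finset.mem_Icc] at hn
      refine (Finset.prod_dvd_prod_of_subset M n.primeFactors _ ?_).trans
        (Nat.prod_primeFactors_dvd n)
      rw [← hn.2]; exact Finset.inter_subset_right
    split_ifs with hMt
    · set Q := W.primeFactors ∪ U ∪ M with hQdef
      have hQ : ∀ p ∈ Q, p.Prime := by
        intro p hp
        rcases Finset.mem_union.1 hp with hp | hp
        · rcases Finset.mem_union.1 hp with hp | hp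
          · exact hWp p hp
          · exact hPp p (hU hp)
        · exact hMP p hp
      have hM0 := prod_primes_pos hMP
      set s := (Finset.Icc 1 N).filter (fun n => (P \ U) ∩ n.primeFactors = M)
      have h2 : ∑ n ∈ s, (1 : ℝ) / n = (1 / ∏ p ∈ M, (p : ℝ)) *
          ∑ n ∈ s.image (fun n => n / ∏ p ∈ M, p), (1 : ℝ) / n := by
        rw [Finset.sum_image, Finset.mul_sum]
        · refine Finset.sum_congr rfl fun n hn => ?_
          obtain ⟨c, hc⟩ := hdvd n hn
          rw [hc, Nat.mul_div_cancel_left _ hM0]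
          push_cast
          rw [one_div_mul_one_div]
        · intro a ha b hb h
          obtain ⟨c, hc⟩ := hdvd a ha
          obtain ⟨d, hd⟩ := hdvd b hb
          simp only [hc, hd, Nat.mul_div_cancel_left _ hM0] at h
          rw [hc, hd, h]
      rw [h2]
      have h3 := sum_inv_factored_le Q hQ (s.image (fun n => n / ∏ p ∈ M, p)) (by
        intro n hn
        obtain ⟨a, ha, rfl⟩ := Finset.mem_image.1 hn
        have hd := hdvd a ha
        obtain ⟨ha1, ha2⟩ := Finset.mem_filter.1 ha
        rw [Finset.mem_Icc] at ha1
        refine Nat.mem_factoredNumbers_of_dvd (k := a / ∏ p ∈ M, p) (m := a) ?_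
          (Nat.div_dvd_of_dvd hd)
        refine Nat.mem_factoredNumbers_of_primeFactors_subset (by omega) fun p hp => ?_
        have hpp := Nat.prime_of_mem_primeFactors hp
        have hpa := Nat.le_of_dvd (by omega) (Nat.dvd_of_mem_primeFactors hp)
        rw [hQdef, Finset.mem_union, Finset.mem_union]
        by_cases hpU : p ∈ U
        · exact Or.inl (Or.inr hpU)
        by_cases hpD : p ≤ D
        · exact Or.inl (Or.inl (Nat.mem_primeFactors.2
            ⟨hpp, hpp.dvd_primorial_iff.2 hpD, primorial_ne_zero D⟩))
        · refine Or.inr ?_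
          rw [← ha2]
          refine Finset.mem_inter.2 ⟨Finset.mem_sdiff.2 ⟨mem_sievePrimes.2 ?_, hpU⟩, hp⟩
          exact ⟨by omega, hpp, by omega⟩)
      refine (mul_le_mul_of_nonneg_left h3 (by positivity)).trans (le_of_eq ?_)
      have hd1 : Disjoint (W.primeFactors ∪ U) M := by
        rw [Finset.disjoint_union_left]
        refine ⟨?_, disjoint_of_mem_powerset_sdiff hM⟩
        rw [Finset.disjoint_left]
        intro p hp hpM
        have h1 := (hWp p hp).dvd_primorial_iff.1 (Nat.dvd_of_mem_primeFactors hp)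
        have h2 := (mem_sievePrimes.1 (Finset.mem_sdiff.1 (Finset.mem_powerset.1 hM hpM)).1).2.2
        omega
      rw [hQdef, Finset.prod_union hd1, Finset.prod_union hWU]
      have e1 : ∏ p ∈ U, (1 - (p : ℝ)⁻¹)⁻¹ = ∏ p ∈ U, (p : ℝ) / (p - 1) := by
        refine Finset.prod_congr rfl fun p hp => ?_
        have := hgt p (hPp p (hU hp))
        have h1 : (p : ℝ) ≠ 0 := by linarith
        rw [show 1 - (p : ℝ)⁻¹ = (p - 1) / p by field_simp, inv_div]
      have e2 : (1 / ∏ p ∈ M, (p : ℝ)) * ∏ p ∈ M, (1 - (p : ℝ)⁻¹)⁻¹ =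
          ∏ p ∈ M, 1 / ((p : ℝ) - 1) := by
        rw [one_div, ← Finset.prod_inv_distrib, ← Finset.prod_mul_distrib]
        refine Finset.prod_congr rfl fun p hp => ?_
        have := hgt p (hMP p hp)
        have h1 : (p : ℝ) ≠ 0 := by linarith
        rw [← mul_inv, mul_sub, mul_inv_cancel₀ h1, mul_one, one_div]
      rw [e1, ← e2]
      ring
    · refine le_of_eq (Finset.sum_eq_zero fun n hn => absurd ?_ hMt)
      have hd := hdvd n hn
      rw [Finset.mem_filter, Finset.mem_Icc] at hn
      exact logSum_le_of_prod_le hMP ((Nat.le_of_dvd (by omega) hd).trans hn.1.2)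
  rw [← Finset.mul_sum] at hmain
  have e : ∏ p ∈ W.primeFactors, (1 - (p : ℝ)⁻¹)⁻¹ = (coprimeDensity W)⁻¹ := by
    rw [Finset.prod_inv_distrib, prod_inv_one_sub_primorial]
  have hpos : 0 < coprimeDensity W := by
    have h1 : 0 < W := primorial_pos D
    have h2 := Nat.totient_pos.2 h1
    unfold coprimeDensity
    positivity
  rw [e, mul_assoc, inv_mul_eq_div, le_div_iff₀ hpos] at hmain
  linarith

/-- The sum of log p over the primes p ∣ n is at most log n, so summing over n ≤ N bounds ∑ log p
⌊N/p⌋ by N log N; removing the floors costs Chebyshev's θ(N) ≤ N log 4. -/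
theorem sum_log_div_primes_le (N : ℕ) (hN : 1 ≤ N) :
    ∑ p ∈ (Finset.Icc 1 N).filter Nat.Prime, Real.log p / p ≤ Real.log N + Real.log 4 := by
  have hN0 : (0 : ℝ) < N := by exact_mod_cast hN
  have h1 : ∑ p ∈ (Finset.Icc 1 N).filter Nat.Prime, Real.log p * ((N / p : ℕ) : ℝ) ≤
      N * Real.log N := by
    calc ∑ p ∈ (Finset.Icc 1 N).filter Nat.Prime, Real.log p * ((N / p : ℕ) : ℝ)
        = ∑ p ∈ (Finset.Icc 1 N).filter Nat.Prime, ∑ n ∈ (Finset.Ioc 0 N).filter (fun n => p ∣ n),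
            Real.log p := by
          refine Finset.sum_congr rfl fun p _ => ?_
          rw [Finset.sum_const, nsmul_eq_mul, Nat.Ioc_filter_dvd_card_eq_div, mul_comm]
      _ = ∑ n ∈ Finset.Ioc 0 N, ∑ p ∈ n.primeFactors, Real.log p := by
          refine Finset.sum_comm' fun p n => ?_
          simp only [Finset.mem_filter, Finset.mem_Icc, Finset.mem_Ioc, Nat.mem_primeFactors]
          constructor
          · rintro ⟨⟨_, a⟩, ⟨b, c⟩, d⟩; exact ⟨⟨a, d, by omega⟩, b, c⟩
          · rintro ⟨⟨a, d, e⟩, b, c⟩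
            exact ⟨⟨⟨a.one_lt.le, (Nat.le_of_dvd b d).trans c⟩, a⟩, ⟨b, c⟩, d⟩
      _ ≤ ∑ n ∈ Finset.Ioc 0 N, Real.log N := by
          refine Finset.sum_le_sum fun n hn => ?_
          rw [Finset.mem_Ioc] at hn
          have : logSum n.primeFactors ≤ Real.log n := by
            rw [logSum_eq_log_prod fun p hp => Nat.prime_of_mem_primeFactors hp]
            refine Real.log_le_log ?_ ?_
            · exact_mod_cast prod_primes_pos fun p hp => Nat.prime_of_mem_primeFactors hp
            · exact_mod_cast Nat.le_of_dvd hn.1 (Nat.prod_primeFactors_dvd n)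
          refine this.trans (Real.log_le_log (by exact_mod_cast hn.1) (by exact_mod_cast hn.2))
      _ = _ := by rw [Finset.sum_const, nsmul_eq_mul, Nat.card_Ioc, Nat.sub_zero]
  have h2 : N * ∑ p ∈ (Finset.Icc 1 N).filter Nat.Prime, Real.log p / p ≤
      ∑ p ∈ (Finset.Icc 1 N).filter Nat.Prime, Real.log p * ((N / p : ℕ) : ℝ) +
      ∑ p ∈ (Finset.Icc 1 N).filter Nat.Prime, Real.log p := by
    rw [Finset.mul_sum, ← Finset.sum_add_distrib]
    refine Finset.sum_le_sum fun p hp => ?_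
    have hp0 : 0 < p := (Finset.mem_filter.1 hp).2.pos
    have h : (N : ℝ) / p ≤ ((N / p : ℕ) : ℝ) + 1 := by
      rw [div_le_iff₀ (by exact_mod_cast hp0)]
      exact_mod_cast (Nat.lt_div_mul_add hp0).le.trans (by rw [add_mul, one_mul])
    calc (N : ℝ) * (Real.log p / p) = Real.log p * (N / p) := by ring
      _ ≤ Real.log p * (((N / p : ℕ) : ℝ) + 1) :=
          mul_le_mul_of_nonneg_left h (Real.log_natCast_nonneg p)
      _ = _ := by ring
  have h3 : ∑ p ∈ (Finset.Icc 1 N).filter Nat.Prime, Real.log p ≤ Real.log 4 * N := by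
    have := Chebyshev.theta_le_log4_mul_x (x := (N : ℝ)) hN0.le
    rw [Chebyshev.theta_eq_sum_Icc, Nat.floor_natCast] at this
    refine le_trans (Finset.sum_le_sum_of_subset_of_nonneg ?_ fun p _ _ =>
      Real.log_natCast_nonneg p) this
    exact Finset.filter_subset_filter _ (Finset.Icc_subset_Icc_left (by norm_num))
  have h4 : N * ∑ p ∈ (Finset.Icc 1 N).filter Nat.Prime, Real.log p / p ≤
      N * (Real.log N + Real.log 4) := by
    linarith
  exact le_of_mul_le_mul_left h4 hN0

theorem summable_two_mul_rpow : Summable fun n : ℕ => 2 * ((n : ℝ) ^ (3 / 2 : ℝ))⁻¹ :=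
  (Real.summable_nat_rpow_inv.2 (by norm_num)).mul_left 2

theorem log_div_sq_le (n : ℕ) : Real.log n / (n : ℝ) ^ 2 ≤ 2 * ((n : ℝ) ^ (3 / 2 : ℝ))⁻¹ := by
  rcases Nat.eq_zero_or_pos n with rfl | hn
  · simp
  have hn0 : (0 : ℝ) < n := by exact_mod_cast hn
  have h1 : Real.log n ≤ 2 * (n : ℝ) ^ (1 / 2 : ℝ) := by
    have := Real.log_le_rpow_div hn0.le (show (0 : ℝ) < 1 / 2 by norm_num)
    linarith
  rw [← Real.rpow_neg hn0.le, div_le_iff₀ (by positivity), mul_assoc, ← Real.rpow_natCast,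
    ← Real.rpow_add hn0]
  norm_num at h1 ⊢
  exact h1

/-- An upper bound of Mertens type. -/
theorem sum_log_div_sub_le (k : ℕ) : ∃ C : ℝ, 0 ≤ C ∧ ∀ D R : ℕ, 2 * k ≤ D → ∀ t : ℝ, 0 ≤ t →
    ∑ p ∈ (sievePrimes D R).filter (fun p : ℕ => Real.log p ≤ t), Real.log p / ((p : ℝ) - k) ≤ t + C := by
  refine ⟨Real.log 4 + 2 * k * ∑' n : ℕ, 2 * ((n : ℝ) ^ (3 / 2 : ℝ))⁻¹, ?_, ?_⟩
  · have : 0 ≤ ∑' n : ℕ, 2 * ((n : ℝ) ^ (3 / 2 : ℝ))⁻¹ := tsum_nonneg fun n => by positivity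
    have : 0 ≤ Real.log 4 := Real.log_nonneg (by norm_num)
    positivity
  intro D R hD t ht
  set s := (sievePrimes D R).filter (fun p : ℕ => Real.log p ≤ t)
  have hN : 1 ≤ ⌊Real.exp t⌋₊ := by
    rw [Nat.one_le_floor_iff]; exact Real.one_le_exp ht
  have h1 : ∑ p ∈ s, Real.log p / ((p : ℝ) - k) ≤
      ∑ p ∈ s, Real.log p / p + 2 * k * ∑ p ∈ s, Real.log p / (p : ℝ) ^ 2 := by
    rw [Finset.mul_sum, ← Finset.sum_add_distrib]
    refine Finset.sum_le_sum fun p hp => ?_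
    have hp' := mem_sievePrimes.1 (Finset.mem_filter.1 hp).1
    have hp0 : (0 : ℝ) < p := by exact_mod_cast hp'.2.1.pos
    have hpk : 2 * (k : ℝ) ≤ p := by exact_mod_cast hD.trans hp'.2.2.le
    have hpk' : 0 < (p : ℝ) - k := by
      have : (0 : ℝ) ≤ k := Nat.cast_nonneg k
      rcases this.eq_or_lt with h | h
      · rw [← h]; linarith
      · linarith
    have hlog : 0 ≤ Real.log p := Real.log_natCast_nonneg p
    -- As p ≥ 2k, passing from p to p - k costs at most 2k/p² per prime, and ∑ log p / p² converges.
    have : 1 / ((p : ℝ) - k) ≤ 1 / p + 2 * k / (p : ℝ) ^ 2 := by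
      rw [div_add_div _ _ hp0.ne' (by positivity), div_le_div_iff₀ hpk' (by positivity)]
      have : 0 ≤ (k : ℝ) * (p * (p - 2 * k)) := by
        have : (0 : ℝ) ≤ p - 2 * k := by linarith
        positivity
      nlinarith
    calc Real.log p / ((p : ℝ) - k) = Real.log p * (1 / ((p : ℝ) - k)) := by ring
      _ ≤ Real.log p * (1 / p + 2 * k / (p : ℝ) ^ 2) := mul_le_mul_of_nonneg_left this hlog
      _ = _ := by ring
  have h2 : ∑ p ∈ s, Real.log p / p ≤ t + Real.log 4 := by
    refine le_trans (Finset.sum_le_sum_of_subset_of_nonneg (t := (Finset.Icc 1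
      ⌊Real.exp t⌋₊).filter Nat.Prime) ?_ fun p _ _ =>
        div_nonneg (Real.log_natCast_nonneg p) (Nat.cast_nonneg p)) ?_
    · intro p hp
      obtain ⟨hp1, hp2⟩ := Finset.mem_filter.1 hp
      have hp' := mem_sievePrimes.1 hp1
      rw [Finset.mem_filter, Finset.mem_Icc]
      refine ⟨⟨hp'.2.1.pos, ?_⟩, hp'.2.1⟩
      rw [Nat.le_floor_iff (Real.exp_pos t).le]
      exact (Real.log_le_iff_le_exp (by exact_mod_cast hp'.2.1.pos)).1 hp2
    · refine (sum_log_div_primes_le _ hN).trans ?_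
      have : Real.log ⌊Real.exp t⌋₊ ≤ t := by
        rw [Real.log_le_iff_le_exp (by exact_mod_cast hN)]
        exact Nat.floor_le (Real.exp_pos t).le
      linarith
  have h3 : ∑ p ∈ s, Real.log p / (p : ℝ) ^ 2 ≤ ∑' n : ℕ, 2 * ((n : ℝ) ^ (3 / 2 : ℝ))⁻¹ :=
    (Finset.sum_le_sum fun p _ => log_div_sq_le p).trans
      (summable_two_mul_rpow.sum_le_tsum s fun n _ => by positivity)
  have h4 : 2 * (k : ℝ) * ∑ p ∈ s, Real.log p / (p : ℝ) ^ 2 ≤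
      2 * k * ∑' n : ℕ, 2 * ((n : ℝ) ^ (3 / 2 : ℝ))⁻¹ :=
    mul_le_mul_of_nonneg_left h3 (by positivity)
  linarith

/-! ### Recursions between Riesz sums -/

/-- The smooth truncation `(L - ∑_{p ∈ S} log p)_+ ^ j`. -/
noncomputable def riesz (L : ℝ) (j : ℕ) (S : Finset ℕ) : ℝ := (max 0 (L - logSum S)) ^ j

/-- The Riesz mean of the multiplicative function supported on products of primes in `P`
with values `f p`. -/
noncomputable def rieszSum (P : Finset ℕ) (f : ℕ → ℝ) (L : ℝ) (j : ℕ) : ℝ :=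
  ∑ S ∈ P.powerset, (∏ p ∈ S, f p) * riesz L j S

theorem riesz_nonneg (L : ℝ) (j : ℕ) (S : Finset ℕ) : 0 ≤ riesz L j S :=
  pow_nonneg (le_max_left _ _) _

theorem riesz_anti (L : ℝ) (j : ℕ) {S T : Finset ℕ} (h : S ⊆ T) : riesz L j T ≤ riesz L j S := by
  have : logSum S ≤ logSum T := Finset.sum_le_sum_of_subset_of_nonneg h fun _ _ _ =>
    Real.log_natCast_nonneg _
  exact pow_le_pow_left₀ (le_max_left _ _) (max_le_max_left _ (by linarith)) _

theorem riesz_eq_zero {L : ℝ} {j : ℕ} (hj : 1 ≤ j) {S : Finset ℕ} (h : L ≤ logSum S) :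
    riesz L j S = 0 := by
  rw [riesz, max_eq_left (by linarith), zero_pow (by omega)]

theorem riesz_union (L : ℝ) (j : ℕ) {S T : Finset ℕ} (h : Disjoint S T) :
    riesz L j (S ∪ T) = (max 0 (L - logSum S - logSum T)) ^ j := by
  rw [riesz, logSum_union h, sub_add_eq_sub_sub]

theorem rieszSum_nonneg {P : Finset ℕ} {f : ℕ → ℝ} (hf : ∀ p ∈ P, 0 ≤ f p) (L : ℝ) (j : ℕ) :
    0 ≤ rieszSum P f L j :=
  Finset.sum_nonneg fun _ hS => mul_nonneg (Finset.prod_nonneg fun p hp =>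
    hf p (Finset.mem_powerset.1 hS hp)) (riesz_nonneg _ _ _)

theorem pow_le_rieszSum {P : Finset ℕ} {f : ℕ → ℝ} (hf : ∀ p ∈ P, 0 ≤ f p) {L : ℝ} (hL : 0 ≤ L)
    (j : ℕ) : L ^ j ≤ rieszSum P f L j := by
  have := Finset.single_le_sum (f := fun S => (∏ p ∈ S, f p) * riesz L j S)
    (fun S hS => mul_nonneg (Finset.prod_nonneg fun p hp =>
      hf p (Finset.mem_powerset.1 hS hp)) (riesz_nonneg _ _ _)) (Finset.empty_mem_powerset P)
  refine le_trans (le_of_eq ?_) this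
  simp [riesz, logSum, hL]

theorem sub_pos_of_mem_sievePrimes {D R k p : ℕ} (hD : 2 * k ≤ D) (hp : p ∈ sievePrimes D R) :
    0 < (p : ℝ) - k := by
  have h := mem_sievePrimes.1 hp
  have : k < p := by omega
  have : (k : ℝ) < p := by exact_mod_cast this
  linarith

theorem le_two_mul_sub_of_mem_sievePrimes {D R k p : ℕ} (hD : 2 * k ≤ D)
    (hp : p ∈ sievePrimes D R) : (p : ℝ) ≤ 2 * ((p : ℝ) - k) := by
  have h := mem_sievePrimes.1 hp
  have : 2 * k ≤ p := by omega
  have : 2 * (k : ℝ) ≤ p := by exact_mod_cast this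
  linarith

theorem one_lt_of_mem_sievePrimes {D R p : ℕ} (hp : p ∈ sievePrimes D R) : (1 : ℝ) < p := by
  exact_mod_cast (mem_sievePrimes.1 hp).2.1.one_lt

/-- Write L ≤ (L - logSum S)_+ + logSum S, expand logSum S over the primes p ∈ S, detach p, and sum
over p by the Mertens bound. The factor 1 + κ/(j+1) matches the ratio expected when a Riesz sum of
order j and dimension κ grows like L^(κ+j)/((j+1)(j+2)⋯(j+κ)), so nothing is lost to leading order.
-/
theorem rieszSum_succ_ge (k : ℕ) : ∃ C : ℝ, 0 ≤ C ∧ ∀ D R : ℕ, 2 * k ≤ D → ∀ κ : ℝ, 0 ≤ κ →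
    ∀ L : ℝ, ∀ j : ℕ, 1 ≤ j →
      (L - κ * C) * rieszSum (sievePrimes D R) (fun p => κ / ((p : ℝ) - k)) L j ≤
        (1 + κ / (j + 1)) * rieszSum (sievePrimes D R) (fun p => κ / ((p : ℝ) - k)) L (j + 1) := by
  obtain ⟨C, hC, hM⟩ := sum_log_div_sub_le k
  refine ⟨C, hC, fun D R hD κ hκ L j hj => ?_⟩
  set P := sievePrimes D R
  set f : ℕ → ℝ := fun p => κ / ((p : ℝ) - k)
  have hf : ∀ p ∈ P, 0 ≤ f p := fun p hp =>
    div_nonneg hκ (sub_pos_of_mem_sievePrimes hD hp).le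
  have hF : ∀ S ∈ P.powerset, 0 ≤ ∏ p ∈ S, f p := fun S hS =>
    Finset.prod_nonneg fun p hp => hf p (Finset.mem_powerset.1 hS hp)
  have h1 : L * rieszSum P f L j ≤ rieszSum P f L (j + 1) +
      ∑ S ∈ P.powerset, (∏ p ∈ S, f p) * (logSum S * riesz L j S) := by
    rw [rieszSum, rieszSum, Finset.mul_sum, ← Finset.sum_add_distrib]
    refine Finset.sum_le_sum fun S hS => ?_
    have : L * riesz L j S ≤ riesz L (j + 1) S + logSum S * riesz L j S := by
      have e : riesz L (j + 1) S = riesz L j S * max 0 (L - logSum S) := pow_succ _ _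
      rw [e]
      nlinarith [riesz_nonneg L j S, le_max_right 0 (L - logSum S)]
    nlinarith [hF S hS]
  have h2 : ∑ S ∈ P.powerset, (∏ p ∈ S, f p) * (logSum S * riesz L j S) ≤
      ∑ T ∈ P.powerset, (∏ p ∈ T, f p) *
        ∑ p ∈ P, (f p * Real.log p) * (max 0 (L - logSum T - Real.log p)) ^ j := by
    have e1 : ∑ S ∈ P.powerset, (∏ p ∈ S, f p) * (logSum S * riesz L j S) =
        ∑ p ∈ P, ∑ S ∈ P.powerset with {p} ⊆ S,
          (∏ q ∈ S, f q) * (Real.log p * riesz L j S) := by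
      simp_rw [logSum, Finset.sum_mul, Finset.mul_sum]
      refine Finset.sum_comm' fun S p => ?_
      simp only [Finset.mem_powerset, Finset.mem_filter, Finset.singleton_subset_iff]
      exact ⟨fun h => ⟨h, h.1 h.2⟩, fun h => h.1⟩
    rw [e1]
    simp_rw [Finset.mul_sum]
    rw [Finset.sum_comm (s := P.powerset)]
    refine Finset.sum_le_sum fun p hp => ?_
    rw [sum_superset_eq (Finset.singleton_subset_iff.2 hp)]
    refine le_trans (le_of_eq ?_) (Finset.sum_le_sum_of_subset_of_nonneg
      (Finset.powerset_mono.2 (Finset.sdiff_subset (s := P) (t := {p}))) fun T hT _ => ?_)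
    · refine Finset.sum_congr rfl fun T hT => ?_
      have hd := disjoint_of_mem_powerset_sdiff hT
      rw [Finset.prod_union hd, Finset.prod_singleton, Finset.union_comm, riesz_union L j hd.symm]
      simp only [logSum, Finset.sum_singleton]
      ring
    · exact mul_nonneg (hF T hT) (mul_nonneg (mul_nonneg (hf p hp) (Real.log_natCast_nonneg p))
        (pow_nonneg (le_max_left _ _) _))
  have h3 : ∑ T ∈ P.powerset, (∏ p ∈ T, f p) *
        ∑ p ∈ P, (f p * Real.log p) * (max 0 (L - logSum T - Real.log p)) ^ j ≤
      ∑ T ∈ P.powerset, (∏ p ∈ T, f p) *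
        (κ / (j + 1) * riesz L (j + 1) T + κ * C * riesz L j T) := by
    refine Finset.sum_le_sum fun T hT => mul_le_mul_of_nonneg_left ?_ (hF T hT)
    have := sum_mul_riesz_le P (fun p => f p * Real.log p) (fun p => Real.log p)
      (fun p _ => Real.log_natCast_nonneg p) (α := κ) (C := κ * C) (Z := L - logSum T) hj (by
        intro t ht _
        have h := mul_le_mul_of_nonneg_left (hM D R hD t ht) hκ
        rw [Finset.mul_sum] at h
        refine le_trans (le_of_eq (Finset.sum_congr rfl fun p _ => ?_)) (h.trans (le_of_eq ?_))
        · simp only [f]; ring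
        · ring)
    refine this.trans (le_of_eq ?_)
    simp only [riesz]; ring
  have h4 : ∑ T ∈ P.powerset, (∏ p ∈ T, f p) *
        (κ / (j + 1) * riesz L (j + 1) T + κ * C * riesz L j T) =
      κ / (j + 1) * rieszSum P f L (j + 1) + κ * C * rieszSum P f L j := by
    rw [rieszSum, rieszSum, Finset.mul_sum, Finset.mul_sum, ← Finset.sum_add_distrib]
    exact Finset.sum_congr rfl fun T _ => by ring
  linarith

/-- The identity 1/(p-k) = 1/p + k/(p(p-k)) exhibits a convolution whose second factor has total
mass at most exp(2k/D). The leading coefficient therefore stays δ up to a factor tending to 1 with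
D. -/
theorem sum_prod_inv_sub_le {D R k : ℕ} (hD : 2 * k ≤ D) (hD0 : 0 < D) {t : ℝ} (ht : 0 ≤ t) :
    ∑ B ∈ (sievePrimes D R).powerset with logSum B ≤ t, ∏ p ∈ B, 1 / ((p : ℝ) - k) ≤
      Real.exp (2 * k / D) * (coprimeDensity (primorial D) * t + (primorial D + 1)) := by
  set P := sievePrimes D R
  set b : Finset ℕ → ℝ := fun B => if logSum B ≤ t then 1 / ∏ p ∈ B, (p : ℝ) else 0
  set a : Finset ℕ → ℝ := fun A => ∏ p ∈ A, (k : ℝ) / (p * (p - k))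
  have ha : ∀ A ∈ P.powerset, 0 ≤ a A := fun A hA => Finset.prod_nonneg fun p hp => by
    have := sub_pos_of_mem_sievePrimes hD (Finset.mem_powerset.1 hA hp)
    positivity
  have hb : ∀ B, 0 ≤ b B := fun B => by
    simp only [b]; split_ifs <;> positivity
  have h1 : ∑ B ∈ P.powerset with logSum B ≤ t, ∏ p ∈ B, 1 / ((p : ℝ) - k) ≤
      ∑ B ∈ P.powerset, ∑ A ∈ B.powerset, a A * b (B \ A) := by
    rw [Finset.sum_filter]
    refine Finset.sum_le_sum fun B hB => ?_
    have hBP := Finset.mem_powerset.1 hB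
    split_ifs with hBt
    · have e : ∏ p ∈ B, 1 / ((p : ℝ) - k) = ∏ p ∈ B, ((k : ℝ) / (p * (p - k)) + 1 / p) := by
        refine Finset.prod_congr rfl fun p hp => ?_
        have h1 := sub_pos_of_mem_sievePrimes hD (hBP hp)
        have h2 := one_lt_of_mem_sievePrimes (hBP hp)
        field_simp
        ring
      rw [e, Finset.prod_add]
      refine Finset.sum_le_sum fun A hA => ?_
      have hAB := Finset.mem_powerset.1 hA
      have : logSum (B \ A) ≤ t := by
        refine le_trans ?_ hBt
        exact Finset.sum_le_sum_of_subset_of_nonneg Finset.sdiff_subset fun _ _ _ =>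
          Real.log_natCast_nonneg _
      simp only [a, b, this, if_true]
      rw [Finset.prod_div_distrib (s := B \ A), Finset.prod_const_one]
    · exact Finset.sum_nonneg fun A hA => mul_nonneg
        (ha A (Finset.mem_powerset.2 ((Finset.mem_powerset.1 hA).trans hBP))) (hb _)
  refine h1.trans ((sum_powerset_split_le P (fun A B => a A * b B)
    fun A hA B _ => mul_nonneg (ha A hA) (hb B)).trans ?_)
  rw [← Finset.sum_mul_sum]
  have hsum2 : ∑ B ∈ P.powerset, b B ≤ coprimeDensity (primorial D) * t + (primorial D + 1) := by
    rw [← Finset.sum_filter]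
    exact (sum_inv_prod_le (fun p hp => (mem_sievePrimes.1 hp).2.1) t
      (fun n => n.Coprime (primorial D)) fun S hS => prod_coprime_primorial hS).trans
        (sum_inv_coprime_le (primorial_pos D) ht)
  refine mul_le_mul ?_ hsum2 (Finset.sum_nonneg fun _ _ => hb _) (Real.exp_pos _).le
  simp only [a]
  rw [sum_powerset_prod_one_add]
  refine le_trans (Finset.prod_le_prod (fun p hp => ?_) fun p hp => ?_)
    (prod_one_add_div_sq_le (R := R) hD0 (K := 2 * k) (by positivity))
  · have := sub_pos_of_mem_sievePrimes hD hp
    positivity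
  · have h1 := sub_pos_of_mem_sievePrimes hD hp
    have h2 := le_two_mul_sub_of_mem_sievePrimes hD hp
    have h3 := one_lt_of_mem_sievePrimes hp
    rw [add_le_add_iff_left, div_le_div_iff₀ (by positivity) (by positivity)]
    have : (0 : ℝ) ≤ k * p * (2 * (p - k) - p) := by
      have : 0 ≤ 2 * ((p : ℝ) - k) - p := by linarith
      positivity
    nlinarith

/-- Lowers the dimension by one: k/(p-k) = (k-1)/(p-k) + 1/(p-k) is a convolution whose second
factor has summatory function about δ t. Its Riesz mean gives the factor δ/(j+1) and raises the
order from j to j + 1. -/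
theorem rieszSum_le_of_dim {D R k : ℕ} (hk : 1 ≤ k) (hD : 2 * k ≤ D) (L : ℝ) {j : ℕ} (hj : 1 ≤ j) :
    rieszSum (sievePrimes D R) (fun p => (k : ℝ) / (p - k)) L j ≤
      Real.exp (2 * k / D) * (coprimeDensity (primorial D) / (j + 1)) *
          rieszSum (sievePrimes D R) (fun p => ((k : ℝ) - 1) / (p - k)) L (j + 1) +
        Real.exp (2 * k / D) * (primorial D + 1) *
          rieszSum (sievePrimes D R) (fun p => ((k : ℝ) - 1) / (p - k)) L j := by
  set P := sievePrimes D R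
  have hk1 : (0 : ℝ) ≤ k - 1 := by
    have : (1 : ℝ) ≤ k := by exact_mod_cast hk
    linarith
  have hf : ∀ S ∈ P.powerset, 0 ≤ ∏ p ∈ S, ((k : ℝ) - 1) / (p - k) := fun S hS =>
    Finset.prod_nonneg fun p hp => div_nonneg hk1
      (sub_pos_of_mem_sievePrimes hD (Finset.mem_powerset.1 hS hp)).le
  have hg : ∀ S ∈ P.powerset, 0 ≤ ∏ p ∈ S, 1 / ((p : ℝ) - k) := fun S hS =>
    Finset.prod_nonneg fun p hp => div_nonneg zero_le_one
      (sub_pos_of_mem_sievePrimes hD (Finset.mem_powerset.1 hS hp)).le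
  have h1 : rieszSum P (fun p => (k : ℝ) / (p - k)) L j =
      ∑ S ∈ P.powerset, ∑ A ∈ S.powerset, (∏ p ∈ A, ((k : ℝ) - 1) / (p - k)) *
        (∏ p ∈ S \ A, 1 / ((p : ℝ) - k)) * (max 0 (L - logSum A - logSum (S \ A))) ^ j := by
    refine Finset.sum_congr rfl fun S hS => ?_
    have e : ∏ p ∈ S, (k : ℝ) / (p - k) =
        ∏ p ∈ S, (((k : ℝ) - 1) / (p - k) + 1 / ((p : ℝ) - k)) :=
      Finset.prod_congr rfl fun p _ => by rw [← add_div, sub_add_cancel]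
    rw [e, Finset.prod_add, Finset.sum_mul]
    refine Finset.sum_congr rfl fun A hA => ?_
    rw [← riesz_union L j Finset.disjoint_sdiff,
      Finset.union_sdiff_of_subset (Finset.mem_powerset.1 hA)]
  rw [h1]
  refine (sum_powerset_split_le P (fun A B => (∏ p ∈ A, ((k : ℝ) - 1) / (p - k)) *
        (∏ p ∈ B, 1 / ((p : ℝ) - k)) * (max 0 (L - logSum A - logSum B)) ^ j)
    fun A hA B hB => mul_nonneg (mul_nonneg (hf A hA) (hg B hB))
      (pow_nonneg (le_max_left _ _) _)).trans ?_
  rw [rieszSum, rieszSum, Finset.mul_sum, Finset.mul_sum, ← Finset.sum_add_distrib]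
  refine Finset.sum_le_sum fun A hA => ?_
  have := sum_mul_riesz_le P.powerset (fun B => ∏ p ∈ B, 1 / ((p : ℝ) - k)) logSum
    (fun B _ => logSum_nonneg B) (α := Real.exp (2 * k / D) * coprimeDensity (primorial D))
    (C := Real.exp (2 * k / D) * (primorial D + 1)) (Z := L - logSum A) hj (by
      intro t ht _
      exact (sum_prod_inv_sub_le hD (by omega) ht).trans (le_of_eq (by ring)))
  have h2 := mul_le_mul_of_nonneg_left this (hf A hA)
  rw [Finset.mul_sum] at h2
  simp_rw [mul_assoc] at h2 ⊢
  refine h2.trans (le_of_eq ?_)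
  simp only [riesz]
  ring

theorem le_sum_union_riesz {D R : ℕ} (hR : 0 < R) {U : Finset ℕ} (hU : U ⊆ sievePrimes D R)
    {l : ℕ} (hl : 1 ≤ l) :
    coprimeDensity (primorial D) * riesz (Real.log R) (l + 1) U / (l + 1) ≤
      (∏ p ∈ U, (p : ℝ) / (p - 1)) * ∑ M ∈ (sievePrimes D R \ U).powerset,
        (∏ p ∈ M, 1 / ((p : ℝ) - 1)) * riesz (Real.log R) l (U ∪ M) := by
  have := le_sum_mul_riesz (sievePrimes D R \ U).powerset
    (fun M => (∏ p ∈ U, (p : ℝ) / (p - 1)) * ∏ p ∈ M, 1 / ((p : ℝ) - 1)) logSum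
    (fun B _ => logSum_nonneg B) (α := coprimeDensity (primorial D))
    (Z := Real.log R - logSum U) hl (by
      intro t _ ht
      rw [← Finset.mul_sum]
      exact le_sum_prod_inv_sub_one hR hU (ht.trans (by linarith [logSum_nonneg U])))
  refine this.trans (le_of_eq ?_)
  rw [Finset.mul_sum]
  refine Finset.sum_congr rfl fun M hM => ?_
  rw [riesz_union _ _ (disjoint_of_mem_powerset_sdiff hM), mul_assoc]

/-! ### Selberg's weights and the three quadratic forms -/

/-- Selberg's weights for a sieve of dimension `k`. -/
noncomputable def selbergWeight (P : Finset ℕ) (k : ℕ) (L : ℝ) (l : ℕ) (S : Finset ℕ) : ℝ :=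
  (∏ p ∈ S, -((p : ℝ) / k)) *
    ∑ V ∈ P.powerset with S ⊆ V, (∏ p ∈ V, (k : ℝ) / (p - k)) * riesz L l V

/-- The quadratic form of Selberg's sieve for the density `g`. -/
noncomputable def selbergForm (P : Finset ℕ) (k : ℕ) (L : ℝ) (l : ℕ) (g : ℕ → ℝ) : ℝ :=
  ∑ S ∈ P.powerset, ∑ T ∈ P.powerset,
    selbergWeight P k L l S * selbergWeight P k L l T * ∏ p ∈ S ∪ T, g p

/-- The weights are themselves superset sums, so composing them with the diagonalisation leaves, for
each U, one sum over M disjoint from U with local factor 1 - g(p) p/k. This factor vanishes for g =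
k/p, is about 1/k for g = (k-1)/(p-1), and is -1/(p-1) for g = k/(p-1); these three cases decide the
size of the forms below. -/
theorem selbergForm_eq (P : Finset ℕ) (k : ℕ) (L : ℝ) (l : ℕ) (g : ℕ → ℝ)
    (hg : ∀ p ∈ P, g p ≠ 0) :
    selbergForm P k L l g = ∑ U ∈ P.powerset, (∏ p ∈ U, (1 / g p - 1)) *
      ((∏ p ∈ U, (g p * (p / k))) * ((∏ p ∈ U, (k : ℝ) / (p - k)) *
        ∑ M ∈ (P \ U).powerset, (∏ p ∈ M, (k : ℝ) / (p - k) * (1 - g p * (p / k))) *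
          riesz L l (U ∪ M))) ^ 2 := by
  rw [selbergForm, quadForm_diagonal P g hg]
  refine Finset.sum_congr rfl fun U hU => ?_
  congr 1
  have e : ∑ S ∈ P.powerset with U ⊆ S, (∏ p ∈ S, g p) * selbergWeight P k L l S =
      ∑ S ∈ P.powerset with U ⊆ S, (∏ p ∈ S, -(g p * (p / k))) *
        ∑ V ∈ P.powerset with S ⊆ V, (∏ p ∈ V, (k : ℝ) / (p - k)) * riesz L l V := by
    refine Finset.sum_congr rfl fun S _ => ?_
    rw [selbergWeight, ← mul_assoc, ← Finset.prod_mul_distrib]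
    congr 1
    exact Finset.prod_congr rfl fun p _ => by ring
  rw [e, sum_superset_mul_sum_superset (Finset.mem_powerset.1 hU), Finset.prod_neg, mul_assoc,
    mul_pow, ← pow_mul, mul_comm U.card 2, pow_mul, neg_one_sq, one_pow, one_mul]
  congr 2
  rw [Finset.mul_sum]
  refine Finset.sum_congr rfl fun M hM => ?_
  rw [Finset.prod_union (disjoint_of_mem_powerset_sdiff hM), Finset.prod_mul_distrib]
  ring

theorem selbergForm_main {D R k : ℕ} (hk : 1 ≤ k) (hD : 2 * k ≤ D) (L : ℝ) (l : ℕ) :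
    selbergForm (sievePrimes D R) k L l (fun p => (k : ℝ) / p) =
      rieszSum (sievePrimes D R) (fun p => (k : ℝ) / (p - k)) L (2 * l) := by
  have hk0 : (0 : ℝ) < k := by exact_mod_cast hk
  rw [selbergForm_eq]
  · refine Finset.sum_congr rfl fun U hU => ?_
    have hUP := Finset.mem_powerset.1 hU
    have e1 : ∀ p ∈ sievePrimes D R, (k : ℝ) / p * (p / k) = 1 := fun p hp => by
      have := one_lt_of_mem_sievePrimes hp
      field_simp
    have e2 : ∏ p ∈ U, (k : ℝ) / p * (p / k) = 1 := Finset.prod_eq_one fun p hp => e1 p (hUP hp)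
    rw [e2, one_mul]
    -- For g = k/p every local factor on M is zero, so only M = ∅ survives.
    have e3 : ∑ M ∈ (sievePrimes D R \ U).powerset,
        (∏ p ∈ M, (k : ℝ) / (p - k) * (1 - (k : ℝ) / p * (p / k))) * riesz L l (U ∪ M) =
        riesz L l U := by
      rw [Finset.sum_eq_single_of_mem ∅ (Finset.empty_mem_powerset _)]
      · simp
      · intro M hM hne
        obtain ⟨p, hp⟩ := Finset.nonempty_iff_ne_empty.2 hne
        have hpP := (Finset.mem_sdiff.1 (Finset.mem_powerset.1 hM hp)).1
        rw [Finset.prod_eq_zero hp (by rw [e1 p hpP]; ring), zero_mul]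
    rw [e3, mul_pow, ← mul_assoc]
    congr 1
    · rw [← Finset.prod_pow, ← Finset.prod_mul_distrib]
      refine Finset.prod_congr rfl fun p hp => ?_
      have h1 := sub_pos_of_mem_sievePrimes hD (hUP hp)
      have h2 := one_lt_of_mem_sievePrimes (hUP hp)
      field_simp
    · simp only [riesz]; rw [← pow_mul, mul_comm]
  · intro p hp
    have := one_lt_of_mem_sievePrimes hp
    positivity

/-- Here the local factor on M is exactly 1/(p-1), so the inner sum is one-dimensional and
`le_sum_union_riesz` bounds it below, raising the order from l to l + 1. The factor p/(p-1) on U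
required there is exactly what the diagonal coefficients leave over, and squaring gives the order 2l
+ 2. -/
theorem le_selbergForm_prime {D R k : ℕ} (hR : 0 < R) (hk : 2 ≤ k) (hD : 2 * k ≤ D) {l : ℕ}
    (hl : 1 ≤ l) :
    (coprimeDensity (primorial D) / (l + 1)) ^ 2 *
        rieszSum (sievePrimes D R) (fun p => ((k : ℝ) - 1) / (p - k)) (Real.log R) (2 * l + 2) ≤
      selbergForm (sievePrimes D R) k (Real.log R) l (fun p => ((k : ℝ) - 1) / (p - 1)) := by
  have hk2 : (2 : ℝ) ≤ k := by exact_mod_cast hk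
  have hk1 : (k : ℝ) - 1 ≠ 0 := by linarith
  have hk0 : (k : ℝ) ≠ 0 := by linarith
  rw [selbergForm_eq]
  · rw [rieszSum, Finset.mul_sum]
    refine Finset.sum_le_sum fun U hU => ?_
    have hUP := Finset.mem_powerset.1 hU
    have h := le_sum_union_riesz hR hUP hl
    have h0 : (0 : ℝ) ≤ coprimeDensity (primorial D) * riesz (Real.log R) (l + 1) U / (l + 1) := by
      have := riesz_nonneg (Real.log R) (l + 1) U
      unfold coprimeDensity; positivity
    have hsq := pow_le_pow_left₀ h0 h 2
    have e1 : ∀ p ∈ sievePrimes D R,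
        (k : ℝ) / (p - k) * (1 - ((k : ℝ) - 1) / (p - 1) * (p / k)) = 1 / ((p : ℝ) - 1) := by
      intro p hp
      have h1 := sub_pos_of_mem_sievePrimes hD hp
      have h2 : (p : ℝ) - 1 ≠ 0 := by linarith [one_lt_of_mem_sievePrimes hp]
      have h3 := h1.ne'
      field_simp
      ring
    have e2 : ∑ M ∈ (sievePrimes D R \ U).powerset,
        (∏ p ∈ M, (k : ℝ) / (p - k) * (1 - ((k : ℝ) - 1) / (p - 1) * (p / k))) *
          riesz (Real.log R) l (U ∪ M) = ∑ M ∈ (sievePrimes D R \ U).powerset,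
        (∏ p ∈ M, 1 / ((p : ℝ) - 1)) * riesz (Real.log R) l (U ∪ M) := by
      refine Finset.sum_congr rfl fun M hM => ?_
      rw [Finset.prod_congr rfl fun p hp =>
        e1 p (Finset.mem_sdiff.1 (Finset.mem_powerset.1 hM hp)).1]
    rw [e2]
    set X := ∑ M ∈ (sievePrimes D R \ U).powerset,
        (∏ p ∈ M, 1 / ((p : ℝ) - 1)) * riesz (Real.log R) l (U ∪ M)
    have e3 : (∏ p ∈ U, (1 / (((k : ℝ) - 1) / (p - 1)) - 1)) *
        ((∏ p ∈ U, ((k : ℝ) - 1) / (p - 1) * (p / k)) *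
          ((∏ p ∈ U, (k : ℝ) / (p - k)) * X)) ^ 2 =
        (∏ p ∈ U, ((k : ℝ) - 1) / (p - k)) * ((∏ p ∈ U, (p : ℝ) / (p - 1)) * X) ^ 2 := by
      rw [← mul_assoc (∏ p ∈ U, ((k : ℝ) - 1) / (p - 1) * (p / k)),
        ← Finset.prod_mul_distrib, mul_pow, mul_pow, ← mul_assoc, ← mul_assoc, ← Finset.prod_pow,
        ← Finset.prod_pow, ← Finset.prod_mul_distrib, ← Finset.prod_mul_distrib]
      congr 1
      refine Finset.prod_congr rfl fun p hp => ?_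
      have h1 := (sub_pos_of_mem_sievePrimes hD (hUP hp)).ne'
      have h2 : (p : ℝ) - 1 ≠ 0 := by linarith [one_lt_of_mem_sievePrimes (hUP hp)]
      field_simp
      ring
    rw [e3]
    have hF : 0 ≤ ∏ p ∈ U, ((k : ℝ) - 1) / (p - k) := Finset.prod_nonneg fun p hp =>
      div_nonneg (by linarith) (sub_pos_of_mem_sievePrimes hD (hUP hp)).le
    refine le_trans (le_of_eq ?_) (mul_le_mul_of_nonneg_left hsq hF)
    simp only [riesz]
    ring
  · intro p hp
    have h2 : (p : ℝ) - 1 ≠ 0 := by linarith [one_lt_of_mem_sievePrimes hp]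
    exact div_ne_zero hk1 h2

theorem sum_prod_mul_one_add_le {D R k : ℕ} (hD : 2 * k ≤ D) (hD0 : 0 < D) (L : ℝ) (j : ℕ) :
    ∑ U ∈ (sievePrimes D R).powerset,
        (∏ p ∈ U, (k : ℝ) / (p - k) * (1 + 4 / p)) * riesz L j U ≤
      Real.exp (8 * k / D) * rieszSum (sievePrimes D R) (fun p => (k : ℝ) / (p - k)) L j := by
  set P := sievePrimes D R
  set a : Finset ℕ → ℝ := fun A => ∏ p ∈ A, (k : ℝ) / (p - k) * (4 / p)
  have hpos : ∀ p ∈ P, 0 ≤ (k : ℝ) / (p - k) := fun p hp => by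
    have := sub_pos_of_mem_sievePrimes hD hp
    positivity
  have ha : ∀ A ∈ P.powerset, 0 ≤ a A := fun A hA => Finset.prod_nonneg fun p hp =>
    mul_nonneg (hpos p (Finset.mem_powerset.1 hA hp)) (by positivity)
  have hb : ∀ A ∈ P.powerset, 0 ≤ ∏ p ∈ A, (k : ℝ) / (p - k) := fun A hA =>
    Finset.prod_nonneg fun p hp => hpos p (Finset.mem_powerset.1 hA hp)
  have h1 : ∑ U ∈ P.powerset, (∏ p ∈ U, (k : ℝ) / (p - k) * (1 + 4 / p)) * riesz L j U ≤
      ∑ U ∈ P.powerset, ∑ A ∈ U.powerset,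
        a A * ((∏ p ∈ U \ A, (k : ℝ) / (p - k)) * riesz L j (U \ A)) := by
    refine Finset.sum_le_sum fun U hU => ?_
    have e : ∏ p ∈ U, (k : ℝ) / (p - k) * (1 + 4 / p) =
        ∏ p ∈ U, ((k : ℝ) / (p - k) * (4 / p) + (k : ℝ) / (p - k)) :=
      Finset.prod_congr rfl fun p _ => by ring
    rw [e, Finset.prod_add, Finset.sum_mul]
    refine Finset.sum_le_sum fun A hA => ?_
    have hA' : A ∈ P.powerset :=
      Finset.mem_powerset.2 ((Finset.mem_powerset.1 hA).trans (Finset.mem_powerset.1 hU))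
    have hUA : U \ A ∈ P.powerset :=
      Finset.mem_powerset.2 (Finset.sdiff_subset.trans (Finset.mem_powerset.1 hU))
    rw [mul_assoc]
    exact mul_le_mul_of_nonneg_left (mul_le_mul_of_nonneg_left
      (riesz_anti L j Finset.sdiff_subset) (hb _ hUA)) (ha A hA')
  refine h1.trans ((sum_powerset_split_le P (fun A B =>
    a A * ((∏ p ∈ B, (k : ℝ) / (p - k)) * riesz L j B)) fun A hA B hB =>
      mul_nonneg (ha A hA) (mul_nonneg (hb B hB) (riesz_nonneg _ _ _))).trans ?_)
  rw [← Finset.sum_mul_sum]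
  refine mul_le_mul_of_nonneg_right ?_ (rieszSum_nonneg hpos L j)
  simp only [a]
  rw [sum_powerset_prod_one_add]
  refine le_trans (Finset.prod_le_prod (fun p hp => ?_) fun p hp => ?_)
    (prod_one_add_div_sq_le (R := R) hD0 (K := 8 * k) (by positivity))
  · have := hpos p hp
    positivity
  · have h1 := sub_pos_of_mem_sievePrimes hD hp
    have h2 := le_two_mul_sub_of_mem_sievePrimes hD hp
    have h3 := one_lt_of_mem_sievePrimes hp
    rw [add_le_add_iff_left, div_mul_div_comm, div_le_div_iff₀ (by positivity) (by positivity)]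
    have : (0 : ℝ) ≤ k * p * (2 * (p - k) - p) := by
      have : 0 ≤ 2 * ((p : ℝ) - k) - p := by linarith
      positivity
    nlinarith

/-- An upper bound for the form attached to the primes in a translate outside the tuple. -/
theorem selbergForm_shift_le {D R k : ℕ} (hk : 2 ≤ k) (hD : 2 * k ≤ D) (L : ℝ) (l : ℕ)
    (ρ : ℕ → ℕ) (hρ : ∀ p ∈ sievePrimes D R, ρ p = k ∨ ρ p + 1 = k) :
    selbergForm (sievePrimes D R) k L l (fun p => (ρ p : ℝ) / (p - 1)) ≤
      Real.exp (16 * k / D) *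
        (∏ p ∈ (sievePrimes D R).filter (fun p => ρ p + 1 = k), (1 + 1 / ((p : ℝ) - 1))) ^ 2 *
        rieszSum (sievePrimes D R) (fun p => (k : ℝ) / (p - k)) L (2 * l) := by
  set P := sievePrimes D R with hP
  set B := P.filter (fun p => ρ p + 1 = k) with hB
  have hk2 : (2 : ℝ) ≤ k := by exact_mod_cast hk
  have hk0 : (k : ℝ) ≠ 0 := by linarith
  have hD0 : 0 < D := by omega
  have hρ1 : ∀ p ∈ P, (ρ p : ℝ) = k ∨ (ρ p : ℝ) = k - 1 := fun p hp => by
    rcases hρ p hp with h | h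
    · left; exact_mod_cast h
    · right; rw [eq_sub_iff_add_eq]; exact_mod_cast h
  have hρpos : ∀ p ∈ P, (0 : ℝ) < ρ p := fun p hp => by
    rcases hρ1 p hp with h | h <;> rw [h] <;> linarith
  -- Bounds the local factor on M: 1/(p-1) at the exceptional primes, where ρ(p) = k - 1, but of
  -- order k/p² at all others. The sum over M is thus bounded up to a product over exceptional
  -- primes, and no logarithm is gained over the form for g = k/p.
  set e : ℕ → ℝ := fun p => if ρ p + 1 = k then 1 / ((p : ℝ) - 1)
    else (k : ℝ) / ((p - k) * (p - 1))
  have he0 : ∀ p ∈ P, 0 ≤ e p := fun p hp => by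
    have h1 := sub_pos_of_mem_sievePrimes hD hp
    have h2 : (0 : ℝ) < p - 1 := by linarith [one_lt_of_mem_sievePrimes hp]
    simp only [e]; split_ifs <;> positivity
  have he : ∀ p ∈ P, |(k : ℝ) / (p - k) * (1 - (ρ p : ℝ) / (p - 1) * (p / k))| ≤ e p := by
    intro p hp
    have h1 := sub_pos_of_mem_sievePrimes hD hp
    have h2 : (0 : ℝ) < p - 1 := by linarith [one_lt_of_mem_sievePrimes hp]
    have h1' := h1.ne'
    have h2' := h2.ne'
    have : (k : ℝ) / (p - k) * (1 - (ρ p : ℝ) / (p - 1) * (p / k)) =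
        (k * (p - 1) - ρ p * p) / ((p - k) * (p - 1)) := by
      field_simp
    rw [this]
    simp only [e]
    split_ifs with h
    · have h' : (ρ p : ℝ) = k - 1 := by rw [eq_sub_iff_add_eq]; exact_mod_cast h
      rw [h', show (k : ℝ) * (p - 1) - (k - 1) * p = p - k by ring, ← div_div, div_self h1',
        abs_of_nonneg (by positivity)]
    · have h' : (ρ p : ℝ) = k := by
        have := (hρ p hp).resolve_right h
        exact_mod_cast this
      rw [h', show (k : ℝ) * (p - 1) - k * p = -k by ring, abs_div, abs_neg,
        abs_of_nonneg (by positivity : (0 : ℝ) ≤ k), abs_of_nonneg (by positivity)]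
  have heprod : ∏ p ∈ P, (1 + e p) ≤ (∏ p ∈ B, (1 + 1 / ((p : ℝ) - 1))) * Real.exp (4 * k / D) := by
    have hB1 : ∀ p ∈ P, 0 < (p : ℝ) - 1 := fun p hp => by linarith [one_lt_of_mem_sievePrimes hp]
    calc ∏ p ∈ P, (1 + e p) ≤ ∏ p ∈ P, ((if ρ p + 1 = k then 1 + 1 / ((p : ℝ) - 1) else 1) *
          (1 + 4 * k / (p : ℝ) ^ 2)) := by
          refine Finset.prod_le_prod (fun p hp => by linarith [he0 p hp]) fun p hp => ?_
          have h1 := sub_pos_of_mem_sievePrimes hD hp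
          have h2 := hB1 p hp
          simp only [e]
          split_ifs with h
          · exact le_mul_of_one_le_right (by positivity) (by
              have : (0 : ℝ) ≤ 4 * k / (p : ℝ) ^ 2 := by positivity
              linarith)
          · rw [one_mul, add_le_add_iff_left]
            have h3 := le_two_mul_sub_of_mem_sievePrimes hD hp
            have h4 : (2 : ℝ) ≤ p := by exact_mod_cast (mem_sievePrimes.1 hp).2.1.two_le
            rw [div_le_div_iff₀ (by positivity) (by positivity)]
            have h5 : (p : ℝ) * p ≤ (2 * (p - k)) * (2 * (p - 1)) :=
              mul_le_mul h3 (by linarith) (by linarith) (by linarith)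
            nlinarith
      _ = (∏ p ∈ B, (1 + 1 / ((p : ℝ) - 1))) * ∏ p ∈ P, (1 + 4 * k / (p : ℝ) ^ 2) := by
          rw [Finset.prod_mul_distrib, hB, Finset.prod_filter]
      _ ≤ _ := mul_le_mul_of_nonneg_left (prod_one_add_div_sq_le hD0 (by positivity))
          (Finset.prod_nonneg fun p hp => by
            have := hB1 p (Finset.mem_filter.1 hp).1
            positivity)
  set E := (∏ p ∈ B, (1 + 1 / ((p : ℝ) - 1))) * Real.exp (4 * k / D)
  have hX : ∀ U ∈ P.powerset, |∑ M ∈ (P \ U).powerset,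
      (∏ p ∈ M, (k : ℝ) / (p - k) * (1 - (ρ p : ℝ) / (p - 1) * (p / k))) * riesz L l (U ∪ M)| ≤
      E * riesz L l U := by
    intro U hU
    refine (Finset.abs_sum_le_sum_abs _ _).trans ?_
    calc _ ≤ ∑ M ∈ (P \ U).powerset, (∏ p ∈ M, e p) * riesz L l U := by
          refine Finset.sum_le_sum fun M hM => ?_
          have hMP : M ⊆ P := (Finset.mem_powerset.1 hM).trans Finset.sdiff_subset
          rw [abs_mul, abs_of_nonneg (riesz_nonneg _ _ _), Finset.abs_prod]
          refine mul_le_mul (Finset.prod_le_prod (fun _ _ => abs_nonneg _) fun p hp => he p (hMP hp))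
            (riesz_anti L l Finset.subset_union_left) (riesz_nonneg _ _ _)
            (Finset.prod_nonneg fun p hp => he0 p (hMP hp))
      _ ≤ ∑ M ∈ P.powerset, (∏ p ∈ M, e p) * riesz L l U :=
          Finset.sum_le_sum_of_subset_of_nonneg (Finset.powerset_mono.2 Finset.sdiff_subset)
            fun M hM _ => mul_nonneg (Finset.prod_nonneg fun p hp =>
              he0 p (Finset.mem_powerset.1 hM hp)) (riesz_nonneg _ _ _)
      _ = (∏ p ∈ P, (1 + e p)) * riesz L l U := by
          rw [← Finset.sum_mul, sum_powerset_prod_one_add]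
      _ ≤ _ := mul_le_mul_of_nonneg_right heprod (riesz_nonneg _ _ _)
  rw [selbergForm_eq]
  · calc _ ≤ ∑ U ∈ P.powerset, E ^ 2 * ((∏ p ∈ U, (k : ℝ) / (p - k) * (1 + 4 / p)) *
          riesz L (2 * l) U) := by
          refine Finset.sum_le_sum fun U hU => ?_
          have hUP := Finset.mem_powerset.1 hU
          rw [← mul_assoc (∏ p ∈ U, (ρ p : ℝ) / (p - 1) * (p / k)), mul_pow, ← mul_assoc,
            ← Finset.prod_mul_distrib, ← Finset.prod_pow, ← Finset.prod_mul_distrib]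
          have h1 := hX U hU
          rw [← sq_abs (∑ M ∈ (P \ U).powerset, _ * riesz L l (U ∪ M))]
          have h2 := pow_le_pow_left₀ (abs_nonneg _) h1 2
          have key : ∀ p ∈ U, 0 ≤ (1 / ((ρ p : ℝ) / (p - 1)) - 1) *
              ((ρ p : ℝ) / (p - 1) * (p / k) * (k / (p - k))) ^ 2 ∧
              (1 / ((ρ p : ℝ) / (p - 1)) - 1) *
              ((ρ p : ℝ) / (p - 1) * (p / k) * (k / (p - k))) ^ 2 ≤ k / (p - k) * (1 + 4 / p) := by
            intro p hp
            have hpP := hUP hp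
            have g1 := sub_pos_of_mem_sievePrimes hD hpP
            have g2 : (0 : ℝ) < p - 1 := by linarith [one_lt_of_mem_sievePrimes hpP]
            have g3 := hρpos p hpP
            have g1' := g1.ne'
            have g2' := g2.ne'
            have g3' := g3.ne'
            have g4 : (0 : ℝ) < p := by linarith
            have g5 : (3 : ℝ) ≤ p := by
              have : D < p := (mem_sievePrimes.1 hpP).2.2
              have : 3 ≤ p := by omega
              exact_mod_cast this
            have g6 : (2 : ℝ) * k ≤ p := by
              have : D < p := (mem_sievePrimes.1 hpP).2.2
              have : 2 * k ≤ p := by omega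
              exact_mod_cast this
            have eq : (1 / ((ρ p : ℝ) / (p - 1)) - 1) *
                ((ρ p : ℝ) / (p - 1) * (p / k) * (k / (p - k))) ^ 2 =
                (ρ p / (p - k)) * ((p - 1 - ρ p) / (p - k)) * (p ^ 2 / (p - 1) ^ 2) := by
              field_simp
            rw [eq]
            have b1 : (ρ p : ℝ) / (p - k) ≤ k / (p - k) := by
              refine div_le_div_of_nonneg_right ?_ g1.le
              rcases hρ1 p hpP with h | h <;> rw [h] <;> linarith
            have b2 : (p - 1 - (ρ p : ℝ)) / (p - k) ≤ 1 := by
              rw [div_le_one g1]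
              rcases hρ1 p hpP with h | h <;> rw [h] <;> linarith
            have b2' : 0 ≤ (p - 1 - (ρ p : ℝ)) / (p - k) := by
              refine div_nonneg ?_ g1.le
              rcases hρ1 p hpP with h | h <;> rw [h] <;> linarith
            have b3 : (p : ℝ) ^ 2 / (p - 1) ^ 2 ≤ 1 + 4 / p := by
              rw [div_le_iff₀ (by positivity), show (1 : ℝ) + 4 / p = (p + 4) / p by field_simp,
                div_mul_eq_mul_div, le_div_iff₀ g4]
              nlinarith
            refine ⟨by positivity, ?_⟩
            refine mul_le_mul ?_ b3 (by positivity) (by positivity)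
            calc _ ≤ (k : ℝ) / (p - k) * 1 := mul_le_mul b1 b2 b2' (by positivity)
              _ = _ := mul_one _
          have h3 := Finset.prod_le_prod (fun p hp => (key p hp).1) fun p hp => (key p hp).2
          refine (mul_le_mul h3 h2 (by positivity) (Finset.prod_nonneg fun p hp =>
            (key p hp).1.trans (key p hp).2)).trans (le_of_eq ?_)
          simp only [riesz]
          ring
      _ ≤ E ^ 2 * (Real.exp (8 * k / D) * rieszSum P (fun p => (k : ℝ) / (p - k)) L (2 * l)) := by
          rw [← Finset.mul_sum]
          exact mul_le_mul_of_nonneg_left (sum_prod_mul_one_add_le hD hD0 L _) (by positivity)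
      _ = _ := by
          have : Real.exp (16 * k / D) = Real.exp (4 * k / D) ^ 2 * Real.exp (8 * k / D) := by
            rw [← Real.exp_nat_mul, ← Real.exp_add]
            congr 1
            push_cast
            ring
          rw [this]
          simp only [E]
          ring
  · intro p hp
    have h2 : (p : ℝ) - 1 ≠ 0 := by linarith [one_lt_of_mem_sievePrimes hp]
    exact div_ne_zero (hρpos p hp).ne' h2

/-! ### The sieve weight and counting in residue classes -/

/-- Every prime of `S` divides one of the numbers `n + h i`. -/
def TupleDvd {k : ℕ} (h : Fin k → ℕ) (S : Finset ℕ) (n : ℕ) : Prop := ∀ p ∈ S, ∃ i, p ∣ n + h i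

instance {k : ℕ} (h : Fin k → ℕ) (S : Finset ℕ) (n : ℕ) : Decidable (TupleDvd h S n) := by
  unfold TupleDvd; infer_instance

/-- The nonnegative sieve weight `(∑_{d ∣ ∏ (n + h i)} λ_d) ^ 2`. -/
noncomputable def sieveWeight {k : ℕ} (P : Finset ℕ) (L : ℝ) (l : ℕ) (h : Fin k → ℕ) (n : ℕ) : ℝ :=
  (∑ S ∈ P.powerset with TupleDvd h S n, selbergWeight P k L l S) ^ 2

theorem sieveWeight_nonneg {k : ℕ} (P : Finset ℕ) (L : ℝ) (l : ℕ) (h : Fin k → ℕ) (n : ℕ) :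
    0 ≤ sieveWeight P L l h n := sq_nonneg _

theorem tupleDvd_union {k : ℕ} (h : Fin k → ℕ) (S T : Finset ℕ) (n : ℕ) :
    TupleDvd h (S ∪ T) n ↔ TupleDvd h S n ∧ TupleDvd h T n := by
  simp only [TupleDvd, Finset.mem_union]
  exact ⟨fun H => ⟨fun p hp => H p (Or.inl hp), fun p hp => H p (Or.inr hp)⟩,
    fun H p hp => hp.elim (H.1 p) (H.2 p)⟩

theorem sum_mul_sieveWeight {k : ℕ} (P : Finset ℕ) (L : ℝ) (l : ℕ) (h : Fin k → ℕ)
    (N : Finset ℕ) (c : ℕ → ℝ) :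
    ∑ n ∈ N, c n * sieveWeight P L l h n = ∑ S ∈ P.powerset, ∑ T ∈ P.powerset,
      selbergWeight P k L l S * selbergWeight P k L l T *
        ∑ n ∈ N with TupleDvd h (S ∪ T) n, c n := by
  have key : ∀ n, c n * sieveWeight P L l h n = ∑ S ∈ P.powerset, ∑ T ∈ P.powerset,
      selbergWeight P k L l S * selbergWeight P k L l T *
        (if TupleDvd h (S ∪ T) n then c n else 0) := by
    intro n
    rw [sieveWeight, sq, Finset.sum_filter, Finset.sum_mul_sum, Finset.mul_sum]
    refine Finset.sum_congr rfl fun S _ => ?_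
    rw [Finset.mul_sum]
    refine Finset.sum_congr rfl fun T _ => ?_
    simp only [tupleDvd_union]
    by_cases a : TupleDvd h S n <;> by_cases b : TupleDvd h T n <;> simp [a, b]
    ring
  rw [Finset.sum_congr rfl fun n _ => key n, Finset.sum_comm]
  refine Finset.sum_congr rfl fun S _ => ?_
  rw [Finset.sum_comm]
  refine Finset.sum_congr rfl fun T _ => ?_
  rw [← Finset.mul_sum, Finset.sum_filter]

theorem card_filter_mod_mul {m p : ℕ} (hm : 0 < m) (hp : 0 < p) (hmp : m.Coprime p) (A B : ℕ → Prop)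
    [DecidablePred A] [DecidablePred B] :
    ((Finset.range (m * p)).filter fun n => A (n % m) ∧ B (n % p)).card =
      ((Finset.range m).filter A).card * ((Finset.range p).filter B).card := by
  rw [← Finset.card_product]
  refine Finset.card_bij (fun n _ => (n % m, n % p)) ?_ ?_ ?_
  · intro n hn
    simp only [Finset.mem_filter, Finset.mem_range, Finset.mem_product] at hn ⊢
    exact ⟨⟨Nat.mod_lt _ hm, hn.2.1⟩, Nat.mod_lt _ hp, hn.2.2⟩
  · intro a ha b hb hab
    simp only [Finset.mem_filter, Finset.mem_range, Prod.mk.injEq] at ha hb hab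
    have := (Nat.modEq_and_modEq_iff_modEq_mul hmp).1 ⟨hab.1, hab.2⟩
    exact Nat.ModEq.eq_of_lt_of_lt this ha.1 hb.1
  · rintro ⟨a, b⟩ hab
    simp only [Finset.mem_filter, Finset.mem_range, Finset.mem_product] at hab
    obtain ⟨⟨ha, hA⟩, hb, hB⟩ := hab
    have h1 := (Nat.chineseRemainder hmp a b).2
    have h1a : (Nat.chineseRemainder hmp a b : ℕ) % m = a := by
      rw [show _ % m = a % m from h1.1, Nat.mod_eq_of_lt ha]
    have h1b : (Nat.chineseRemainder hmp a b : ℕ) % p = b := by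
      rw [show _ % p = b % p from h1.2, Nat.mod_eq_of_lt hb]
    refine ⟨Nat.chineseRemainder hmp a b, ?_, ?_⟩
    · simp only [Finset.mem_filter, Finset.mem_range]
      exact ⟨Nat.chineseRemainder_lt_mul hmp a b hm.ne' hp.ne', by rwa [h1a], by rwa [h1b]⟩
    · rw [h1a, h1b]

theorem card_filter_mod_prod {W w : ℕ} (hw : w < W) (V : Finset ℕ) (hV : ∀ p ∈ V, p.Prime)
    (hVW : ∀ p ∈ V, p.Coprime W) (B : ℕ → ℕ → Prop) [∀ p, DecidablePred (B p)] :
    ((Finset.range (W * ∏ p ∈ V, p)).filter fun n => n % W = w ∧ ∀ p ∈ V, B p (n % p)).card =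
      ∏ p ∈ V, ((Finset.range p).filter (B p)).card := by
  induction V using Finset.induction_on with
  | empty =>
    simp only [Finset.prod_empty, mul_one, Finset.notMem_empty, IsEmpty.forall_iff, implies_true,
      and_true]
    rw [Finset.card_eq_one]
    refine ⟨w, ?_⟩
    ext n
    simp only [Finset.mem_filter, Finset.mem_range, Finset.mem_singleton]
    constructor
    · rintro ⟨a, b⟩; rwa [Nat.mod_eq_of_lt a] at b
    · rintro rfl; exact ⟨hw, Nat.mod_eq_of_lt hw⟩
  | insert q V hq ih =>
    have ih := ih (fun p hp => hV p (Finset.mem_insert_of_mem hp))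
      (fun p hp => hVW p (Finset.mem_insert_of_mem hp))
    have hqp := hV q (Finset.mem_insert_self q V)
    have hVp : ∀ p ∈ V, p.Prime := fun p hp => hV p (Finset.mem_insert_of_mem hp)
    set m := W * ∏ p ∈ V, p
    have hm : 0 < m := Nat.mul_pos (by omega) (prod_primes_pos hVp)
    have hcop : m.Coprime q := by
      refine Nat.Coprime.mul_left (hVW q (Finset.mem_insert_self q V)).symm ?_
      exact Nat.Coprime.prod_left fun p hp => (Nat.coprime_primes (hVp p hp) hqp).2
        (fun h => hq (h ▸ hp))
    rw [Finset.prod_insert hq, Finset.prod_insert hq, ← ih, mul_comm (Finset.card _),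
      ← card_filter_mod_mul hm hqp.pos hcop, mul_comm q, ← mul_assoc]
    congr 1
    refine Finset.filter_congr fun n _ => ?_
    simp only [Finset.mem_insert, forall_eq_or_imp, m]
    rw [Nat.mod_mul_right_mod]
    have : ∀ p ∈ V, n % (W * ∏ p ∈ V, p) % p = n % p := fun p hp =>
      Nat.mod_mod_of_dvd _ ((Finset.dvd_prod_of_mem _ hp).mul_left _)
    constructor
    · rintro ⟨a, b, c⟩
      exact ⟨⟨a, fun p hp => by rw [this p hp]; exact c p hp⟩, b⟩
    · rintro ⟨⟨a, c⟩, b⟩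
      exact ⟨a, b, fun p hp => by have := this p hp; rw [← this]; exact c p hp⟩

theorem card_roots {k p : ℕ} (hp : 0 < p) (h : Fin k → ℕ)
    (hinj : ∀ i j, h i ≡ h j [MOD p] → i = j) (s : ℕ) :
    ((Finset.range p).filter fun b => ∃ i, b + h i ≡ s [MOD p]).card = k := by
  have hex : ∀ i, ∃ b, b < p ∧ b + h i ≡ s [MOD p] := by
    intro i
    refine ⟨(s + (p - h i % p)) % p, Nat.mod_lt _ hp, ?_⟩
    have h1 : (s + (p - h i % p)) % p + h i ≡ s + (p - h i % p) + h i % p [MOD p] :=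
      (Nat.mod_modEq _ _).add (Nat.mod_modEq _ _).symm
    refine h1.trans ?_
    have : s + (p - h i % p) + h i % p = s + p := by
      have := (Nat.mod_lt (h i) hp).le
      omega
    rw [this]
    exact Nat.add_modEq_right
  choose b hb1 hb2 using hex
  have : (Finset.range p).filter (fun b => ∃ i, b + h i ≡ s [MOD p]) = Finset.univ.image b := by
    ext c
    simp only [Finset.mem_filter, Finset.mem_range, Finset.mem_image, Finset.mem_univ, true_and]
    constructor
    · rintro ⟨hc, i, hi⟩
      refine ⟨i, ?_⟩
      have : b i ≡ c [MOD p] := Nat.ModEq.add_right_cancel' (h i) ((hb2 i).trans hi.symm)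
      exact this.eq_of_lt_of_lt (hb1 i) hc
    · rintro ⟨i, rfl⟩
      exact ⟨hb1 i, i, hb2 i⟩
  rw [this, Finset.card_image_of_injective, Finset.card_univ, Fintype.card_fin]
  intro i j hij
  refine hinj i j (Nat.ModEq.add_left_cancel' (b i) ((hb2 i).trans ?_))
  rw [hij]; exact (hb2 j).symm

/-- The number of nonzero residues `b` modulo `p` with `b + h i ≡ s` for some `i`. -/
def unitRoots {k : ℕ} (h : Fin k → ℕ) (s p : ℕ) : ℕ :=
  ((Finset.range p).filter fun b => b ≠ 0 ∧ ∃ i, b + h i ≡ s [MOD p]).card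

/-- The k roots s - h_i are distinct modulo p, and exactly one of them is zero when s meets the
tuple modulo p. So the local density has k - 1 roots at these primes and k elsewhere, which is the
dichotomy assumed in `selbergForm_shift_le`. -/
theorem unitRoots_of_modEq {k p : ℕ} (hp : 0 < p) (h : Fin k → ℕ)
    (hinj : ∀ i j, h i ≡ h j [MOD p] → i = j) {s : ℕ} (hs : ∃ i, h i ≡ s [MOD p]) :
    unitRoots h s p + 1 = k := by
  have h1 := card_roots hp h hinj s
  have h2 : 0 ∈ (Finset.range p).filter fun b => ∃ i, b + h i ≡ s [MOD p] := by
    simp only [Finset.mem_filter, Finset.mem_range, zero_add]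
    exact ⟨hp, hs⟩
  have h3 := Finset.card_erase_add_one h2
  rw [h1] at h3
  refine Eq.trans ?_ h3
  rw [unitRoots]
  congr 2
  ext b
  simp only [Finset.mem_filter, Finset.mem_range, Finset.mem_erase]
  tauto

theorem unitRoots_of_not_modEq {k p : ℕ} (hp : 0 < p) (h : Fin k → ℕ)
    (hinj : ∀ i j, h i ≡ h j [MOD p] → i = j) {s : ℕ} (hs : ¬ ∃ i, h i ≡ s [MOD p]) :
    unitRoots h s p = k := by
  refine Eq.trans ?_ (card_roots hp h hinj s)
  rw [unitRoots]
  congr 1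
  refine Finset.filter_congr fun b _ => ?_
  constructor
  · exact fun h => h.2
  · intro hb
    refine ⟨?_, hb⟩
    rintro rfl
    simp only [zero_add] at hb
    exact hs hb

theorem card_Ioc_modEq_sub_le (x y q a : ℕ) (hq : 0 < q) (hxy : x ≤ y) :
    |(((Finset.Ioc x y).filter fun n => n % q = a % q).card : ℝ) - ((y : ℝ) - x) / q| ≤ 1 := by
  have h := Nat.Ioc_filter_modEq_card x y hq a
  have e : ((Finset.Ioc x y).filter fun n => n % q = a % q) =
      ((Finset.Ioc x y).filter fun n => n ≡ a [MOD q]) := rfl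
  rw [e]
  have hq' : (0 : ℚ) < q := by exact_mod_cast hq
  have h1 := Int.floor_le (((y : ℚ) - a) / q)
  have h2 := Int.lt_floor_add_one (((y : ℚ) - a) / q)
  have h3 := Int.floor_le (((x : ℚ) - a) / q)
  have h4 := Int.lt_floor_add_one (((x : ℚ) - a) / q)
  have hmono : ⌊((x : ℚ) - a) / q⌋ ≤ ⌊((y : ℚ) - a) / q⌋ := by
    refine Int.floor_le_floor (div_le_div_of_nonneg_right ?_ hq'.le)
    have : (x : ℚ) ≤ y := by exact_mod_cast hxy
    linarith
  rw [max_eq_left (by omega)] at h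
  have h5 : ((((Finset.Ioc x y).filter fun n => n ≡ a [MOD q]).card : ℤ) : ℚ) =
      (⌊((y : ℚ) - a) / q⌋ : ℚ) - (⌊((x : ℚ) - a) / q⌋ : ℚ) := by
    rw [h]; push_cast; ring
  have h6 : |(((Finset.Ioc x y).filter fun n => n ≡ a [MOD q]).card : ℚ) - ((y : ℚ) - x) / q| ≤
      1 := by
    have e2 : ((y : ℚ) - x) / q = ((y : ℚ) - a) / q - ((x : ℚ) - a) / q := by ring
    push_cast at h5
    rw [h5, e2, abs_le]
    constructor <;> linarith
  have h7 := (Rat.cast_le (K := ℝ)).2 h6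
  push_cast at h7
  exact h7

theorem sum_periodic_eq {ι : Type*} [AddCommMonoid ι] (N : Finset ℕ) (q : ℕ) (hq : 0 < q) (A : ℕ → Prop)
    [DecidablePred A] (hA : ∀ n, A n ↔ A (n % q)) (f : ℕ → ι) :
    ∑ n ∈ N with A n, f n =
      ∑ a ∈ (Finset.range q).filter A, ∑ n ∈ N with n % q = a % q, f n := by
  rw [← Finset.sum_fiberwise_of_maps_to (s := N.filter A) (t := (Finset.range q).filter A)
    (g := fun n => n % q)]
  · refine Finset.sum_congr rfl fun a ha => ?_
    rw [Finset.mem_filter, Finset.mem_range] at ha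
    rw [Finset.filter_filter]
    refine Finset.sum_congr (Finset.filter_congr fun n _ => ?_) fun _ _ => rfl
    rw [Nat.mod_eq_of_lt ha.1]
    constructor
    · exact fun h => h.2
    · intro h
      exact ⟨(hA n).2 (by rw [h]; exact ha.2), h⟩
  · intro n hn
    rw [Finset.mem_filter] at hn
    simp only [Finset.mem_filter, Finset.mem_range]
    exact ⟨Nat.mod_lt _ hq, (hA n).1 hn.2⟩

theorem tupleDvd_mod {k : ℕ} (h : Fin k → ℕ) (V : Finset ℕ) (n q : ℕ) (hq : ∀ p ∈ V, p ∣ q) :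
    TupleDvd h V n ↔ TupleDvd h V (n % q) := by
  refine forall₂_congr fun p hp => exists_congr fun i => ?_
  exact Nat.ModEq.dvd_iff (((Nat.mod_modEq n q).symm.of_dvd (hq p hp)).add_right _) dvd_rfl

theorem card_Ioc_tupleDvd_sub_le {k D R : ℕ} (hD : 2 ≤ D) (h : Fin k → ℕ)
    (hinj : ∀ p ∈ sievePrimes D R, ∀ i j, h i ≡ h j [MOD p] → i = j) {V : Finset ℕ}
    (hV : V ⊆ sievePrimes D R) (x : ℕ) :
    |(((Finset.Ioc x (2 * x)).filter fun n => n % primorial D = 1 ∧ TupleDvd h V n).card : ℝ) -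
      (x : ℝ) / primorial D * ∏ p ∈ V, (k : ℝ) / p| ≤ (k : ℝ) ^ V.card := by
  set W := primorial D
  have hW1 : 1 < W := by
    have : 2 ∣ W := Nat.prime_two.dvd_primorial_iff.2 hD
    exact lt_of_lt_of_le one_lt_two (Nat.le_of_dvd (primorial_pos D) this)
  have hVp : ∀ p ∈ V, p.Prime := fun p hp => (mem_sievePrimes.1 (hV hp)).2.1
  set q := W * ∏ p ∈ V, p with hqdef
  have hq : 0 < q := Nat.mul_pos (by omega) (prod_primes_pos hVp)
  have hpq : ∀ p ∈ V, p ∣ q := fun p hp => (Finset.dvd_prod_of_mem _ hp).mul_left _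
  have h1 := sum_periodic_eq (Finset.Ioc x (2 * x)) q hq
    (fun n => n % W = 1 ∧ TupleDvd h V n) (fun n => by
      rw [tupleDvd_mod h V n q hpq, Nat.mod_mod_of_dvd n (Dvd.intro _ rfl : W ∣ q)])
    (fun _ => (1 : ℝ))
  have hcard : ((Finset.range q).filter fun n => n % W = 1 ∧ TupleDvd h V n).card = k ^ V.card := by
    have h2 := card_filter_mod_prod hW1 V hVp (fun p hp => coprime_primorial_of_mem (hV hp))
      (fun p b => ∃ i, b + h i ≡ 0 [MOD p])
    rw [Finset.prod_congr rfl fun p hp => card_roots (hVp p hp).pos h (hinj p (hV hp)) 0,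
      Finset.prod_const] at h2
    rw [← h2]
    congr 1
    refine Finset.filter_congr fun n _ => and_congr_right fun _ => ?_
    refine forall₂_congr fun p hp => exists_congr fun i => ?_
    rw [← Nat.modEq_zero_iff_dvd]
    exact ⟨fun H => ((Nat.mod_modEq n p).add_right _).trans H,
      fun H => ((Nat.mod_modEq n p).add_right _).symm.trans H⟩
  simp only [Finset.sum_const, nsmul_eq_mul, mul_one] at h1
  rw [h1]
  have h3 : (x : ℝ) / W * ∏ p ∈ V, (k : ℝ) / p =
      ∑ a ∈ (Finset.range q).filter (fun n => n % W = 1 ∧ TupleDvd h V n),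
        ((2 * x : ℕ) - (x : ℝ)) / q := by
    rw [Finset.sum_const, hcard, nsmul_eq_mul, Finset.prod_div_distrib, Finset.prod_const, hqdef]
    push_cast
    rw [div_mul_div_comm]
    ring
  rw [h3, ← Finset.sum_sub_distrib]
  refine (Finset.abs_sum_le_sum_abs _ _).trans ?_
  calc _ ≤ ∑ a ∈ (Finset.range q).filter (fun n => n % W = 1 ∧ TupleDvd h V n), (1 : ℝ) :=
        Finset.sum_le_sum fun a _ => card_Ioc_modEq_sub_le x (2 * x) q a hq (by omega)
    _ = _ := by rw [Finset.sum_const, hcard, nsmul_eq_mul, mul_one]; push_cast; rfl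

/-- Each pair (S, T) carries a counting error at most k^|S ∪ T| ≤ k^|S| k^|T|, so the total error
factors into a square. -/
theorem sum_sieveWeight_sub_le {k D R : ℕ} (hk : 1 ≤ k) (hD : 2 ≤ D) (hkD : 2 * k ≤ D) (L : ℝ)
    (l : ℕ) (h : Fin k → ℕ)
    (hinj : ∀ p ∈ sievePrimes D R, ∀ i j, h i ≡ h j [MOD p] → i = j) (x : ℕ) :
    |∑ n ∈ (Finset.Ioc x (2 * x)).filter (fun n => n % primorial D = 1),
        sieveWeight (sievePrimes D R) L l h n -
      (x : ℝ) / primorial D * rieszSum (sievePrimes D R) (fun p => (k : ℝ) / (p - k)) L (2 * l)| ≤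
      (∑ S ∈ (sievePrimes D R).powerset,
        |selbergWeight (sievePrimes D R) k L l S| * (k : ℝ) ^ S.card) ^ 2 := by
  set P := sievePrimes D R
  have hk1 : (1 : ℝ) ≤ k := by exact_mod_cast hk
  have h1 := sum_mul_sieveWeight P L l h
    ((Finset.Ioc x (2 * x)).filter fun n => n % primorial D = 1) (fun _ => 1)
  simp only [one_mul] at h1
  rw [h1, ← selbergForm_main hk hkD, selbergForm, Finset.mul_sum, ← Finset.sum_sub_distrib, sq,
    Finset.sum_mul_sum]
  refine (Finset.abs_sum_le_sum_abs _ _).trans (Finset.sum_le_sum fun S hS => ?_)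
  rw [Finset.mul_sum, ← Finset.sum_sub_distrib]
  refine (Finset.abs_sum_le_sum_abs _ _).trans (Finset.sum_le_sum fun T hT => ?_)
  have hV : S ∪ T ⊆ P := Finset.union_subset (Finset.mem_powerset.1 hS) (Finset.mem_powerset.1 hT)
  have h2 := card_Ioc_tupleDvd_sub_le hD h hinj hV x
  rw [Finset.filter_filter, Finset.sum_const, nsmul_eq_mul, mul_one]
  have h3 : (k : ℝ) ^ (S ∪ T).card ≤ (k : ℝ) ^ S.card * (k : ℝ) ^ T.card := by
    rw [← pow_add]
    exact pow_le_pow_right₀ hk1 (Finset.card_union_le S T)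
  set u := selbergWeight P k L l S
  set v := selbergWeight P k L l T
  calc _ = |u| * |v| * |(((Finset.Ioc x (2 * x)).filter fun n =>
        n % primorial D = 1 ∧ TupleDvd h (S ∪ T) n).card : ℝ) -
          (x : ℝ) / primorial D * ∏ p ∈ S ∪ T, (k : ℝ) / p| := by
        rw [← abs_mul, ← abs_mul]; congr 1; ring
    _ ≤ |u| * |v| * ((k : ℝ) ^ S.card * (k : ℝ) ^ T.card) :=
        mul_le_mul_of_nonneg_left (h2.trans h3) (by positivity)
    _ = _ := by ring

theorem riesz_le {L : ℝ} (hL : 0 ≤ L) {l : ℕ} (hl : 1 ≤ l) (S : Finset ℕ) :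
    riesz L l S ≤ if logSum S ≤ L then L ^ l else 0 := by
  split_ifs with hS
  · refine pow_le_pow_left₀ (le_max_left _ _) (max_le hL ?_) l
    linarith [logSum_nonneg S]
  · exact (riesz_eq_zero hl (not_le.1 hS).le).le

theorem selbergWeight_eq_zero {P : Finset ℕ} {k : ℕ} {L : ℝ} {l : ℕ} (hl : 1 ≤ l) {S : Finset ℕ}
    (hS : L ≤ logSum S) : selbergWeight P k L l S = 0 := by
  rw [selbergWeight, Finset.sum_eq_zero, mul_zero]
  intro V hV
  have : logSum S ≤ logSum V := Finset.sum_le_sum_of_subset_of_nonneg (Finset.mem_filter.1 hV).2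
    fun _ _ _ => Real.log_natCast_nonneg _
  rw [riesz_eq_zero hl (hS.trans this), mul_zero]

/-- On S the factors k/(p-k) coming from V ⊇ S cancel p/k up to p/(p-k) ≤ 2; the remaining sum over
V \ S is a divisor-type sum, hence a power of the logarithm. -/
theorem abs_selbergWeight_le {D R k : ℕ} (hk : 1 ≤ k) (hD : 2 * k ≤ D) {L : ℝ} (hL : 0 ≤ L) {l : ℕ}
    (hl : 1 ≤ l) {S : Finset ℕ} (hS : S ⊆ sievePrimes D R) :
    |selbergWeight (sievePrimes D R) k L l S| ≤ 2 ^ S.card * (L ^ l * (1 + L) ^ (2 * k)) := by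
  set P := sievePrimes D R
  have hk0 : (0 : ℝ) < k := by exact_mod_cast hk
  have hh : ∀ p ∈ P, 0 ≤ (k : ℝ) / (p - k) := fun p hp => by
    have := sub_pos_of_mem_sievePrimes hD hp
    positivity
  have h1 : ∑ V ∈ P.powerset with S ⊆ V, (∏ p ∈ V, (k : ℝ) / (p - k)) * riesz L l V ≤
      (∏ p ∈ S, (k : ℝ) / (p - k)) * (L ^ l * (1 + L) ^ (2 * k)) := by
    rw [sum_superset_eq hS]
    have h2 : ∑ M ∈ P.powerset with logSum M ≤ L, ((2 * k : ℕ) : ℝ) ^ M.card / ∏ p ∈ M, (p : ℝ) ≤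
        (1 + L) ^ (2 * k) := sum_pow_card_div_prod_le (fun p hp => (mem_sievePrimes.1 hp).2.1) hL _
    calc _ ≤ ∑ M ∈ (P \ S).powerset, (∏ p ∈ S, (k : ℝ) / (p - k)) * (L ^ l *
          (if logSum M ≤ L then ((2 * k : ℕ) : ℝ) ^ M.card / ∏ p ∈ M, (p : ℝ) else 0)) := by
          refine Finset.sum_le_sum fun M hM => ?_
          have hMP : M ⊆ P := (Finset.mem_powerset.1 hM).trans Finset.sdiff_subset
          rw [Finset.prod_union (disjoint_of_mem_powerset_sdiff hM), mul_assoc]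
          refine mul_le_mul_of_nonneg_left ?_ (Finset.prod_nonneg fun p hp => hh p (hS hp))
          have h3 : ∏ p ∈ M, (k : ℝ) / (p - k) ≤ ((2 * k : ℕ) : ℝ) ^ M.card / ∏ p ∈ M, (p : ℝ) := by
            rw [← Finset.prod_const, ← Finset.prod_div_distrib]
            refine Finset.prod_le_prod (fun p hp => hh p (hMP hp)) fun p hp => ?_
            have g1 := sub_pos_of_mem_sievePrimes hD (hMP hp)
            have g2 := le_two_mul_sub_of_mem_sievePrimes hD (hMP hp)
            have g3 := one_lt_of_mem_sievePrimes (hMP hp)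
            push_cast
            rw [div_le_div_iff₀ g1 (by linarith)]
            nlinarith
          have h4 : riesz L l (S ∪ M) ≤ if logSum M ≤ L then L ^ l else 0 :=
            (riesz_anti L l Finset.subset_union_right).trans (riesz_le hL hl M)
          have h5 := mul_le_mul h3 h4 (riesz_nonneg _ _ _) (by positivity)
          refine h5.trans (le_of_eq ?_)
          split_ifs
          · ring
          · simp
      _ ≤ ∑ M ∈ P.powerset, (∏ p ∈ S, (k : ℝ) / (p - k)) * (L ^ l *
          (if logSum M ≤ L then ((2 * k : ℕ) : ℝ) ^ M.card / ∏ p ∈ M, (p : ℝ) else 0)) := by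
          refine Finset.sum_le_sum_of_subset_of_nonneg
            (Finset.powerset_mono.2 Finset.sdiff_subset) fun M _ _ => ?_
          refine mul_nonneg (Finset.prod_nonneg fun p hp => hh p (hS hp)) (mul_nonneg (by positivity) ?_)
          split_ifs <;> positivity
      _ ≤ _ := by
          rw [← Finset.mul_sum, ← Finset.mul_sum, ← Finset.sum_filter]
          exact mul_le_mul_of_nonneg_left (mul_le_mul_of_nonneg_left h2 (by positivity))
            (Finset.prod_nonneg fun p hp => hh p (hS hp))
  have h0 : 0 ≤ ∑ V ∈ P.powerset with S ⊆ V, (∏ p ∈ V, (k : ℝ) / (p - k)) * riesz L l V :=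
    Finset.sum_nonneg fun V hV => mul_nonneg (Finset.prod_nonneg fun p hp =>
      hh p (Finset.mem_powerset.1 (Finset.mem_filter.1 hV).1 hp)) (riesz_nonneg _ _ _)
  rw [selbergWeight, abs_mul, abs_of_nonneg h0, Finset.abs_prod]
  calc _ ≤ (∏ p ∈ S, |(-((p : ℝ) / k))|) *
        ((∏ p ∈ S, (k : ℝ) / (p - k)) * (L ^ l * (1 + L) ^ (2 * k))) :=
        mul_le_mul_of_nonneg_left h1 (Finset.prod_nonneg fun _ _ => abs_nonneg _)
    _ = (∏ p ∈ S, (p : ℝ) / (p - k)) * (L ^ l * (1 + L) ^ (2 * k)) := by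
        rw [← mul_assoc, ← Finset.prod_mul_distrib]
        congr 1
        refine Finset.prod_congr rfl fun p hp => ?_
        rw [abs_neg, abs_of_nonneg (by positivity)]
        have g1 := (sub_pos_of_mem_sievePrimes hD (hS hp)).ne'
        field_simp
    _ ≤ _ := by
        refine mul_le_mul_of_nonneg_right ?_ (by positivity)
        rw [← Finset.prod_const]
        refine Finset.prod_le_prod (fun p hp => ?_) fun p hp => ?_
        · have := sub_pos_of_mem_sievePrimes hD (hS hp)
          positivity
        · rw [div_le_iff₀ (sub_pos_of_mem_sievePrimes hD (hS hp))]
          exact le_two_mul_sub_of_mem_sievePrimes hD (hS hp)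

/-- Summing over S ⊆ V first replaces ∏ p by ∏ (1 + p), and (1 + p) k/(p-k) ≤ 3k. Since only ∏ V ≤ R
matters, inserting R/∏ V ≥ 1 yields a divisor-type sum. The squared error is then R² up to
logarithms, which explains the condition 2η < 1. -/
theorem sum_abs_selbergWeight_mul_le {D R k : ℕ} (hR : 0 < R) (hk : 1 ≤ k) (hD : 2 * k ≤ D) {l : ℕ}
    (hl : 1 ≤ l) :
    ∑ S ∈ (sievePrimes D R).powerset,
        |selbergWeight (sievePrimes D R) k (Real.log R) l S| * (k : ℝ) ^ S.card ≤
      R * (Real.log R ^ l * (1 + Real.log R) ^ (3 * k)) := by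
  set P := sievePrimes D R
  set L := Real.log R
  have hL : 0 ≤ L := Real.log_natCast_nonneg R
  have hR0 : (0 : ℝ) < R := by exact_mod_cast hR
  have hk0 : (0 : ℝ) < k := by exact_mod_cast hk
  have hh : ∀ p ∈ P, 0 ≤ (k : ℝ) / (p - k) := fun p hp => by
    have := sub_pos_of_mem_sievePrimes hD hp
    positivity
  have h1 : ∀ S ∈ P.powerset, |selbergWeight P k L l S| * (k : ℝ) ^ S.card ≤
      ∑ V ∈ P.powerset with S ⊆ V, (∏ p ∈ S, (p : ℝ)) *
        ((∏ p ∈ V, (k : ℝ) / (p - k)) * riesz L l V) := by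
    intro S _
    have h0 : 0 ≤ ∑ V ∈ P.powerset with S ⊆ V, (∏ p ∈ V, (k : ℝ) / (p - k)) * riesz L l V :=
      Finset.sum_nonneg fun V hV => mul_nonneg (Finset.prod_nonneg fun p hp =>
        hh p (Finset.mem_powerset.1 (Finset.mem_filter.1 hV).1 hp)) (riesz_nonneg _ _ _)
    rw [selbergWeight, abs_mul, abs_of_nonneg h0, Finset.abs_prod, ← Finset.mul_sum,
      mul_right_comm]
    refine le_of_eq ?_
    congr 1
    rw [← Finset.prod_const, ← Finset.prod_mul_distrib]
    refine Finset.prod_congr rfl fun p _ => ?_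
    rw [abs_neg, abs_of_nonneg (by positivity)]
    field_simp
  have h2 : ∑ M ∈ P.powerset with logSum M ≤ L, ((3 * k : ℕ) : ℝ) ^ M.card / ∏ p ∈ M, (p : ℝ) ≤
        (1 + L) ^ (3 * k) := sum_pow_card_div_prod_le (fun p hp => (mem_sievePrimes.1 hp).2.1) hL _
  refine (Finset.sum_le_sum h1).trans ?_
  rw [Finset.sum_comm' (s' := fun V => V.powerset) (t' := P.powerset)]
  · calc _ ≤ ∑ V ∈ P.powerset, R * (L ^ l *
          (if logSum V ≤ L then ((3 * k : ℕ) : ℝ) ^ V.card / ∏ p ∈ V, (p : ℝ) else 0)) := by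
          refine Finset.sum_le_sum fun V hV => ?_
          have hVP := Finset.mem_powerset.1 hV
          rw [← Finset.sum_mul, sum_powerset_prod_one_add, ← mul_assoc, ← Finset.prod_mul_distrib]
          have h3 : ∏ p ∈ V, (1 + (p : ℝ)) * (k / (p - k)) ≤ ((3 * k : ℕ) : ℝ) ^ V.card := by
            rw [← Finset.prod_const]
            refine Finset.prod_le_prod (fun p hp => mul_nonneg (by positivity) (hh p (hVP hp)))
              fun p hp => ?_
            have g1 := sub_pos_of_mem_sievePrimes hD (hVP hp)
            have g2 := le_two_mul_sub_of_mem_sievePrimes hD (hVP hp)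
            have g3 : (2 : ℝ) ≤ p := by exact_mod_cast (mem_sievePrimes.1 (hVP hp)).2.1.two_le
            push_cast
            rw [mul_div_assoc', div_le_iff₀ g1]
            nlinarith
          have h5 := mul_le_mul h3 (riesz_le hL hl V) (riesz_nonneg _ _ _) (by positivity)
          refine h5.trans ?_
          split_ifs with hVL
          · have h6 : ∏ p ∈ V, (p : ℝ) ≤ R := by
              have hVp := prime_of_mem_powerset_sievePrimes hV
              rw [logSum_eq_log_prod hVp] at hVL
              have := (Real.log_le_log_iff (by exact_mod_cast prod_primes_pos hVp) hR0).1 hVL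
              rwa [Nat.cast_prod] at this
            have h7 : 0 < ∏ p ∈ V, (p : ℝ) := Finset.prod_pos fun p hp => by
              linarith [one_lt_of_mem_sievePrimes (hVP hp)]
            have h8 : 1 ≤ R / ∏ p ∈ V, (p : ℝ) := (one_le_div h7).2 h6
            calc ((3 * k : ℕ) : ℝ) ^ V.card * L ^ l = 1 * (((3 * k : ℕ) : ℝ) ^ V.card * L ^ l) := by
                  ring
              _ ≤ (R / ∏ p ∈ V, (p : ℝ)) * (((3 * k : ℕ) : ℝ) ^ V.card * L ^ l) :=
                  mul_le_mul_of_nonneg_right h8 (by positivity)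
              _ = _ := by ring
          · simp
      _ ≤ _ := by
          rw [← Finset.mul_sum, ← Finset.mul_sum, ← Finset.sum_filter]
          exact mul_le_mul_of_nonneg_left (mul_le_mul_of_nonneg_left h2 (by positivity)) hR0.le
  · intro S V
    simp only [Finset.mem_powerset, Finset.mem_filter]
    exact ⟨fun h => ⟨h.2.2, h.2.1⟩, fun h => ⟨h.1.trans h.2, h.2, h.1⟩⟩

/-! ### Primes in progressions and the level of distribution -/

/-- The logarithmically weighted indicator function of the primes. -/
noncomputable def primeLog (m : ℕ) : ℝ := if m.Prime then Real.log m else 0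

theorem primeLog_nonneg (m : ℕ) : 0 ≤ primeLog m := by
  unfold primeLog; split_ifs
  · exact Real.log_natCast_nonneg m
  · rfl

theorem thetaMod_natCast (y q a : ℕ) :
    thetaMod y q (a : ZMod q) =
      ∑ p ∈ (Finset.Icc 1 y).filter (fun p => p.Prime ∧ p % q = a % q), Real.log p := by
  rw [thetaMod, Nat.floor_natCast]
  refine Finset.sum_congr (Finset.filter_congr fun p _ => and_congr_right fun _ => ?_) fun _ _ => rfl
  exact ZMod.natCast_eq_natCast_iff p a q

theorem thetaMod_sub_thetaMod (x y q a : ℕ) (hxy : x ≤ y) :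
    thetaMod y q (a : ZMod q) - thetaMod x q (a : ZMod q) =
      ∑ p ∈ (Finset.Ioc x y).filter (fun p => p.Prime ∧ p % q = a % q), Real.log p := by
  rw [thetaMod_natCast, thetaMod_natCast, sub_eq_iff_eq_add, ← Finset.sum_union]
  · refine Finset.sum_congr ?_ fun _ _ => rfl
    rw [← Finset.filter_union]
    congr 1
    ext n
    simp only [Finset.mem_union, Finset.mem_Icc, Finset.mem_Ioc]
    omega
  · refine Finset.disjoint_filter_filter ?_
    rw [Finset.disjoint_left]
    intro n hn hn'
    simp only [Finset.mem_Icc, Finset.mem_Ioc] at hn hn'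
    omega

theorem bddAbove_range_error {q : ℕ} [NeZero q] (x : ℝ) :
    BddAbove (Set.range fun a : (ZMod q)ˣ =>
      |thetaMod x q (a : ZMod q) - x / (Nat.totient q : ℝ)|) := by
  exact (Set.finite_range _).bddAbove

theorem maxError_nonneg (x : ℝ) (q : ℕ) : 0 ≤ maxError x q :=
  Real.iSup_nonneg fun _ => abs_nonneg _

theorem abs_thetaMod_sub_le_maxError {q a : ℕ} (hq : 0 < q) (ha : a.Coprime q) (x : ℝ) :
    |thetaMod x q (a : ZMod q) - x / (Nat.totient q : ℝ)| ≤ maxError x q := by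
  have : NeZero q := ⟨hq.ne'⟩
  have := le_ciSup (bddAbove_range_error x) (ZMod.unitOfCoprime a ha)
  simpa [maxError] using this

theorem totient_mul_prod {D R : ℕ} {V : Finset ℕ} (hV : V ⊆ sievePrimes D R) :
    (Nat.totient (primorial D * ∏ p ∈ V, p) : ℝ) =
      Nat.totient (primorial D) * ∏ p ∈ V, ((p : ℝ) - 1) := by
  rw [Nat.totient_mul (prod_coprime_primorial (Finset.mem_powerset.2 hV)).symm]
  push_cast
  congr 1
  induction V using Finset.induction_on with
  | empty => simp
  | insert q V hq ih =>
    have hVP : V ⊆ sievePrimes D R := (Finset.subset_insert q V).trans hV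
    have hqp : q.Prime := (mem_sievePrimes.1 (hV (Finset.mem_insert_self q V))).2.1
    rw [Finset.prod_insert hq, Finset.prod_insert hq, Nat.totient_mul, Nat.totient_prime hqp]
    · push_cast
      rw [ih hVP, Nat.cast_sub hqp.one_lt.le, Nat.cast_one]
    · refine Nat.Coprime.prod_right fun p hp => ?_
      exact (Nat.coprime_primes hqp (mem_sievePrimes.1 (hVP hp)).2.1).2 fun h => hq (h ▸ hp)

/-- In the variable m = n + s the conditions read m ≡ 1 + s modulo W and, for each p ∈ V, m + h_i ≡
s for some i. A prime m > x ≥ R is nonzero modulo every p ≤ R, so only reduced classes occur, and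
their number is the product of the `unitRoots`. Each class has one error term for each end of the
interval. -/
theorem sum_primeLog_tupleDvd_sub_le {k D R : ℕ} (h : Fin k → ℕ)
    (hinj : ∀ p ∈ sievePrimes D R, ∀ i j, h i ≡ h j [MOD p] → i = j) {V : Finset ℕ}
    (hV : V ⊆ sievePrimes D R) {x : ℕ} (hRx : R ≤ x) (hW1 : 1 < primorial D)
    {s : ℕ} (hs : (1 + s).Coprime (primorial D)) :
    |∑ n ∈ (Finset.Ioc x (2 * x)).filter (fun n => n % primorial D = 1 ∧ TupleDvd h V n),
        primeLog (n + s) -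
      (x : ℝ) / Nat.totient (primorial D) * ∏ p ∈ V, (unitRoots h s p : ℝ) / (p - 1)| ≤
      (k : ℝ) ^ V.card * (maxError ((2 * x + s : ℕ) : ℝ) (primorial D * ∏ p ∈ V, p) +
        maxError ((x + s : ℕ) : ℝ) (primorial D * ∏ p ∈ V, p)) := by
  set W := primorial D
  have hW0 : 0 < W := by omega
  have hVp : ∀ p ∈ V, p.Prime := fun p hp => (mem_sievePrimes.1 (hV hp)).2.1
  set q := W * ∏ p ∈ V, p with hqdef
  have hq : 0 < q := Nat.mul_pos hW0 (prod_primes_pos hVp)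
  have hWq : W ∣ q := Dvd.intro _ rfl
  have hpq : ∀ p ∈ V, p ∣ q := fun p hp => (Finset.dvd_prod_of_mem _ hp).mul_left _
  set A : ℕ → Prop := fun m => m % W = (1 + s) % W ∧
    ∀ p ∈ V, (m % p ≠ 0 ∧ ∃ i, m % p + h i ≡ s [MOD p])
  have : DecidablePred A := fun m => by unfold A; infer_instance
  have hAper : ∀ m, A m ↔ A (m % q) := by
    intro m
    have e1 : m % q % W = m % W := Nat.mod_mod_of_dvd m hWq
    have e2 : ∀ p ∈ V, m % q % p = m % p := fun p hp => Nat.mod_mod_of_dvd m (hpq p hp)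
    simp only [A, e1]
    refine and_congr_right fun _ => forall₂_congr fun p hp => ?_
    rw [e2 p hp]
  set N := (Finset.Ioc (x + s) (2 * x + s)).filter Nat.Prime
  have hshift : ∑ n ∈ (Finset.Ioc x (2 * x)).filter (fun n => n % W = 1 ∧ TupleDvd h V n),
      primeLog (n + s) = ∑ m ∈ N with A m, Real.log m := by
    have hfil : ∑ n ∈ (Finset.Ioc x (2 * x)).filter (fun n => n % W = 1 ∧ TupleDvd h V n),
        primeLog (n + s) = ∑ n ∈ (Finset.Ioc x (2 * x)).filter (fun n =>
          (n % W = 1 ∧ TupleDvd h V n) ∧ (n + s).Prime), Real.log ((n + s : ℕ) : ℝ) := by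
      rw [← Finset.filter_filter (p := fun n => n % W = 1 ∧ TupleDvd h V n)
        (q := fun n => (n + s).Prime), Finset.sum_filter (p := fun n => (n + s).Prime)]
      rfl
    rw [hfil]
    refine Finset.sum_nbij' (fun n => n + s) (fun m => m - s) ?_ ?_ ?_ ?_ ?_
    · intro n hn
      simp only [Finset.mem_filter, Finset.mem_Ioc] at hn
      obtain ⟨⟨hn1, hn2⟩, ⟨hn3, hn4⟩, hn5⟩ := hn
      simp only [N, A, Finset.mem_filter, Finset.mem_Ioc]
      refine ⟨⟨⟨by omega, by omega⟩, hn5⟩, ?_, fun p hp => ⟨?_, ?_⟩⟩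
      · rw [Nat.add_mod, hn3, Nat.add_mod 1 s, Nat.mod_eq_of_lt hW1]
      · intro h0
        have := (Nat.prime_dvd_prime_iff_eq (hVp p hp) hn5).1 (Nat.dvd_of_mod_eq_zero h0)
        have := (mem_sievePrimes.1 (hV hp)).1
        omega
      · obtain ⟨i, hi⟩ := hn4 p hp
        refine ⟨i, ((Nat.mod_modEq _ p).add_right _).trans ?_⟩
        have : n + s + h i = (n + h i) + s := by ring
        rw [this]
        simpa using ((Nat.modEq_zero_iff_dvd.2 hi).add_right s)
    · intro m hm
      simp only [N, A, Finset.mem_filter, Finset.mem_Ioc] at hm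
      obtain ⟨⟨⟨hm1, hm2⟩, hm3⟩, hm4, hm5⟩ := hm
      obtain ⟨n, rfl⟩ : ∃ n, m = n + s := ⟨m - s, by omega⟩
      simp only [Finset.mem_filter, Finset.mem_Ioc, Nat.add_sub_cancel]
      refine ⟨⟨by omega, by omega⟩, ⟨?_, fun p hp => ?_⟩, hm3⟩
      · have : n ≡ 1 [MOD W] := Nat.ModEq.add_right_cancel' s hm4
        rw [show n % W = 1 % W from this, Nat.mod_eq_of_lt hW1]
      · obtain ⟨i, hi⟩ := (hm5 p hp).2
        refine ⟨i, Nat.modEq_zero_iff_dvd.1 (Nat.ModEq.add_right_cancel' s ?_)⟩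
        have h1 := ((Nat.mod_modEq (n + s) p).add_right (h i)).symm.trans hi
        have : n + h i + s = n + s + h i := by ring
        rw [this]
        simpa using h1
    · intro n _; simp
    · intro m hm
      simp only [N, Finset.mem_filter, Finset.mem_Ioc] at hm
      omega
    · intro n _; rfl
  have hcard : ((Finset.range q).filter A).card = ∏ p ∈ V, unitRoots h s p := by
    convert card_filter_mod_prod (Nat.mod_lt (1 + s) hW0) V hVp
      (fun p hp => coprime_primorial_of_mem (hV hp))
      (fun p b => b ≠ 0 ∧ ∃ i, b + h i ≡ s [MOD p])
    rfl
  have hroots : ∀ p ∈ V, unitRoots h s p ≤ k := by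
    intro p hp
    by_cases hh : ∃ i, h i ≡ s [MOD p]
    · have := unitRoots_of_modEq (hVp p hp).pos h (hinj p (hV hp)) hh
      omega
    · exact (unitRoots_of_not_modEq (hVp p hp).pos h (hinj p (hV hp)) hh).le
  have hcop : ∀ a, A a → a.Coprime q := by
    intro a ha
    rw [hqdef]
    refine Nat.Coprime.mul_right ?_ (Nat.Coprime.prod_right fun p hp => ?_)
    · rw [Nat.coprime_iff_gcd_eq_one]
      have h1 : a ≡ 1 + s [MOD W] := ha.1
      rw [h1.gcd_eq]
      exact hs
    · rw [Nat.coprime_comm, (hVp p hp).coprime_iff_not_dvd]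
      exact fun hd => (ha.2 p hp).1 (Nat.mod_eq_zero_of_dvd hd)
  rw [hshift, sum_periodic_eq N q hq A hAper]
  have hmain : (x : ℝ) / Nat.totient W * ∏ p ∈ V, (unitRoots h s p : ℝ) / (p - 1) =
      ∑ a ∈ (Finset.range q).filter A, (x : ℝ) / Nat.totient q := by
    rw [Finset.sum_const, hcard, nsmul_eq_mul, hqdef, totient_mul_prod hV, Finset.prod_div_distrib,
      div_mul_div_comm]
    push_cast
    ring
  rw [hmain, ← Finset.sum_sub_distrib]
  refine (Finset.abs_sum_le_sum_abs _ _).trans ?_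
  have hEnn := maxError_nonneg ((2 * x + s : ℕ) : ℝ) q
  have hEnn' := maxError_nonneg ((x + s : ℕ) : ℝ) q
  calc _ ≤ ∑ a ∈ (Finset.range q).filter A,
        (maxError ((2 * x + s : ℕ) : ℝ) q + maxError ((x + s : ℕ) : ℝ) q) := by
        refine Finset.sum_le_sum fun a ha => ?_
        have hac := hcop a (Finset.mem_filter.1 ha).2
        have e : ∑ n ∈ N with n % q = a % q, Real.log n =
            thetaMod ((2 * x + s : ℕ) : ℝ) q (a : ZMod q) -
              thetaMod ((x + s : ℕ) : ℝ) q (a : ZMod q) := by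
          rw [thetaMod_sub_thetaMod _ _ _ _ (by omega), Finset.filter_filter]
        have h1 := abs_thetaMod_sub_le_maxError hq hac ((2 * x + s : ℕ) : ℝ)
        have h2 := abs_thetaMod_sub_le_maxError hq hac ((x + s : ℕ) : ℝ)
        rw [e]
        have e2 : (x : ℝ) / Nat.totient q = ((2 * x + s : ℕ) : ℝ) / Nat.totient q -
            ((x + s : ℕ) : ℝ) / Nat.totient q := by
          push_cast; ring
        rw [e2]
        rw [abs_le] at h1 h2 ⊢
        constructor <;> linarith [h1.1, h1.2, h2.1, h2.2]
    _ ≤ _ := by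
        rw [Finset.sum_const, hcard, nsmul_eq_mul]
        refine mul_le_mul_of_nonneg_right ?_ (by positivity)
        have : ∏ p ∈ V, unitRoots h s p ≤ k ^ V.card :=
          Finset.prod_le_pow_card V _ k hroots
        exact_mod_cast this

theorem sum_primeLog_mul_sieveWeight_sub_le {k D R : ℕ} (hk : 1 ≤ k) (hD : 2 * k ≤ D) {l : ℕ}
    (hl : 1 ≤ l) (h : Fin k → ℕ)
    (hinj : ∀ p ∈ sievePrimes D R, ∀ i j, h i ≡ h j [MOD p] → i = j) {x : ℕ}
    (hRx : R ≤ x) {s : ℕ} (hs : (1 + s).Coprime (primorial D)) :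
    |∑ n ∈ (Finset.Ioc x (2 * x)).filter (fun n => n % primorial D = 1),
        primeLog (n + s) * sieveWeight (sievePrimes D R) (Real.log R) l h n -
      (x : ℝ) / Nat.totient (primorial D) * selbergForm (sievePrimes D R) k (Real.log R) l
        (fun p => (unitRoots h s p : ℝ) / (p - 1))| ≤
      (Real.log R ^ l * (1 + Real.log R) ^ (2 * k)) ^ 2 *
        ∑ V ∈ (sievePrimes D R).powerset with logSum V ≤ 2 * Real.log R,
          ((16 * k : ℕ) : ℝ) ^ V.card *
            (maxError ((2 * x + s : ℕ) : ℝ) (primorial D * ∏ p ∈ V, p) +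
              maxError ((x + s : ℕ) : ℝ) (primorial D * ∏ p ∈ V, p)) := by
  set P := sievePrimes D R
  set L := Real.log R
  have hL : 0 ≤ L := Real.log_natCast_nonneg R
  set Λ := L ^ l * (1 + L) ^ (2 * k)
  have hΛ : 0 ≤ Λ := by positivity
  have hk1 : (1 : ℝ) ≤ k := by exact_mod_cast hk
  have hW1 : 1 < primorial D := by
    have : 2 ∣ primorial D := Nat.prime_two.dvd_primorial_iff.2 (by omega)
    exact lt_of_lt_of_le one_lt_two (Nat.le_of_dvd (primorial_pos D) this)
  set E : Finset ℕ → ℝ := fun V => maxError ((2 * x + s : ℕ) : ℝ) (primorial D * ∏ p ∈ V, p) +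
              maxError ((x + s : ℕ) : ℝ) (primorial D * ∏ p ∈ V, p)
  have hE : ∀ V, 0 ≤ E V := fun V => add_nonneg (maxError_nonneg _ _) (maxError_nonneg _ _)
  rw [sum_mul_sieveWeight, selbergForm, Finset.mul_sum, ← Finset.sum_sub_distrib]
  set G : Finset ℕ → ℝ := fun V =>
    if logSum V ≤ 2 * L then Λ ^ 2 * (((4 * k : ℕ) : ℝ) ^ V.card * E V) else 0
  have hG : ∀ V, 0 ≤ G V := fun V => by
    simp only [G]; split_ifs
    · exact mul_nonneg (by positivity) (mul_nonneg (by positivity) (hE V))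
    · rfl
  have h1 : ∀ S ∈ P.powerset, |∑ T ∈ P.powerset,
      selbergWeight P k L l S * selbergWeight P k L l T *
        ∑ n ∈ (Finset.Ioc x (2 * x)).filter (fun n => n % primorial D = 1) with
          TupleDvd h (S ∪ T) n, primeLog (n + s) -
      (x : ℝ) / Nat.totient (primorial D) * ∑ T ∈ P.powerset, selbergWeight P k L l S *
        selbergWeight P k L l T * ∏ p ∈ S ∪ T, (unitRoots h s p : ℝ) / (p - 1)| ≤
      ∑ T ∈ P.powerset, G (S ∪ T) := by
    intro S hS
    rw [Finset.mul_sum, ← Finset.sum_sub_distrib]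
    refine (Finset.abs_sum_le_sum_abs _ _).trans (Finset.sum_le_sum fun T hT => ?_)
    have hSP := Finset.mem_powerset.1 hS
    have hTP := Finset.mem_powerset.1 hT
    have hV : S ∪ T ⊆ P := Finset.union_subset hSP hTP
    have h2 := sum_primeLog_tupleDvd_sub_le h hinj hV hRx hW1 hs
    rw [Finset.filter_filter]
    set u := selbergWeight P k L l S
    set v := selbergWeight P k L l T
    set X := ∑ n ∈ (Finset.Ioc x (2 * x)).filter (fun n => n % primorial D = 1 ∧
      TupleDvd h (S ∪ T) n), primeLog (n + s)
    set Y := ∏ p ∈ S ∪ T, (unitRoots h s p : ℝ) / (p - 1)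
    have e : u * v * X - (x : ℝ) / Nat.totient (primorial D) * (u * v * Y) =
        u * v * (X - (x : ℝ) / Nat.totient (primorial D) * Y) := by ring
    rw [e]
    simp only [G]
    split_ifs with hVL
    · rw [abs_mul, abs_mul]
      have hu : |u| ≤ 2 ^ S.card * Λ := abs_selbergWeight_le hk hD hL hl hSP
      have hv : |v| ≤ 2 ^ T.card * Λ := abs_selbergWeight_le hk hD hL hl hTP
      have c1 : (2 : ℝ) ^ S.card ≤ 2 ^ (S ∪ T).card :=
        pow_le_pow_right₀ one_le_two (Finset.card_le_card Finset.subset_union_left)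
      have c2 : (2 : ℝ) ^ T.card ≤ 2 ^ (S ∪ T).card :=
        pow_le_pow_right₀ one_le_two (Finset.card_le_card Finset.subset_union_right)
      calc |u| * |v| * |X - (x : ℝ) / Nat.totient (primorial D) * Y|
          ≤ ((2 ^ (S ∪ T).card * Λ) * (2 ^ (S ∪ T).card * Λ)) *
            ((k : ℝ) ^ (S ∪ T).card * E (S ∪ T)) := by
            refine mul_le_mul (mul_le_mul (hu.trans ?_) (hv.trans ?_) (abs_nonneg _) (by positivity))
              h2 (abs_nonneg _) (by positivity)
            · exact mul_le_mul_of_nonneg_right c1 hΛ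
            · exact mul_le_mul_of_nonneg_right c2 hΛ
        _ = _ := by
            have e4 : (4 : ℝ) ^ (S ∪ T).card = 2 ^ (S ∪ T).card * 2 ^ (S ∪ T).card := by
              rw [← mul_pow]; norm_num
            push_cast
            rw [mul_pow 4 (k : ℝ), e4]
            clear_value Λ
            ring
    -- A weight vanishes once its set has logSum at least L, so only moduli with ∏ V at most R²
    -- occur.
    · have hz : u = 0 ∨ v = 0 := by
        by_contra hcon
        rw [not_or] at hcon
        have a1 : logSum S < L := by
          by_contra H; exact hcon.1 (selbergWeight_eq_zero hl (not_lt.1 H))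
        have a2 : logSum T < L := by
          by_contra H; exact hcon.2 (selbergWeight_eq_zero hl (not_lt.1 H))
        have a3 : logSum (S ∪ T) ≤ logSum S + logSum T := by
          rw [logSum, logSum, logSum, ← Finset.sum_union_inter]
          have : 0 ≤ ∑ p ∈ S ∩ T, Real.log p := logSum_nonneg _
          linarith
        exact hVL (by linarith)
      rcases hz with hz | hz <;> simp [hz]
  have h1' : |∑ S ∈ P.powerset, (∑ T ∈ P.powerset,
      selbergWeight P k L l S * selbergWeight P k L l T *
        ∑ n ∈ (Finset.Ioc x (2 * x)).filter (fun n => n % primorial D = 1) with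
          TupleDvd h (S ∪ T) n, primeLog (n + s) -
      (x : ℝ) / Nat.totient (primorial D) * ∑ T ∈ P.powerset, selbergWeight P k L l S *
        selbergWeight P k L l T * ∏ p ∈ S ∪ T, (unitRoots h s p : ℝ) / (p - 1))| ≤
      ∑ S ∈ P.powerset, ∑ T ∈ P.powerset, G (S ∪ T) :=
    (Finset.abs_sum_le_sum_abs _ _).trans (Finset.sum_le_sum h1)
  refine h1'.trans ?_
  rw [← Finset.sum_product', ← Finset.sum_fiberwise_of_maps_to (t := P.powerset)
    (g := fun x => x.1 ∪ x.2) (fun x hx => by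
      rw [Finset.mem_product, Finset.mem_powerset, Finset.mem_powerset] at hx
      exact Finset.mem_powerset.2 (Finset.union_subset hx.1 hx.2)), Finset.mul_sum,
    Finset.sum_filter]
  refine Finset.sum_le_sum fun V _ => ?_
  -- At most 4^|V| pairs have union V. Together with 4^|V| from the bounds on the two weights and
  -- k^|V| from the number of classes this makes (16k)^|V|.
  have h3 : ∑ x ∈ P.powerset ×ˢ P.powerset with x.1 ∪ x.2 = V, G (x.1 ∪ x.2) ≤
      (4 : ℝ) ^ V.card * G V := by
    rw [Finset.sum_congr rfl (g := fun _ => G V) fun x hx => by rw [(Finset.mem_filter.1 hx).2],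
      Finset.sum_const, nsmul_eq_mul]
    refine mul_le_mul_of_nonneg_right ?_ (hG V)
    have : (P.powerset ×ˢ P.powerset).filter (fun x => x.1 ∪ x.2 = V) ⊆
        V.powerset ×ˢ V.powerset := by
      intro x hx
      have := (Finset.mem_filter.1 hx).2
      rw [Finset.mem_product, Finset.mem_powerset, Finset.mem_powerset, ← this]
      exact ⟨Finset.subset_union_left, Finset.subset_union_right⟩
    have := Finset.card_le_card this
    rw [Finset.card_product, Finset.card_powerset, ← mul_pow] at this
    exact_mod_cast this
  refine h3.trans (le_of_eq ?_)
  simp only [G]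
  split_ifs
  · change (4 : ℝ) ^ V.card * (Λ ^ 2 * (((4 * k : ℕ) : ℝ) ^ V.card * E V)) =
      Λ ^ 2 * (((16 * k : ℕ) : ℝ) ^ V.card * E V)
    rw [show ((16 * k : ℕ) : ℝ) = 4 * ((4 * k : ℕ) : ℝ) by push_cast; ring,
      mul_pow 4 ((4 * k : ℕ) : ℝ)]
    generalize E V = e
    ring
  · simp

theorem thetaMod_le {y q a : ℕ} (hq : 0 < q) (hqy : q ≤ y) :
    thetaMod y q (a : ZMod q) ≤ 2 * y * Real.log y / q := by
  have hq0 : (0 : ℝ) < q := by exact_mod_cast hq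
  rw [thetaMod_natCast]
  calc _ ≤ ∑ p ∈ (Finset.Ioc 0 y).filter (fun n => n % q = a % q), Real.log y := by
        refine le_trans (Finset.sum_le_sum_of_subset_of_nonneg
          (t := (Finset.Ioc 0 y).filter (fun n => n % q = a % q)) ?_ fun p _ _ =>
            Real.log_natCast_nonneg p) (Finset.sum_le_sum fun p hp => ?_)
        · intro p hp
          simp only [Finset.mem_filter, Finset.mem_Icc, Finset.mem_Ioc] at hp ⊢
          exact ⟨⟨by omega, hp.1.2⟩, hp.2.2⟩
        · simp only [Finset.mem_filter, Finset.mem_Ioc] at hp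
          exact Real.log_le_log (by exact_mod_cast hp.1.1) (by exact_mod_cast hp.1.2)
    _ ≤ _ := by
        rw [Finset.sum_const, nsmul_eq_mul]
        have h1 := (abs_le.1 (card_Ioc_modEq_sub_le 0 y q a hq (Nat.zero_le y))).2
        have h2 : (1 : ℝ) ≤ y / q := (one_le_div hq0).2 (by exact_mod_cast hqy)
        have h3 : (((Finset.Ioc 0 y).filter fun n => n % q = a % q).card : ℝ) ≤ 2 * (y / q) := by
          simp only [CharP.cast_eq_zero, sub_zero] at h1
          linarith
        calc _ ≤ 2 * ((y : ℝ) / q) * Real.log y :=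
              mul_le_mul_of_nonneg_right h3 (Real.log_natCast_nonneg y)
          _ = _ := by ring

theorem thetaMod_nonneg (x : ℝ) (q : ℕ) (a : ZMod q) : 0 ≤ thetaMod x q a :=
  Finset.sum_nonneg fun p _ => Real.log_natCast_nonneg p

theorem maxError_le_of_thetaMod {y q : ℕ} (hq : 0 < q) {b : ℝ}
    (h1 : ∀ a : ℕ, thetaMod y q (a : ZMod q) ≤ b) (h2 : (y : ℝ) / Nat.totient q ≤ b) :
    maxError y q ≤ b := by
  have : NeZero q := ⟨hq.ne'⟩
  refine ciSup_le fun a => ?_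
  have h3 := h1 (a : ZMod q).val
  rw [ZMod.natCast_zmod_val] at h3
  have h4 := thetaMod_nonneg y q (a : ZMod q)
  have h5 : (0 : ℝ) ≤ (y : ℝ) / Nat.totient q := by positivity
  rw [abs_le]
  constructor <;> linarith

/-- The trivial bound, which serves in Cauchy–Schwarz to absorb factors K^|V|. The power 2^|V| pays
for replacing p - 1 by p in φ. -/
theorem maxError_le {D R y : ℕ} {V : Finset ℕ} (hV : V ⊆ sievePrimes D R)
    (hy : primorial D * ∏ p ∈ V, p ≤ y) :
    maxError y (primorial D * ∏ p ∈ V, p) ≤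
      2 * y * (1 + Real.log y) * (2 ^ V.card / ∏ p ∈ V, (p : ℝ)) := by
  have hVp : ∀ p ∈ V, p.Prime := fun p hp => (mem_sievePrimes.1 (hV hp)).2.1
  have hprod := prod_primes_pos hVp
  have hprod' : 0 < ∏ p ∈ V, (p : ℝ) := by
    rw [← Nat.cast_prod]; exact_mod_cast hprod
  have hW := primorial_pos D
  have hlog : 0 ≤ Real.log y := Real.log_natCast_nonneg y
  have hone : (1 : ℝ) ≤ 2 ^ V.card := one_le_pow₀ one_le_two
  have hq : 0 < primorial D * ∏ p ∈ V, p := Nat.mul_pos hW hprod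
  refine maxError_le_of_thetaMod hq (fun a => ?_) ?_
  · refine (thetaMod_le hq hy).trans ?_
    have h1 : ∏ p ∈ V, (p : ℝ) ≤ ((primorial D * ∏ p ∈ V, p : ℕ) : ℝ) := by
      have : ∏ p ∈ V, p ≤ primorial D * ∏ p ∈ V, p := Nat.le_mul_of_pos_left _ hW
      rw [← Nat.cast_prod]; exact_mod_cast this
    calc _ ≤ 2 * y * Real.log y / ∏ p ∈ V, (p : ℝ) :=
          div_le_div_of_nonneg_left (by positivity) hprod' h1
      _ = 2 * y * Real.log y * (1 / ∏ p ∈ V, (p : ℝ)) := by ring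
      _ ≤ _ := by
          refine mul_le_mul ?_ (div_le_div_of_nonneg_right hone hprod'.le) (by positivity)
            (by positivity)
          exact mul_le_mul_of_nonneg_left (by linarith) (by positivity)
  · rw [totient_mul_prod hV]
    have h1 : (1 : ℝ) ≤ Nat.totient (primorial D) := by
      exact_mod_cast Nat.totient_pos.2 hW
    have h2 : ∏ p ∈ V, (p : ℝ) ≤ 2 ^ V.card * ∏ p ∈ V, ((p : ℝ) - 1) := by
      rw [← Finset.prod_const, ← Finset.prod_mul_distrib]
      refine Finset.prod_le_prod (fun p _ => by positivity) fun p hp => ?_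
      have : (2 : ℝ) ≤ p := by exact_mod_cast (hVp p hp).two_le
      linarith
    have h3 : 0 < ∏ p ∈ V, ((p : ℝ) - 1) := Finset.prod_pos fun p hp => by
      have : (2 : ℝ) ≤ p := by exact_mod_cast (hVp p hp).two_le
      linarith
    calc (y : ℝ) / (Nat.totient (primorial D) * ∏ p ∈ V, ((p : ℝ) - 1))
        ≤ y / (1 * ∏ p ∈ V, ((p : ℝ) - 1)) := by
          refine div_le_div_of_nonneg_left (by positivity) (by positivity) ?_
          exact mul_le_mul_of_nonneg_right h1 h3.le
      _ ≤ y * (2 ^ V.card / ∏ p ∈ V, (p : ℝ)) := by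
          rw [one_mul, div_eq_mul_one_div]
          refine mul_le_mul_of_nonneg_left ?_ (by positivity)
          rw [div_le_div_iff₀ h3 hprod']
          linarith
      _ ≤ _ := by
          refine mul_le_mul_of_nonneg_right ?_ (by positivity)
          nlinarith [(Nat.cast_nonneg y : (0 : ℝ) ≤ y)]

theorem prod_le_sq_of_logSum_le {V : Finset ℕ} (hV : ∀ p ∈ V, p.Prime) {R : ℕ} (hR : 0 < R)
    (h : logSum V ≤ 2 * Real.log R) : ((∏ p ∈ V, p : ℕ) : ℝ) ≤ (R : ℝ) ^ 2 := by
  rw [logSum_eq_log_prod hV] at h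
  have h2 : 2 * Real.log R = Real.log ((R : ℝ) ^ 2) := by rw [Real.log_pow]; norm_num
  rw [h2] at h
  have hR0 : (0 : ℝ) < R := by exact_mod_cast hR
  exact (Real.log_le_log_iff (by exact_mod_cast prod_primes_pos hV) (by positivity)).1 h

theorem eventually_const_mul_rpow_le {a b c : ℝ} (hab : a < b) :
    ∀ᶠ y : ℕ in atTop, c * (y : ℝ) ^ a ≤ (y : ℝ) ^ b := by
  have h : Tendsto (fun y : ℕ => (y : ℝ) ^ (b - a)) atTop atTop :=
    (tendsto_rpow_atTop (by linarith)).comp tendsto_natCast_atTop_atTop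
  filter_upwards [h.eventually_ge_atTop c, eventually_gt_atTop 0] with y hy hy0
  have hy0' : (0 : ℝ) < y := by exact_mod_cast hy0
  calc c * (y : ℝ) ^ a ≤ (y : ℝ) ^ (b - a) * (y : ℝ) ^ a :=
        mul_le_mul_of_nonneg_right hy (by positivity)
    _ = _ := by rw [← Real.rpow_add hy0']; congr 1; ring

theorem tendsto_log_natCast : Tendsto (fun y : ℕ => Real.log y) atTop atTop :=
  Real.tendsto_log_atTop.comp tendsto_natCast_atTop_atTop

/-- By Cauchy–Schwarz, the sum of K^|V| E(V) is controlled by the sum of K^(2|V|) E(V), which the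
trivial bound makes y times a power of log y, and the sum of E(V), which the level of distribution
makes smaller than any such power. Distinct V give distinct moduli, at most W y^(2η) ≤ y^τ with 2η <
τ < θ. -/
theorem HasLevelOfDistribution.eventually_sum_maxError_le {θ : ℝ} (hθ : HasLevelOfDistribution θ)
    {η : ℝ} (hηθ : 2 * η < θ) (hη1 : 2 * η < 1) (D K B : ℕ) :
    ∀ᶠ y : ℕ in atTop, ∀ R : ℕ, 0 < R → (R : ℝ) ≤ (y : ℝ) ^ η →
      ∑ V ∈ (sievePrimes D R).powerset with logSum V ≤ 2 * Real.log R,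
        (K : ℝ) ^ V.card * maxError y (primorial D * ∏ p ∈ V, p) ≤ y / Real.log y ^ B := by
  set W := primorial D
  set τ := θ - (θ - 2 * η) / 2
  have hτ : 2 * η < τ := by simp only [τ]; linarith
  -- The exponent of the logarithm lost in the trivial bound: 2K² from the divisor-type sum and 1
  -- from 1 + log y. The exponent m + 2B + 1 requested below leaves one spare logarithm to absorb
  -- the constants.
  set m := 2 * K ^ 2 + 1 with hm
  obtain ⟨C, hC⟩ := hθ ((θ - 2 * η) / 2) (by linarith) ((m + 2 * B + 1 : ℕ) : ℝ) (by positivity)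
  filter_upwards [eventually_const_mul_rpow_le (c := W) hτ,
    eventually_const_mul_rpow_le (c := W) hη1, eventually_ge_atTop 2,
    tendsto_log_natCast.eventually_ge_atTop 1,
    tendsto_log_natCast.eventually_ge_atTop (2 ^ (m + 1) * |C|)] with y hy1 hy2 hy3 hy4 hy5
  intro R hR hRy
  have hy0 : (0 : ℝ) < y := by exact_mod_cast (by omega : 0 < y)
  set ly := Real.log y
  have hR0 : (0 : ℝ) < R := by exact_mod_cast hR
  set P := sievePrimes D R
  set s := P.powerset.filter (fun V => logSum V ≤ 2 * Real.log R)
  have hsP : ∀ V ∈ s, V ⊆ P := fun V hV => Finset.mem_powerset.1 (Finset.mem_filter.1 hV).1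
  have hsp : ∀ V ∈ s, ∀ p ∈ V, p.Prime := fun V hV p hp => (mem_sievePrimes.1 (hsP V hV hp)).2.1
  have hprod : ∀ V ∈ s, ((W * ∏ p ∈ V, p : ℕ) : ℝ) ≤ W * (y : ℝ) ^ (2 * η) := by
    intro V hV
    have h1 := prod_le_sq_of_logSum_le (hsp V hV) hR (Finset.mem_filter.1 hV).2
    have h2 : (R : ℝ) ^ 2 ≤ (y : ℝ) ^ (2 * η) := by
      rw [mul_comm, Real.rpow_mul hy0.le, Real.rpow_two]
      exact pow_le_pow_left₀ hR0.le hRy 2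
    rw [Nat.cast_mul]
    exact mul_le_mul_of_nonneg_left (h1.trans h2) (Nat.cast_nonneg W)
  have hprody : ∀ V ∈ s, W * ∏ p ∈ V, p ≤ y := by
    intro V hV
    have := (hprod V hV).trans hy2
    rw [Real.rpow_one] at this
    exact_mod_cast this
  set E : Finset ℕ → ℝ := fun V => maxError y (W * ∏ p ∈ V, p)
  have hE : ∀ V, 0 ≤ E V := fun V => maxError_nonneg _ _
  have hlogR : 1 + 2 * Real.log R ≤ 2 * ly := by
    have h1 : Real.log R ≤ η * ly := by
      rw [← Real.log_rpow hy0]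
      exact Real.log_le_log hR0 hRy
    nlinarith
  have hsum1 : ∑ V ∈ s, ((K : ℝ) ^ V.card) ^ 2 * E V ≤ 2 * y * (2 * ly) ^ m := by
    have h1 : ∑ V ∈ s, ((2 * K ^ 2 : ℕ) : ℝ) ^ V.card / ∏ p ∈ V, (p : ℝ) ≤
        (2 * ly) ^ (2 * K ^ 2) :=
      (sum_pow_card_div_prod_le (fun p hp => (mem_sievePrimes.1 hp).2.1)
        (by have := Real.log_natCast_nonneg R; positivity) _).trans
        (pow_le_pow_left₀ (by have := Real.log_natCast_nonneg R; positivity) hlogR _)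
    calc _ ≤ ∑ V ∈ s, 2 * y * (1 + ly) *
          (((2 * K ^ 2 : ℕ) : ℝ) ^ V.card / ∏ p ∈ V, (p : ℝ)) := by
          refine Finset.sum_le_sum fun V hV => ?_
          have h2 := maxError_le (hsP V hV) (hprody V hV)
          refine (mul_le_mul_of_nonneg_left h2 (by positivity)).trans (le_of_eq ?_)
          push_cast
          rw [mul_pow 2 ((K : ℝ) ^ 2), ← pow_mul, ← pow_mul, mul_comm V.card 2]
          ring
      _ ≤ 2 * y * (2 * ly) * (2 * ly) ^ (2 * K ^ 2) := by
          rw [← Finset.mul_sum]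
          refine mul_le_mul ?_ h1 (Finset.sum_nonneg fun V _ => by positivity) (by positivity)
          exact mul_le_mul_of_nonneg_left (by linarith) (by positivity)
      _ = _ := by rw [hm, pow_succ]; ring
  have hsum2 : ∑ V ∈ s, E V ≤ |C| * (y / ly ^ (m + 2 * B + 1)) := by
    have h1 := hC y (by exact_mod_cast hy3)
    rw [Real.rpow_natCast] at h1
    have h2 : ∑ V ∈ s, E V ≤ ∑ q ∈ Finset.Icc 1 ⌊(y : ℝ) ^ τ⌋₊, maxError y q := by
      calc _ = ∑ q ∈ s.image (fun V => W * ∏ p ∈ V, p), maxError y q := by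
            rw [Finset.sum_image]
            intro V hV U hU h
            exact prod_injOn_primes (hsp V hV) (hsp U hU)
              (Nat.eq_of_mul_eq_mul_left (primorial_pos D) h)
        _ ≤ _ := by
            refine Finset.sum_le_sum_of_subset_of_nonneg ?_ fun _ _ _ => maxError_nonneg _ _
            intro q hq
            obtain ⟨V, hV, rfl⟩ := Finset.mem_image.1 hq
            rw [Finset.mem_Icc]
            exact ⟨Nat.mul_pos (primorial_pos D) (prod_primes_pos (hsp V hV)),
              Nat.le_floor ((hprod V hV).trans hy1)⟩
    refine (h2.trans h1).trans (mul_le_mul_of_nonneg_right (le_abs_self C) (by positivity))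
  have hCS := Finset.sum_mul_sq_le_sq_mul_sq s (fun V => (K : ℝ) ^ V.card * √(E V))
    (fun V => √(E V))
  have e1 : ∀ V ∈ s, (K : ℝ) ^ V.card * √(E V) * √(E V) = (K : ℝ) ^ V.card * E V :=
    fun V _ => by rw [mul_assoc, Real.mul_self_sqrt (hE V)]
  have e2 : ∀ V ∈ s, ((K : ℝ) ^ V.card * √(E V)) ^ 2 = ((K : ℝ) ^ V.card) ^ 2 * E V :=
    fun V _ => by rw [mul_pow, Real.sq_sqrt (hE V)]
  have e3 : ∀ V ∈ s, √(E V) ^ 2 = E V := fun V _ => Real.sq_sqrt (hE V)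
  rw [Finset.sum_congr rfl e1, Finset.sum_congr rfl e2, Finset.sum_congr rfl e3] at hCS
  have hly : 0 < ly := by linarith
  refine le_of_sq_le_sq ?_ (by positivity)
  refine hCS.trans ((mul_le_mul hsum1 hsum2 (Finset.sum_nonneg fun V _ => hE V)
    (by positivity)).trans ?_)
  have : 2 * y * (2 * ly) ^ m * (|C| * (y / ly ^ (m + 2 * B + 1))) =
      (2 ^ (m + 1) * |C|) / ly * (y / ly ^ B) ^ 2 := by
    clear_value m
    field_simp
    ring
  rw [this]
  have h6 : (2 ^ (m + 1) * |C|) / ly ≤ 1 := (div_le_one hly).2 hy5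
  calc _ ≤ 1 * (y / ly ^ B) ^ 2 := mul_le_mul_of_nonneg_right h6 (by positivity)
    _ = _ := one_mul _

theorem log_natCast_le_log_natCast {x : ℕ} (hx : 1 ≤ x) {y : ℕ} (hxy : x ≤ y) :
    Real.log x ≤ Real.log y :=
  Real.log_le_log (by exact_mod_cast hx) (by exact_mod_cast hxy)

theorem log_floor_rpow_le {η : ℝ} (hη1 : η ≤ 1) {x : ℕ} (hx : 1 ≤ x) :
    Real.log ⌊(x : ℝ) ^ η⌋₊ ≤ Real.log x := by
  have hx1 : (1 : ℝ) ≤ x := by exact_mod_cast hx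
  rcases Nat.eq_zero_or_pos ⌊(x : ℝ) ^ η⌋₊ with h | h
  · rw [h]; simp; exact Real.log_natCast_nonneg x
  · refine Real.log_le_log (by exact_mod_cast h) ((Nat.floor_le (by positivity)).trans ?_)
    calc (x : ℝ) ^ η ≤ (x : ℝ) ^ (1 : ℝ) := Real.rpow_le_rpow_of_exponent_le hx1 hη1
      _ = x := Real.rpow_one _

/-- The threshold on x is uniform in the tuple and in s ≤ x, since both ends x + s and 2x + s lie in
[x, 3x]. Uniformity is essential: the tuple depends on x, and s is later summed over an interval. -/
theorem HasLevelOfDistribution.eventually_sum_primeLog {θ : ℝ} (hθ : HasLevelOfDistribution θ)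
    {η : ℝ} (hη : 0 < η) (hηθ : 2 * η < θ) (hη1 : 2 * η < 1) {k l D : ℕ} (hk : 1 ≤ k)
    (hD : 2 * k ≤ D) (hl : 1 ≤ l) (B : ℕ) :
    ∀ᶠ x : ℕ in atTop, ∀ h : Fin k → ℕ,
      (∀ p, p.Prime → D < p → ∀ i j, h i ≡ h j [MOD p] → i = j) →
      ∀ s : ℕ, s ≤ x → (1 + s).Coprime (primorial D) →
      |∑ n ∈ (Finset.Ioc x (2 * x)).filter (fun n => n % primorial D = 1), primeLog (n + s) *
          sieveWeight (sievePrimes D ⌊(x : ℝ) ^ η⌋₊) (Real.log ⌊(x : ℝ) ^ η⌋₊) l h n -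
        (x : ℝ) / Nat.totient (primorial D) *
          selbergForm (sievePrimes D ⌊(x : ℝ) ^ η⌋₊) k (Real.log ⌊(x : ℝ) ^ η⌋₊) l
            (fun p => (unitRoots h s p : ℝ) / (p - 1))| ≤ x / Real.log x ^ B := by
  set m := 2 * l + 4 * k with hm
  have hsum := hθ.eventually_sum_maxError_le hηθ hη1 D (16 * k) (m + B + 1)
  obtain ⟨y0, hy0⟩ := eventually_atTop.1 hsum
  filter_upwards [eventually_ge_atTop y0, eventually_ge_atTop 1,
    tendsto_log_natCast.eventually_ge_atTop 1,
    tendsto_log_natCast.eventually_ge_atTop (5 * 2 ^ (4 * k))] with x hx hx1 hlx hlx2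
  intro h hinj s hs hcop
  have hx0 : (1 : ℝ) ≤ x := by exact_mod_cast hx1
  set R := ⌊(x : ℝ) ^ η⌋₊ with hRdef
  have hR : 0 < R := Nat.floor_pos.2 (Real.one_le_rpow hx0 hη.le)
  have hRle : (R : ℝ) ≤ (x : ℝ) ^ η := Nat.floor_le (by positivity)
  have hRx : R ≤ x := by
    have : (R : ℝ) ≤ x := hRle.trans (by
      calc (x : ℝ) ^ η ≤ (x : ℝ) ^ (1 : ℝ) := Real.rpow_le_rpow_of_exponent_le hx0 (by linarith)
        _ = x := Real.rpow_one _)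
    exact_mod_cast this
  have hL0 : 0 ≤ Real.log R := Real.log_natCast_nonneg R
  have hLx : Real.log R ≤ Real.log x := log_floor_rpow_le (by linarith) hx1
  refine (sum_primeLog_mul_sieveWeight_sub_le hk hD hl h
    (fun p hp => hinj p (mem_sievePrimes.1 hp).2.1 (mem_sievePrimes.1 hp).2.2) hRx hcop).trans ?_
  set lx := Real.log x
  have hlx0 : 0 < lx := by linarith
  have hbound : ∀ y : ℕ, x ≤ y → y ≤ 3 * x →
      ∑ V ∈ (sievePrimes D R).powerset with logSum V ≤ 2 * Real.log R,
        ((16 * k : ℕ) : ℝ) ^ V.card * maxError y (primorial D * ∏ p ∈ V, p) ≤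
        (y : ℝ) / lx ^ (m + B + 1) := by
    intro y hxy hy3
    have h1 : (x : ℝ) ≤ y := by exact_mod_cast hxy
    refine (hy0 y (hx.trans hxy) R hR (hRle.trans
      (Real.rpow_le_rpow (by linarith) h1 hη.le))).trans ?_
    refine div_le_div_of_nonneg_left (by positivity) (by positivity) ?_
    exact pow_le_pow_left₀ hlx0.le (log_natCast_le_log_natCast hx1 hxy) _
  have hb1 := hbound (2 * x + s) (by omega) (by omega)
  have hb2 := hbound (x + s) (by omega) (by omega)
  have hΛ : (Real.log R ^ l * (1 + Real.log R) ^ (2 * k)) ^ 2 ≤ 2 ^ (4 * k) * lx ^ m := by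
    calc _ ≤ (lx ^ l * (2 * lx) ^ (2 * k)) ^ 2 := by
          gcongr
          linarith
      _ = _ := by rw [hm]; ring
  have hsplit : ∑ V ∈ (sievePrimes D R).powerset with logSum V ≤ 2 * Real.log R,
          ((16 * k : ℕ) : ℝ) ^ V.card *
            (maxError ((2 * x + s : ℕ) : ℝ) (primorial D * ∏ p ∈ V, p) +
              maxError ((x + s : ℕ) : ℝ) (primorial D * ∏ p ∈ V, p)) ≤
      5 * x / lx ^ (m + B + 1) := by
    simp_rw [mul_add]
    rw [Finset.sum_add_distrib]
    refine (add_le_add hb1 hb2).trans ?_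
    rw [← add_div]
    refine div_le_div_of_nonneg_right ?_ (by positivity)
    have : (s : ℝ) ≤ x := by exact_mod_cast hs
    push_cast
    linarith
  refine (mul_le_mul hΛ hsplit (Finset.sum_nonneg fun V _ => mul_nonneg (by positivity)
    (add_nonneg (maxError_nonneg _ _) (maxError_nonneg _ _))) (by positivity)).trans ?_
  have e : 2 ^ (4 * k) * lx ^ m * (5 * x / lx ^ (m + B + 1)) =
      (5 * 2 ^ (4 * k)) / lx * (x / lx ^ B) := by
    clear_value m
    field_simp
    ring
  rw [e]
  calc _ ≤ 1 * (x / lx ^ B) :=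
        mul_le_mul_of_nonneg_right ((div_le_one hlx0).2 hlx2) (by positivity)
    _ = _ := one_mul _

theorem eventually_sum_sieveWeight {η : ℝ} (hη : 0 < η) (hη1 : 2 * η < 1) {k l D : ℕ}
    (hk : 1 ≤ k) (hD : 2 * k ≤ D) (hl : 1 ≤ l) (B : ℕ) :
    ∀ᶠ x : ℕ in atTop, ∀ h : Fin k → ℕ,
      (∀ p, p.Prime → D < p → ∀ i j, h i ≡ h j [MOD p] → i = j) →
      |∑ n ∈ (Finset.Ioc x (2 * x)).filter (fun n => n % primorial D = 1),
          sieveWeight (sievePrimes D ⌊(x : ℝ) ^ η⌋₊) (Real.log ⌊(x : ℝ) ^ η⌋₊) l h n -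
        (x : ℝ) / primorial D * rieszSum (sievePrimes D ⌊(x : ℝ) ^ η⌋₊)
          (fun p => (k : ℝ) / (p - k)) (Real.log ⌊(x : ℝ) ^ η⌋₊) (2 * l)| ≤
        x / Real.log x ^ B := by
  set m := 2 * l + 6 * k with hm
  have hlog : ∀ᶠ x : ℕ in atTop, 2 ^ (6 * k) * Real.log x ^ (m + B) ≤ (x : ℝ) ^ (1 - 2 * η) := by
    have h1 : (fun x : ℝ => Real.log x ^ (m + B)) =o[atTop] fun x : ℝ => x ^ (1 - 2 * η) := by
      have := isLittleO_log_rpow_rpow_atTop ((m + B : ℕ) : ℝ) (show 0 < 1 - 2 * η by linarith)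
      exact this.congr_left fun x => Real.rpow_natCast _ _
    have h2 := (h1.comp_tendsto tendsto_natCast_atTop_atTop).bound
      (show (0 : ℝ) < (2 ^ (6 * k))⁻¹ by positivity)
    filter_upwards [h2] with x hx
    simp only [Function.comp] at hx
    rw [Real.norm_of_nonneg (pow_nonneg (Real.log_natCast_nonneg x) _),
      Real.norm_of_nonneg (by positivity)] at hx
    rwa [inv_mul_eq_div, le_div_iff₀ (by positivity), mul_comm] at hx
  filter_upwards [hlog, eventually_ge_atTop 1,
    tendsto_log_natCast.eventually_ge_atTop 1] with x hx2 hx1 hlx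
  intro h hinj
  have hx0 : (1 : ℝ) ≤ x := by exact_mod_cast hx1
  set R := ⌊(x : ℝ) ^ η⌋₊ with hRdef
  have hR : 0 < R := Nat.floor_pos.2 (Real.one_le_rpow hx0 hη.le)
  have hRle : (R : ℝ) ≤ (x : ℝ) ^ η := Nat.floor_le (by positivity)
  have hL0 : 0 ≤ Real.log R := Real.log_natCast_nonneg R
  have hLx : Real.log R ≤ Real.log x := log_floor_rpow_le (by linarith) hx1
  refine (sum_sieveWeight_sub_le hk (by omega) hD _ l h
    (fun p hp => hinj p (mem_sievePrimes.1 hp).2.1 (mem_sievePrimes.1 hp).2.2) x).trans ?_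
  have h1 := sum_abs_selbergWeight_mul_le (D := D) hR hk hD hl
  refine (pow_le_pow_left₀ (Finset.sum_nonneg fun S _ => by positivity) h1 2).trans ?_
  set lx := Real.log x
  have hlx0 : 0 < lx := by linarith
  rw [le_div_iff₀ (by positivity)]
  calc (R * (Real.log R ^ l * (1 + Real.log R) ^ (3 * k))) ^ 2 * lx ^ B
      ≤ ((x : ℝ) ^ η * (lx ^ l * (2 * lx) ^ (3 * k))) ^ 2 * lx ^ B := by
        gcongr
        linarith
    _ = (x : ℝ) ^ (2 * η) * (2 ^ (6 * k) * lx ^ (m + B)) := by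
        rw [mul_comm 2 η, Real.rpow_mul (by linarith), Real.rpow_two, hm]
        ring
    _ ≤ (x : ℝ) ^ (2 * η) * (x : ℝ) ^ (1 - 2 * η) :=
        mul_le_mul_of_nonneg_left hx2 (by positivity)
    _ = x := by
        rw [← Real.rpow_add (by linarith)]
        ring_nf
        exact Real.rpow_one _

/-! ### Averaging over shifts outside the tuple -/

theorem one_add_pow_le {u : ℝ} (h0 : 0 ≤ u) (h1 : u ≤ 1) (k : ℕ) :
    (1 + u) ^ k ≤ 1 + (2 ^ k - 1) * u := by
  induction k with
  | zero => simp
  | succ k ih =>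
    have h2 : (1 : ℝ) ≤ 2 ^ k := one_le_pow₀ one_le_two
    calc (1 + u) ^ (k + 1) = (1 + u) ^ k * (1 + u) := pow_succ _ _
      _ ≤ (1 + (2 ^ k - 1) * u) * (1 + u) := mul_le_mul_of_nonneg_right ih (by linarith)
      _ ≤ _ := by
          have : (2 ^ k - 1) * (u * u) ≤ (2 ^ k - 1) * u :=
            mul_le_mul_of_nonneg_left (by nlinarith) (by linarith)
          rw [pow_succ]
          nlinarith

theorem prod_le_sum_pow {k : ℕ} (hk : 1 ≤ k) (a : Fin k → ℝ) (ha : ∀ i, 0 ≤ a i) :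
    ∏ i, a i ≤ ∑ i, a i ^ k := by
  have : Nonempty (Fin k) := ⟨⟨0, hk⟩⟩
  obtain ⟨j, hj⟩ := Finite.exists_max a
  calc ∏ i, a i ≤ ∏ _i : Fin k, a j := Finset.prod_le_prod (fun i _ => ha i) fun i _ => hj i
    _ = a j ^ k := by simp
    _ ≤ _ := Finset.single_le_sum (f := fun i => a i ^ k) (fun i _ => pow_nonneg (ha i) k)
        (Finset.mem_univ j)

/-- Each exceptional prime divides some s - h_i, so the product is at most a product over i, and ∏
a_i ≤ ∑ a_i^k decouples the indices. The constant comes from (1 + 1/(p-1))² ≤ 1 + 4/p and (1 +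
4/p)^k ≤ 1 + 2^(k+2)/p, valid for p ≥ 4. -/
theorem prod_bad_sq_le {D R k : ℕ} (hk : 1 ≤ k) (hD : 3 ≤ D) (h : Fin k → ℕ) {s : ℕ} (B : Finset ℕ)
    (hB : B ⊆ sievePrimes D R) (hBs : ∀ p ∈ B, ∃ i, h i ≡ s [MOD p]) :
    (∏ p ∈ B, (1 + 1 / ((p : ℝ) - 1))) ^ 2 ≤
      ∑ i, ∏ p ∈ (sievePrimes D R).filter (fun p => h i ≡ s [MOD p]), (1 + (2 ^ (k + 2) : ℕ) / (p : ℝ)) := by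
  set P := sievePrimes D R
  have hp4 : ∀ p ∈ P, (4 : ℝ) ≤ p := fun p hp => by
    have := (mem_sievePrimes.1 hp).2.2
    exact_mod_cast (by omega : 4 ≤ p)
  set a : Fin k → ℝ := fun i => ∏ p ∈ P.filter (fun p => h i ≡ s [MOD p]), (1 + 4 / (p : ℝ))
  have h1 : (∏ p ∈ B, (1 + 1 / ((p : ℝ) - 1))) ^ 2 ≤ ∏ p ∈ B, (1 + 4 / (p : ℝ)) := by
    rw [← Finset.prod_pow]
    refine Finset.prod_le_prod (fun p _ => sq_nonneg _) fun p hp => ?_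
    have g := hp4 p (hB hp)
    have g1 : (0 : ℝ) < p - 1 := by linarith
    have g0 : (0 : ℝ) < p := by linarith
    rw [show 1 + 1 / ((p : ℝ) - 1) = p / (p - 1) by field_simp; ring, div_pow,
      div_le_iff₀ (by positivity), show (1 : ℝ) + 4 / p = (p + 4) / p by field_simp,
      div_mul_eq_mul_div, le_div_iff₀ g0]
    nlinarith
  have h2 : ∏ p ∈ B, (1 + 4 / (p : ℝ)) ≤ ∏ i, a i := by
    have e : ∏ i, a i = ∏ p ∈ P, ∏ i, if h i ≡ s [MOD p] then (1 + 4 / (p : ℝ)) else 1 := by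
      rw [Finset.prod_comm]
      exact Finset.prod_congr rfl fun i _ => Finset.prod_filter _ _
    have hge : ∀ p i, (1 : ℝ) ≤ if h i ≡ s [MOD p] then (1 + 4 / (p : ℝ)) else 1 := fun p i => by
      split_ifs
      · have : (0 : ℝ) ≤ 4 / p := by positivity
        linarith
      · rfl
    rw [e]
    calc ∏ p ∈ B, (1 + 4 / (p : ℝ))
        ≤ ∏ p ∈ B, ∏ i, if h i ≡ s [MOD p] then (1 + 4 / (p : ℝ)) else 1 := by
          refine Finset.prod_le_prod (fun p _ => by positivity) fun p hp => ?_
          obtain ⟨i, hi⟩ := hBs p hp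
          have := Finset.prod_le_prod_of_subset_of_one_le (s := {i}) (t := Finset.univ)
            (f := fun i => if h i ≡ s [MOD p] then (1 + 4 / (p : ℝ)) else 1)
            (Finset.subset_univ _) (fun i _ => zero_le_one.trans (hge p i)) fun i _ _ => hge p i
          rw [Finset.prod_singleton, if_pos hi] at this
          exact this
      _ ≤ _ := by
          refine Finset.prod_le_prod_of_subset_of_one_le hB (fun p _ => ?_) fun p _ _ => ?_
          · exact Finset.prod_nonneg fun i _ => zero_le_one.trans (hge p i)
          · exact Finset.one_le_prod fun i _ => hge p i
  refine (h1.trans h2).trans ((prod_le_sum_pow hk a fun i =>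
    Finset.prod_nonneg fun p _ => by positivity).trans (Finset.sum_le_sum fun i _ => ?_))
  simp only [a]
  rw [← Finset.prod_pow]
  refine Finset.prod_le_prod (fun p _ => by positivity) fun p hp => ?_
  have g := hp4 p (Finset.mem_filter.1 hp).1
  have g0 : (0 : ℝ) < p := by linarith
  refine (one_add_pow_le (by positivity) ((div_le_one g0).2 g) k).trans ?_
  rw [add_le_add_iff_left, mul_div_assoc']
  refine div_le_div_of_nonneg_right ?_ g0.le
  push_cast
  rw [pow_add]
  linarith

theorem card_coprime_modEq_le {D R : ℕ} {V : Finset ℕ} (hV : V ⊆ sievePrimes D R) (c N : ℕ) :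
    (((Finset.Ioc 0 N).filter fun t => t.Coprime (primorial D) ∧ ∀ p ∈ V, t ≡ c [MOD p]).card : ℝ) ≤
      Nat.totient (primorial D) * ((N : ℝ) / (primorial D * ∏ p ∈ V, (p : ℝ)) + 1) := by
  set W := primorial D
  have hW0 : 0 < W := primorial_pos D
  have hVp : ∀ p ∈ V, p.Prime := fun p hp => (mem_sievePrimes.1 (hV hp)).2.1
  set q := W * ∏ p ∈ V, p with hqdef
  have hq : 0 < q := Nat.mul_pos hW0 (prod_primes_pos hVp)
  have hWq : W ∣ q := Dvd.intro _ rfl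
  have hpq : ∀ p ∈ V, p ∣ q := fun p hp => (Finset.dvd_prod_of_mem _ hp).mul_left _
  have hmodW : ∀ t, t.Coprime W ↔ (t % W).Coprime W := fun t => by
    rw [Nat.Coprime, Nat.Coprime, (Nat.mod_modEq t W).gcd_eq]
  have h1 := sum_periodic_eq (Finset.Ioc 0 N) q hq
    (fun t => t.Coprime W ∧ ∀ p ∈ V, t ≡ c [MOD p]) (fun t => by
      rw [hmodW t, hmodW (t % q), Nat.mod_mod_of_dvd t hWq]
      refine and_congr_right fun _ => forall₂_congr fun p hp => ?_
      have e : t % q ≡ t [MOD p] := (Nat.mod_modEq t q).of_dvd (hpq p hp)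
      exact ⟨fun H => e.trans H, fun H => e.symm.trans H⟩) (fun _ => (1 : ℝ))
  have hcard : ((Finset.range q).filter fun t => t.Coprime W ∧ ∀ p ∈ V, t ≡ c [MOD p]).card =
      Nat.totient W := by
    rw [Nat.totient_eq_card_coprime, Finset.card_eq_sum_card_fiberwise (f := fun t => t % W)
      (t := (Finset.range W).filter fun a => W.Coprime a)]
    · rw [Finset.card_eq_sum_ones]
      refine Finset.sum_congr rfl fun w hw => ?_
      rw [Finset.mem_filter, Finset.mem_range] at hw
      have h2 := card_filter_mod_prod hw.1 V hVp (fun p hp => coprime_primorial_of_mem (hV hp))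
        (fun p b => b = c % p)
      have h3 : ∏ p ∈ V, ((Finset.range p).filter fun b => b = c % p).card = 1 := by
        refine Finset.prod_eq_one fun p hp => ?_
        rw [Finset.card_eq_one]
        refine ⟨c % p, ?_⟩
        ext b
        simp only [Finset.mem_filter, Finset.mem_range, Finset.mem_singleton]
        constructor
        · exact fun h => h.2
        · rintro rfl; exact ⟨Nat.mod_lt _ (hVp p hp).pos, rfl⟩
      rw [h3] at h2
      rw [← h2, Finset.filter_filter]
      congr 1
      refine Finset.filter_congr fun t _ => ?_
      constructor
      · rintro ⟨⟨_, b⟩, c⟩; exact ⟨c, b⟩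
      · rintro ⟨c, b⟩
        refine ⟨⟨(hmodW t).2 ?_, b⟩, c⟩
        rw [c]; exact hw.2.symm
    · intro t ht
      have ht' := Finset.mem_filter.1 (Finset.mem_coe.1 ht)
      exact Finset.mem_coe.2 (Finset.mem_filter.2
        ⟨Finset.mem_range.2 (Nat.mod_lt _ hW0), ((hmodW t).1 ht'.2.1).symm⟩)
  simp only [Finset.sum_const, nsmul_eq_mul, mul_one] at h1
  rw [h1, ← hcard, ← nsmul_eq_mul, ← Finset.sum_const]
  refine Finset.sum_le_sum fun a _ => ?_
  have := (abs_le.1 (card_Ioc_modEq_sub_le 0 N q a hq (Nat.zero_le N))).2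
  rw [hqdef] at this ⊢
  push_cast at this
  simp only [sub_zero] at this
  linarith

theorem prod_le_of_modEq {V : Finset ℕ} (hV : ∀ p ∈ V, p.Prime) {a b H : ℕ} (ha : a ≤ H)
    (hb : b ≤ H) (hab : a ≠ b) (h : ∀ p ∈ V, a ≡ b [MOD p]) : ∏ p ∈ V, p ≤ H := by
  have h1 : ∏ p ∈ V, p ∣ ((b : ℤ) - a).natAbs := by
    refine Finset.prod_primes_dvd _ (fun p hp => (hV p hp).prime) fun p hp => ?_
    have := (Nat.modEq_iff_dvd.1 (h p hp))
    exact Int.natCast_dvd.1 this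
  have h2 : 0 < ((b : ℤ) - a).natAbs := Int.natAbs_pos.2 (by omega)
  exact (Nat.le_of_dvd h2 h1).trans (by omega)

theorem exp_one_le_three : Real.exp 1 ≤ 3 := by
  linarith [Real.exp_one_lt_d9]

/-- Expand the product over sets V of primes dividing s - c. If ∏ V > H no s ≠ c qualifies;
otherwise s is fixed modulo ∏ V, and the coprimality of 1 + s to W preserves the factor δ, which
must later cancel the one in φ(W). The main terms sum to a product ∏ (1 + K/p²) ≤ 3, the rest to a
power of log H, so that 3(H + 1) + H ≤ 7H finishes the count. -/
theorem sum_shift_prod_le {k D : ℕ} (hD : 2 ^ (k + 2) ≤ D) :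
    ∃ H₁ : ℕ, ∀ H : ℕ, H₁ ≤ H → ∀ R c : ℕ, c ≤ H →
      ∑ s ∈ (Finset.range (H + 1)).filter (fun s => s ≠ c ∧ (1 + s).Coprime (primorial D)),
        ∏ p ∈ (sievePrimes D R).filter (fun p => c ≡ s [MOD p]),
          (1 + (2 ^ (k + 2) : ℕ) / (p : ℝ)) ≤ 7 * coprimeDensity (primorial D) * H := by
  set K := 2 ^ (k + 2)
  set W := primorial D
  have hK : 0 < K := by positivity
  have hW0 : (0 : ℝ) < W := by exact_mod_cast primorial_pos D
  have hev : ∀ᶠ H : ℕ in atTop, (W : ℝ) * (1 + Real.log H) ^ K ≤ H := by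
    have h1 : (fun x : ℝ => Real.log x ^ K) =o[atTop] fun x : ℝ => x := by
      have := isLittleO_log_rpow_rpow_atTop ((K : ℕ) : ℝ) (show (0 : ℝ) < 1 by norm_num)
      refine (this.congr_left fun x => Real.rpow_natCast _ _).congr_right fun x => Real.rpow_one x
    have h2 := (h1.comp_tendsto tendsto_natCast_atTop_atTop).bound
      (show (0 : ℝ) < ((W : ℝ) * 2 ^ K)⁻¹ by positivity)
    filter_upwards [h2, tendsto_log_natCast.eventually_ge_atTop 1] with x hx hx1
    simp only [Function.comp] at hx
    rw [Real.norm_of_nonneg (pow_nonneg (Real.log_natCast_nonneg x) _),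
      Real.norm_of_nonneg (by positivity), inv_mul_eq_div, le_div_iff₀ (by positivity)] at hx
    calc (W : ℝ) * (1 + Real.log x) ^ K ≤ W * (2 * Real.log x) ^ K := by
          gcongr
          linarith
      _ = Real.log x ^ K * (W * 2 ^ K) := by rw [mul_pow]; ring
      _ ≤ x := hx
  obtain ⟨H₁, hH₁⟩ := eventually_atTop.1 hev
  refine ⟨max H₁ 1, fun H hH R c hc => ?_⟩
  have hH1 : 1 ≤ H := (le_max_right _ _).trans hH
  have hHW := hH₁ H ((le_max_left _ _).trans hH)
  have hH0 : (1 : ℝ) ≤ H := by exact_mod_cast hH1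
  set P := sievePrimes D R
  set S := (Finset.range (H + 1)).filter (fun s => s ≠ c ∧ (1 + s).Coprime W)
  have hlogH : 0 ≤ Real.log H := Real.log_natCast_nonneg H
  have hPp : ∀ p ∈ P, p.Prime := fun p hp => (mem_sievePrimes.1 hp).2.1
  set F : Finset ℕ → ℝ := fun V => (K : ℝ) ^ V.card / ∏ p ∈ V, (p : ℝ)
  have h1 : ∀ s ∈ S, ∏ p ∈ P.filter (fun p => c ≡ s [MOD p]), (1 + (K : ℝ) / p) =
      ∑ V ∈ P.powerset, if ∀ p ∈ V, c ≡ s [MOD p] then F V else 0 := by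
    intro s _
    rw [← sum_powerset_prod_one_add, ← Finset.sum_filter]
    have : (P.filter (fun p => c ≡ s [MOD p])).powerset =
        P.powerset.filter (fun V => ∀ p ∈ V, c ≡ s [MOD p]) := by
      ext V
      simp only [Finset.mem_powerset, Finset.mem_filter]
      constructor
      · exact fun h => ⟨h.trans (Finset.filter_subset _ _), fun p hp =>
          (Finset.mem_filter.1 (h hp)).2⟩
      · exact fun h p hp => Finset.mem_filter.2 ⟨h.1 hp, h.2 p hp⟩
    rw [this]
    exact Finset.sum_congr rfl fun V _ => by
      rw [Finset.prod_div_distrib, Finset.prod_const]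
  rw [Finset.sum_congr rfl h1, Finset.sum_comm]
  have hF : ∀ V, 0 ≤ F V := fun V => by simp only [F]; positivity
  have hφ : (0 : ℝ) ≤ Nat.totient W := Nat.cast_nonneg _
  have hδ : 0 ≤ coprimeDensity W := by unfold coprimeDensity; positivity
  have h2 : ∀ V ∈ P.powerset, (∑ s ∈ S, if ∀ p ∈ V, c ≡ s [MOD p] then F V else 0) ≤
      coprimeDensity W * (H + 1) * (∏ p ∈ V, (K : ℝ) / (p : ℝ) ^ 2) +
        (if logSum V ≤ Real.log H then Nat.totient W * F V else 0) := by
    intro V hV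
    have hVp : ∀ p ∈ V, p.Prime := fun p hp => hPp p (Finset.mem_powerset.1 hV hp)
    have hnn : 0 ≤ ∏ p ∈ V, (K : ℝ) / (p : ℝ) ^ 2 := Finset.prod_nonneg fun p _ => by positivity
    rw [← Finset.sum_filter, Finset.sum_const, nsmul_eq_mul]
    by_cases hVH : logSum V ≤ Real.log H
    · rw [if_pos hVH]
      have hc1 : (((S.filter fun s => ∀ p ∈ V, c ≡ s [MOD p]).card : ℕ) : ℝ) ≤
          Nat.totient W * (((H + 1 : ℕ) : ℝ) / (W * ∏ p ∈ V, (p : ℝ)) + 1) := by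
        refine le_trans ?_ (card_coprime_modEq_le (Finset.mem_powerset.1 hV) (c + 1) (H + 1))
        have : (S.filter fun s => ∀ p ∈ V, c ≡ s [MOD p]).card ≤
            ((Finset.Ioc 0 (H + 1)).filter fun t => t.Coprime (primorial D) ∧
              ∀ p ∈ V, t ≡ c + 1 [MOD p]).card := by
          refine Finset.card_le_card_of_injOn (fun s => s + 1) ?_ fun a _ b _ h => by simpa using h
          intro s hs
          simp only [S, Finset.coe_filter, Finset.mem_filter, Finset.mem_range,
            Set.mem_ofPred_eq] at hs
          simp only [Finset.coe_filter, Finset.mem_Ioc, Set.mem_ofPred_eq]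
          refine ⟨⟨by omega, by omega⟩, ?_, fun p hp => ?_⟩
          · rw [add_comm]; exact hs.1.2.2
          · exact ((hs.2 p hp).symm).add_right 1
        exact_mod_cast this
      refine (mul_le_mul_of_nonneg_right hc1 (hF V)).trans (le_of_eq ?_)
      have e : ∏ p ∈ V, (K : ℝ) / (p : ℝ) ^ 2 = F V / ∏ p ∈ V, (p : ℝ) := by
        simp only [F]
        rw [Finset.prod_div_distrib, Finset.prod_const, Finset.prod_pow, div_div, sq]
      have h0 : (∏ p ∈ V, (p : ℝ)) ≠ 0 := Finset.prod_ne_zero_iff.2 fun p hp => by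
        exact_mod_cast (hVp p hp).ne_zero
      rw [e, coprimeDensity]
      push_cast
      field_simp
    · rw [if_neg hVH, add_zero]
      have : S.filter (fun s => ∀ p ∈ V, c ≡ s [MOD p]) = ∅ := by
        refine Finset.eq_empty_of_forall_notMem fun s hs => hVH ?_
        simp only [S, Finset.mem_filter, Finset.mem_range] at hs
        have := prod_le_of_modEq hVp hc (Nat.lt_succ_iff.1 hs.1.1) (Ne.symm hs.1.2.1) hs.2
        rw [logSum_eq_log_prod hVp]
        exact Real.log_le_log (by exact_mod_cast prod_primes_pos hVp) (by exact_mod_cast this)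
      rw [this, Finset.card_empty, Nat.cast_zero, zero_mul]
      positivity
  refine (Finset.sum_le_sum h2).trans ?_
  rw [Finset.sum_add_distrib, ← Finset.mul_sum, ← Finset.sum_filter, ← Finset.mul_sum,
    sum_powerset_prod_one_add]
  have hD0 : 0 < D := by omega
  have h3 : ∏ p ∈ P, (1 + (K : ℝ) / (p : ℝ) ^ 2) ≤ 3 := by
    refine (prod_one_add_div_sq_le hD0 (by positivity)).trans (le_trans ?_ exp_one_le_three)
    rw [Real.exp_le_exp, div_le_one (by exact_mod_cast hD0)]
    exact_mod_cast hD
  have h4 : ∑ V ∈ P.powerset with logSum V ≤ Real.log H, F V ≤ (1 + Real.log H) ^ K :=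
    sum_pow_card_div_prod_le hPp hlogH K
  have h5 : (Nat.totient W : ℝ) = coprimeDensity W * W := by
    rw [coprimeDensity]; field_simp
  calc _ ≤ coprimeDensity W * (H + 1) * 3 + Nat.totient W * (1 + Real.log H) ^ K :=
        add_le_add (mul_le_mul_of_nonneg_left h3 (by positivity))
          (mul_le_mul_of_nonneg_left h4 hφ)
    _ = coprimeDensity W * ((H + 1) * 3 + W * (1 + Real.log H) ^ K) := by rw [h5]; ring
    _ ≤ coprimeDensity W * (7 * H) := by
        refine mul_le_mul_of_nonneg_left ?_ hδ
        linarith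
    _ = _ := by ring

/-! ### Comparison of the main terms -/

theorem selbergForm_congr {P : Finset ℕ} {g g' : ℕ → ℝ} (h : ∀ p ∈ P, g p = g' p) (k : ℕ) (L : ℝ)
    (l : ℕ) : selbergForm P k L l g = selbergForm P k L l g' := by
  refine Finset.sum_congr rfl fun S hS => Finset.sum_congr rfl fun T hT => ?_
  congr 1
  exact Finset.prod_congr rfl fun p hp =>
    h p (Finset.union_subset (Finset.mem_powerset.1 hS) (Finset.mem_powerset.1 hT) hp)

theorem coprimeDensity_primorial_pos (D : ℕ) : 0 < coprimeDensity (primorial D) := by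
  have := primorial_pos D
  have h2 : 0 < Nat.totient (primorial D) := Nat.totient_pos.2 this
  unfold coprimeDensity
  positivity

/-- The comparison that dictates k. Lowering the dimension gives the factor δ/(2l+1) and order 2l +
1; raising the order to 2l + 2 gives (1 + (k-1)/(2l+2))/L. For k = (2l+1)² one has k - 1 = 2l(2l+2),
so the second factor is (2l+1)/L and the product is δ/L. The secondary term has order 2l and is
smaller by a further factor L. -/
theorem eventually_mul_rieszSum_le {k l D : ℕ} (hl : 1 ≤ l) (hk : k = (2 * l + 1) ^ 2)
    (hD : 2 * k ≤ D) {ε : ℝ} (hε : 0 < ε) :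
    ∀ᶠ L : ℝ in atTop, ∀ R : ℕ,
      L * rieszSum (sievePrimes D R) (fun p => (k : ℝ) / (p - k)) L (2 * l) ≤
        (Real.exp (2 * k / D) + ε) * coprimeDensity (primorial D) *
          rieszSum (sievePrimes D R) (fun p => ((k : ℝ) - 1) / (p - k)) L (2 * l + 2) := by
  have hk1 : 1 ≤ k := by rw [hk]; exact Nat.one_le_pow _ _ (by omega)
  obtain ⟨C, hC, hrec⟩ := rieszSum_succ_ge k
  set δ := coprimeDensity (primorial D)
  have hδ : 0 < δ := coprimeDensity_primorial_pos D
  set E := Real.exp (2 * k / D)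
  have hE : 0 < E := Real.exp_pos _
  set W : ℝ := ((primorial D : ℕ) : ℝ)
  have hW : 0 ≤ W := Nat.cast_nonneg _
  set κ : ℝ := (k : ℝ) - 1 with hκ
  have hκ0 : 0 ≤ κ := by
    have : (1 : ℝ) ≤ k := by exact_mod_cast hk1
    linarith
  have hκl : κ = 2 * l * (2 * l + 2) := by
    rw [hκ, hk]; push_cast; ring
  set a := κ * C
  have hsub : Tendsto (fun L : ℝ => L - a) atTop atTop := tendsto_atTop_add_const_right _ _ tendsto_id
  have ht1 : Tendsto (fun L : ℝ => 1 + a / (L - a)) atTop (nhds (1 + 0)) :=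
    tendsto_const_nhds.add (tendsto_const_nhds.div_atTop hsub)
  have ht2 : Tendsto (fun L : ℝ => E * (W + 1) * k * (2 * l + 1) / (L - a)) atTop (nhds 0) :=
    tendsto_const_nhds.div_atTop hsub
  have ht3 : Tendsto (fun L : ℝ => (E * δ + E * (W + 1) * k * (2 * l + 1) / (L - a)) *
      (1 + a / (L - a))) atTop (nhds ((E * δ + 0) * (1 + 0))) :=
    (tendsto_const_nhds.add ht2).mul ht1
  have hlim : (E * δ + 0) * (1 + 0) < (E + ε) * δ := by nlinarith [mul_pos hε hδ]
  filter_upwards [ht3.eventually_lt_const hlim, hsub.eventually_ge_atTop 1] with L hL hLa R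
  set P := sievePrimes D R
  set T := fun j => rieszSum P (fun p => ((k : ℝ) - 1) / (p - k)) L j
  have hf : ∀ p ∈ P, 0 ≤ ((k : ℝ) - 1) / (p - k) := fun p hp =>
    div_nonneg hκ0 (sub_pos_of_mem_sievePrimes hD hp).le
  have hT : ∀ j, 0 ≤ T j := fun j => rieszSum_nonneg hf L j
  have r1 := hrec D R hD κ hκ0 L (2 * l) (by omega)
  have r2 := hrec D R hD κ hκ0 L (2 * l + 1) (by omega)
  have hl0 : (1 : ℝ) ≤ l := by exact_mod_cast hl
  have e2 : (1 : ℝ) + κ / (((2 * l + 1 : ℕ) : ℝ) + 1) = 2 * l + 1 := by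
    rw [hκl]; push_cast; field_simp; ring
  have e1 : (1 : ℝ) + κ / (((2 * l : ℕ) : ℝ) + 1) ≤ k := by
    have : κ / (((2 * l : ℕ) : ℝ) + 1) ≤ κ :=
      div_le_self hκ0 (by push_cast; linarith)
    linarith
  rw [e2] at r2
  change (L - a) * T (2 * l) ≤ _ * T (2 * l + 1) at r1
  change (L - a) * T (2 * l + 1) ≤ _ * T (2 * l + 2) at r2
  have hLa0 : 0 < L - a := by linarith
  have b2 : T (2 * l + 1) ≤ (2 * l + 1) / (L - a) * T (2 * l + 2) := by
    rw [div_mul_eq_mul_div, le_div_iff₀ hLa0]; linarith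
  have b1 : T (2 * l) ≤ k * (2 * l + 1) / (L - a) / (L - a) * T (2 * l + 2) := by
    have : T (2 * l) ≤ k / (L - a) * T (2 * l + 1) := by
      rw [div_mul_eq_mul_div, le_div_iff₀ hLa0]
      have := mul_le_mul_of_nonneg_right e1 (hT (2 * l + 1))
      linarith
    refine this.trans ((mul_le_mul_of_nonneg_left b2 (by positivity)).trans (le_of_eq ?_))
    field_simp
  have hmain := rieszSum_le_of_dim (R := R) hk1 hD L (j := 2 * l) (by omega)
  change _ ≤ E * (δ / (((2 * l : ℕ) : ℝ) + 1)) * T (2 * l + 1) + E * (W + 1) * T (2 * l) at hmain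
  have hL0 : 0 ≤ L := by
    have : 0 ≤ a := mul_nonneg hκ0 hC
    linarith
  have c1 := mul_le_mul_of_nonneg_left b2
    (show 0 ≤ E * (δ / (((2 * l : ℕ) : ℝ) + 1)) by positivity)
  have c2 := mul_le_mul_of_nonneg_left b1 (show 0 ≤ E * (W + 1) by positivity)
  refine (mul_le_mul_of_nonneg_left (hmain.trans (add_le_add c1 c2)) hL0).trans ?_
  have : L * (E * (δ / (((2 * l : ℕ) : ℝ) + 1)) * ((2 * l + 1) / (L - a) * T (2 * l + 2)) +
      E * (W + 1) * (k * (2 * l + 1) / (L - a) / (L - a) * T (2 * l + 2))) =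
      ((E * δ + E * (W + 1) * k * (2 * l + 1) / (L - a)) * (1 + a / (L - a))) * T (2 * l + 2) := by
    push_cast
    field_simp
    ring
  rw [this]
  exact mul_le_mul_of_nonneg_right hL.le (hT _)

/-- The constant 21k is 3 · 7 · k: the bound e ≤ 3 for exp(16k/D), the average over shifts for one
index, and the sum over the k indices that `prod_bad_sq_le` produces. -/
theorem exists_sum_selbergForm_shift_le {k D : ℕ} (hk : 2 ≤ k) (hD16 : 16 * k ≤ D)
    (hD : 2 ^ (k + 2) ≤ D) :
    ∃ H₁ : ℕ, ∀ H : ℕ, H₁ ≤ H → ∀ (R : ℕ) (L : ℝ) (l : ℕ) (h : Fin k → ℕ),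
      (∀ p, p.Prime → D < p → ∀ i j, h i ≡ h j [MOD p] → i = j) → (∀ i, h i ≤ H) →
      ∑ s ∈ (Finset.range (H + 1)).filter
          (fun s => (∀ i, s ≠ h i) ∧ (1 + s).Coprime (primorial D)),
        selbergForm (sievePrimes D R) k L l (fun p => (unitRoots h s p : ℝ) / (p - 1)) ≤
      21 * k * coprimeDensity (primorial D) * H *
        rieszSum (sievePrimes D R) (fun p => (k : ℝ) / (p - k)) L (2 * l) := by
  obtain ⟨H₁, hH₁⟩ := sum_shift_prod_le (k := k) hD
  refine ⟨H₁, fun H hH R L l h hinj hh => ?_⟩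
  set P := sievePrimes D R
  set T := rieszSum P (fun p => (k : ℝ) / (p - k)) L (2 * l)
  have hT : 0 ≤ T := rieszSum_nonneg (fun p hp => div_nonneg (Nat.cast_nonneg _)
    (sub_pos_of_mem_sievePrimes (by omega) hp).le) _ _
  set S := (Finset.range (H + 1)).filter (fun s => (∀ i, s ≠ h i) ∧ (1 + s).Coprime (primorial D))
  set F : ℕ → Fin k → ℝ := fun s i =>
    ∏ p ∈ P.filter (fun p => h i ≡ s [MOD p]), (1 + (2 ^ (k + 2) : ℕ) / (p : ℝ))
  have hE : Real.exp (16 * k / D) ≤ 3 := by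
    refine le_trans (Real.exp_le_exp.2 ?_) exp_one_le_three
    have : (0 : ℝ) < D := by exact_mod_cast (by omega : 0 < D)
    rw [div_le_one this]
    exact_mod_cast hD16
  have hterm : ∀ s, selbergForm P k L l (fun p => (unitRoots h s p : ℝ) / (p - 1)) ≤
      3 * (∑ i, F s i) * T := by
    intro s
    have hpp : ∀ p ∈ P, p.Prime ∧ D < p := fun p hp => (mem_sievePrimes.1 hp).2
    have hρ : ∀ p ∈ P, unitRoots h s p = k ∨ unitRoots h s p + 1 = k := fun p hp => by
      by_cases hs : ∃ i, h i ≡ s [MOD p]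
      · exact Or.inr (unitRoots_of_modEq (hpp p hp).1.pos h (hinj p (hpp p hp).1 (hpp p hp).2) hs)
      · exact Or.inl
          (unitRoots_of_not_modEq (hpp p hp).1.pos h (hinj p (hpp p hp).1 (hpp p hp).2) hs)
    refine (selbergForm_shift_le hk (by omega) L l (unitRoots h s) hρ).trans ?_
    have hbad := prod_bad_sq_le (R := R) (k := k) (D := D) (by omega) (by omega) h (s := s)
      (P.filter (fun p => unitRoots h s p + 1 = k)) (Finset.filter_subset _ _) (fun p hp => by
        rw [Finset.mem_filter] at hp
        by_contra hs
        have := unitRoots_of_not_modEq (hpp p hp.1).1.pos h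
          (hinj p (hpp p hp.1).1 (hpp p hp.1).2) hs
        omega)
    refine mul_le_mul_of_nonneg_right ?_ hT
    exact mul_le_mul hE hbad (sq_nonneg _) (by norm_num)
  have hsumi : ∀ i, ∑ s ∈ S, F s i ≤ 7 * coprimeDensity (primorial D) * H := fun i => by
    refine le_trans (Finset.sum_le_sum_of_subset_of_nonneg ?_ fun s _ _ => ?_)
      (hH₁ H hH R (h i) (hh i))
    · intro s hs
      rw [Finset.mem_filter] at hs ⊢
      exact ⟨hs.1, hs.2.1 i, hs.2.2⟩
    · exact Finset.prod_nonneg fun p _ => by positivity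
  refine (Finset.sum_le_sum fun s _ => hterm s).trans ?_
  rw [← Finset.sum_mul, ← Finset.mul_sum, Finset.sum_comm]
  refine mul_le_mul_of_nonneg_right ?_ hT
  calc 3 * ∑ i, ∑ s ∈ S, F s i ≤ 3 * ∑ _i : Fin k, 7 * coprimeDensity (primorial D) * H :=
        mul_le_mul_of_nonneg_left (Finset.sum_le_sum fun i _ => hsumi i) (by norm_num)
    _ = _ := by rw [Finset.sum_const, Finset.card_univ, Fintype.card_fin, nsmul_eq_mul]; ring

theorem selbergForm_prime_ge {D R k : ℕ} (hR : 0 < R) (hk : 2 ≤ k) (hD : 2 * k ≤ D) {l : ℕ}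
    (hl : 1 ≤ l) (h : Fin k → ℕ)
    (hinj : ∀ p, p.Prime → D < p → ∀ i j, h i ≡ h j [MOD p] → i = j) (i : Fin k) :
    (coprimeDensity (primorial D) / (l + 1)) ^ 2 *
        rieszSum (sievePrimes D R) (fun p => ((k : ℝ) - 1) / (p - k)) (Real.log R) (2 * l + 2) ≤
      selbergForm (sievePrimes D R) k (Real.log R) l
        (fun p => (unitRoots h (h i) p : ℝ) / (p - 1)) := by
  rw [selbergForm_congr (g' := fun p => ((k : ℝ) - 1) / (p - 1))]
  · exact le_selbergForm_prime hR hk hD hl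
  · intro p hp
    have hpp := (mem_sievePrimes.1 hp).2
    have e := unitRoots_of_modEq hpp.1.pos h (hinj p hpp.1 hpp.2) ⟨i, Nat.ModEq.rfl⟩
    have e' : (unitRoots h (h i) p : ℝ) + 1 = k := by exact_mod_cast e
    rw [← e', add_sub_cancel_right]

/-! ### Primes of the tuple outnumber the others -/

/-- The inequality that would follow if no n worked: a tuple prime weighs at most log 3x, any other
prime at least log x. Restricting to shifts with (1 + s, W) = 1 loses nothing, because n ≡ 1 modulo
W and a prime n + s > W is coprime to W. -/
theorem log_mul_sum_primeLog_le {k x H W : ℕ} (hW : 0 < W) (hWx : W ≤ x) (hHx : H ≤ x)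
    (h : Fin k → ℕ) (hh : ∀ i, h i ≤ H) (N : Finset ℕ) (hN : ∀ n ∈ N, x < n ∧ n ≤ 2 * x ∧ n % W = 1)
    (w : ℕ → ℝ) (hw : ∀ n, 0 ≤ w n)
    (hle : ∀ n ∈ N, (Finset.univ.filter fun i => (n + h i).Prime).card ≤
      1 + ((Finset.range (H + 1)).filter fun s => (∀ i, s ≠ h i) ∧ (n + s).Prime).card) :
    Real.log x * ∑ i, ∑ n ∈ N, primeLog (n + h i) * w n ≤
      Real.log (3 * x) * (Real.log x * ∑ n ∈ N, w n +
        ∑ s ∈ (Finset.range (H + 1)).filter (fun s => (∀ i, s ≠ h i) ∧ (1 + s).Coprime W),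
          ∑ n ∈ N, primeLog (n + s) * w n) := by
  have hx1 : 1 ≤ x := by omega
  have hx0 : (1 : ℝ) ≤ x := by exact_mod_cast hx1
  have hlx : 0 ≤ Real.log x := Real.log_natCast_nonneg x
  have hl3 : 0 ≤ Real.log (3 * x) := Real.log_nonneg (by linarith)
  rw [Finset.sum_comm, Finset.sum_comm (t := N), Finset.mul_sum, Finset.mul_sum,
    ← Finset.sum_add_distrib, Finset.mul_sum]
  refine Finset.sum_le_sum fun n hn => ?_
  obtain ⟨hxn, hn2, hnW⟩ := hN n hn
  rw [← Finset.sum_mul, ← Finset.sum_mul]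
  have up : ∑ i, primeLog (n + h i) ≤
      Real.log (3 * x) * (Finset.univ.filter fun i => (n + h i).Prime).card := by
    rw [mul_comm, ← nsmul_eq_mul, ← Finset.sum_const, Finset.sum_filter]
    refine Finset.sum_le_sum fun i _ => ?_
    unfold primeLog
    split_ifs with hp
    · refine Real.log_le_log (by exact_mod_cast hp.pos) ?_
      have := hh i
      exact_mod_cast (by omega : n + h i ≤ 3 * x)
    · exact le_rfl
  have low : Real.log x *
      ((Finset.range (H + 1)).filter fun s => (∀ i, s ≠ h i) ∧ (n + s).Prime).card ≤
      ∑ s ∈ (Finset.range (H + 1)).filter (fun s => (∀ i, s ≠ h i) ∧ (1 + s).Coprime W),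
        primeLog (n + s) := by
    rw [mul_comm, ← nsmul_eq_mul, ← Finset.sum_const]
    refine le_trans (Finset.sum_le_sum fun s hs => ?_)
      (Finset.sum_le_sum_of_subset_of_nonneg (f := fun s => primeLog (n + s)) ?_
        fun s _ _ => primeLog_nonneg _)
    · rw [primeLog, if_pos (Finset.mem_filter.1 hs).2.2]
      exact Real.log_le_log (by linarith) (by exact_mod_cast (by omega : x ≤ n + s))
    · intro s hs
      rw [Finset.mem_filter] at hs ⊢
      refine ⟨hs.1, hs.2.1, ?_⟩
      have e : 1 + s ≡ n + s [MOD W] := by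
        refine Nat.ModEq.add_right s ?_
        have := Nat.mod_modEq n W
        rwa [hnW] at this
      rw [Nat.Coprime, e.gcd_eq]
      refine (Nat.Prime.coprime_iff_not_dvd hs.2.2).2 fun hd => ?_
      have := Nat.le_of_dvd hW hd
      omega
  have hc : (((Finset.univ.filter fun i => (n + h i).Prime).card : ℕ) : ℝ) ≤
      1 + (((Finset.range (H + 1)).filter fun s => (∀ i, s ≠ h i) ∧ (n + s).Prime).card : ℕ) := by
    exact_mod_cast hle n hn
  calc Real.log x * ((∑ i, primeLog (n + h i)) * w n)
      ≤ Real.log x * (Real.log (3 * x) * (1 +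
        (((Finset.range (H + 1)).filter fun s => (∀ i, s ≠ h i) ∧ (n + s).Prime).card : ℕ)) * w n) := by
        refine mul_le_mul_of_nonneg_left (mul_le_mul_of_nonneg_right ?_ (hw n)) hlx
        exact up.trans (mul_le_mul_of_nonneg_left hc hl3)
    _ = Real.log (3 * x) * ((Real.log x + Real.log x *
        (((Finset.range (H + 1)).filter fun s => (∀ i, s ≠ h i) ∧ (n + s).Prime).card : ℕ)) * w n) := by
        ring
    _ ≤ Real.log (3 * x) * ((Real.log x + ∑ s ∈ (Finset.range (H + 1)).filter
        (fun s => (∀ i, s ≠ h i) ∧ (1 + s).Coprime W), primeLog (n + s)) * w n) := by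
        refine mul_le_mul_of_nonneg_left (mul_le_mul_of_nonneg_right ?_ (hw n)) hl3
        linarith
    _ = _ := by ring

theorem eventually_log_floor_rpow_ge {η ε : ℝ} (hη : 0 < η) (hε : 0 < ε) :
    ∀ᶠ x : ℕ in atTop, (η - ε) * Real.log (3 * x) ≤ Real.log ⌊(x : ℝ) ^ η⌋₊ := by
  have h1 : ∀ᶠ x : ℕ in atTop, (η * Real.log 3 + Real.log 2) / ε ≤ Real.log x :=
    tendsto_log_natCast.eventually_ge_atTop _
  have h2 : ∀ᶠ x : ℕ in atTop, (1 : ℝ) ≤ (x : ℝ) ^ η :=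
    ((tendsto_rpow_atTop hη).comp tendsto_natCast_atTop_atTop).eventually_ge_atTop 1
  filter_upwards [h1, h2, eventually_ge_atTop 1] with x hx hx2 hx1
  have hx0 : (0 : ℝ) < x := by exact_mod_cast hx1
  rw [div_le_iff₀ hε] at hx
  have hf : (x : ℝ) ^ η / 2 ≤ (⌊(x : ℝ) ^ η⌋₊ : ℝ) := by
    have h3 := Nat.lt_floor_add_one ((x : ℝ) ^ η)
    have h4 : (1 : ℝ) ≤ (⌊(x : ℝ) ^ η⌋₊ : ℝ) := by
      exact_mod_cast Nat.le_floor (by simpa using hx2)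
    linarith
  have h5 := Real.log_le_log (by positivity) hf
  rw [Real.log_div (by positivity) (by norm_num), Real.log_rpow hx0] at h5
  rw [Real.log_mul (by norm_num) hx0.ne']
  have h6 : 0 ≤ Real.log 3 := Real.log_nonneg (by norm_num)
  nlinarith [mul_nonneg hε.le h6]

/-- Take 2η = t strictly between 1/2 and min(θ, 1). With u = 1/(l+1) the quantity is (t/2)(2 - u)²,
which tends to 2t > 1 as l grows and stays at most 2t < 2. -/
theorem exists_exponent_parameters {θ : ℝ} (hθ : 1 / 2 < θ) :
    ∃ η : ℝ, 0 < η ∧ 2 * η < θ ∧ 2 * η < 1 ∧ ∃ l : ℕ, 1 ≤ l ∧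
      1 < η * ((2 * l + 1) / (l + 1)) ^ 2 ∧ η * ((2 * l + 1) / (l + 1)) ^ 2 ≤ 2 := by
  obtain ⟨t, ht1, ht2⟩ := exists_between (lt_min hθ (show (1 / 2 : ℝ) < 1 by norm_num))
  have htθ := ht2.trans_le (min_le_left _ _)
  have ht1' := ht2.trans_le (min_le_right _ _)
  refine ⟨t / 2, by linarith, by linarith, by linarith, ?_⟩
  obtain ⟨l, hl⟩ := exists_nat_gt (4 / (2 * t - 1) + 1)
  have h2t : 0 < 2 * t - 1 := by linarith
  have hpos : 0 < 4 / (2 * t - 1) := by positivity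
  have hl1 : (1 : ℝ) ≤ l := by linarith
  have hl' : 4 < (2 * t - 1) * (l + 1) := by
    rw [← div_lt_iff₀' h2t]; linarith
  have hq : (2 * (l : ℝ) + 1) / (l + 1) = 2 - 1 / (l + 1) := by field_simp; ring
  have hu : 4 * (1 / ((l : ℝ) + 1)) < 2 * t - 1 := by
    rw [mul_one_div, div_lt_iff₀ (by linarith)]; exact hl'
  have hu0 : 0 < 1 / ((l : ℝ) + 1) := by positivity
  have hu1 : 1 / ((l : ℝ) + 1) ≤ 1 := by rw [div_le_one (by linarith)]; linarith
  refine ⟨l, by exact_mod_cast hl1, ?_, ?_⟩ <;> rw [hq] <;>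
    set u := 1 / ((l : ℝ) + 1)
  · nlinarith [sq_nonneg u]
  · nlinarith [sq_nonneg u]

/-- After division by M the lower bound is 1 + Δ and the upper bound (1 + Δ/8)², up to multiples of
ε. Those losses total at most (k + 10) ε = Δ/4, so the bounds are incompatible for 0 < Δ ≤ 1. -/
theorem false_of_sieve_bounds {k l : ℕ} (hk : k = (2 * l + 1) ^ 2) {η Δ ε c E M I r : ℝ}
    (hΔ : η * ((2 * l + 1) / (l + 1)) ^ 2 = 1 + Δ) (hΔ0 : 0 < Δ) (hΔ1 : Δ ≤ 1)
    (hε : ε = Δ / (4 * (k + 10))) (hc : 21 * k * c ≤ Δ / 8) (hE : E ≤ 1 + Δ / 8) (hM : 0 < M)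
    (hr : η - ε ≤ r) (h : k * (r * M / (l + 1) ^ 2) - k * (ε * M) ≤ I)
    (hI : I ≤ (E + ε) * M + ε * M + (21 * k * c * ((E + ε) * M) + 2 * (ε * M))) (hE0 : 0 < E) : False := by
  have hk' : (k : ℝ) = (2 * l + 1) ^ 2 := by rw [hk]; push_cast; ring
  have hk0 : (0 : ℝ) ≤ k := Nat.cast_nonneg k
  have hε0 : 0 < ε := by rw [hε]; positivity
  have hεk : (k + 10) * ε = Δ / 4 := by rw [hε]; field_simp
  set v := ((2 * (l : ℝ) + 1) / (l + 1)) ^ 2 with hv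
  have hv4 : v ≤ 4 := by
    have h1 : (2 * (l : ℝ) + 1) / (l + 1) ≤ 2 := by
      rw [div_le_iff₀ (by positivity)]; linarith
    have h2 : 0 ≤ (2 * (l : ℝ) + 1) / (l + 1) := by positivity
    nlinarith
  have hv0 : 0 ≤ v := sq_nonneg _
  have e1 : k * (r * M / (l + 1) ^ 2) = v * r * M := by rw [hv, hk', div_pow]; ring
  rw [e1] at h
  have h1 : v * (η - ε) * M ≤ v * r * M :=
    mul_le_mul_of_nonneg_right (mul_le_mul_of_nonneg_left hr hv0) hM.le
  have h2 : (v * (η - ε) - k * ε) * M ≤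
      ((1 + 21 * k * c) * (E + ε) + 3 * ε) * M := by
    linarith
  have h3 := le_of_mul_le_mul_right h2 hM
  have h4 : (1 + 21 * k * c) * (E + ε) ≤ (1 + Δ / 8) * (1 + Δ / 8 + ε) := by
    refine mul_le_mul (by linarith) (by linarith) (by linarith) (by linarith)
  have h5 : v * ε ≤ 4 * ε := mul_le_mul_of_nonneg_right hv4 hε0.le
  nlinarith [mul_nonneg hΔ0.le hε0.le, mul_le_mul_of_nonneg_right hΔ1 hε0.le,
    mul_le_mul_of_nonneg_right hΔ1 hΔ0.le]

set_option maxHeartbeats 1000000 in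
/-- If the primes have a level of distribution exceeding `1/2`, then in short intervals there are
translates of suitable tuples in which the primes of the tuple outnumber by two the remaining
primes of the interval. -/
theorem HasLevelOfDistribution.exists_primes_in_tuple {θ : ℝ} (hθ : 1 / 2 < θ)
    (hlevel : HasLevelOfDistribution θ) :
    ∃ k : ℕ, 2 ≤ k ∧ ∃ c : ℝ, 0 < c ∧ ∃ D₀ : ℕ, ∀ D, D₀ ≤ D → ∃ H₁ : ℕ, ∀ᶠ x : ℕ in atTop,
      ∀ h : Fin k → ℕ, (∀ p, p.Prime → D < p → ∀ i j, h i ≡ h j [MOD p] → i = j) →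
      (∀ i, primorial D ∣ h i) → ∀ H : ℕ, H₁ ≤ H → (H : ℝ) ≤ c * Real.log x → (∀ i, h i ≤ H) →
      ∃ n ∈ Finset.Ioc x (2 * x),
        1 + ((Finset.range (H + 1)).filter fun s => (∀ i, s ≠ h i) ∧ (n + s).Prime).card <
          (Finset.univ.filter fun i => (n + h i).Prime).card := by
  obtain ⟨η, hη, hηθ, hη1, l, hl, hlow, hup⟩ := exists_exponent_parameters hθ
  obtain ⟨k, hk⟩ : ∃ k : ℕ, k = (2 * l + 1) ^ 2 := ⟨_, rfl⟩
  have hk2 : 2 ≤ k := by rw [hk]; nlinarith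
  have hk0 : (0 : ℝ) < k := by exact_mod_cast (by omega : 0 < k)
  obtain ⟨Δ, hΔ⟩ : ∃ Δ : ℝ, η * ((2 * l + 1) / (l + 1)) ^ 2 = 1 + Δ :=
    ⟨η * ((2 * l + 1) / (l + 1)) ^ 2 - 1, by ring⟩
  have hΔ0 : 0 < Δ := by linarith
  have hΔ1 : Δ ≤ 1 := by linarith
  obtain ⟨ε, hε⟩ : ∃ ε : ℝ, ε = Δ / (4 * (k + 10)) := ⟨_, rfl⟩
  have hε0 : 0 < ε := by rw [hε]; positivity
  -- 168 = 8 · 21: primes outside the tuple, of relative weight 21kc, then use up only Δ/8.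
  obtain ⟨c, hc⟩ : ∃ c : ℝ, c = Δ / (168 * k) := ⟨_, rfl⟩
  have hc0 : 0 < c := by rw [hc]; positivity
  have hc1 : 21 * k * c ≤ Δ / 8 := by rw [hc]; field_simp; norm_num
  have hc2 : c ≤ 1 := by
    have : (2 : ℝ) ≤ k := by exact_mod_cast hk2
    nlinarith
  refine ⟨k, hk2, c, hc0, ?_⟩
  -- Large D brings the loss exp(2k/D) in the comparison of Riesz sums below 1 + Δ/8.
  have hlimE : Tendsto (fun D : ℕ => Real.exp (2 * k / (D : ℝ))) atTop (nhds (Real.exp 0)) :=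
    (Real.continuous_exp.tendsto 0).comp
      (tendsto_const_nhds.div_atTop tendsto_natCast_atTop_atTop)
  rw [Real.exp_zero] at hlimE
  obtain ⟨D₀, hD₀⟩ := eventually_atTop.1
    (hlimE.eventually_le_const (show 1 < 1 + Δ / 8 by linarith))
  refine ⟨max D₀ (max (16 * k) (2 ^ (k + 2))), fun D hD => ?_⟩
  have hDE := hD₀ D ((le_max_left _ _).trans hD)
  have hD16 : 16 * k ≤ D := (le_max_left _ _).trans ((le_max_right _ _).trans hD)
  have hDk : 2 ^ (k + 2) ≤ D := (le_max_right _ _).trans ((le_max_right _ _).trans hD)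
  have hD2 : 2 * k ≤ D := by omega
  obtain ⟨H₁, hH₁⟩ := exists_sum_selbergForm_shift_le hk2 hD16 hDk
  refine ⟨H₁, ?_⟩
  set W := primorial D with hW
  have hWpos : 0 < W := primorial_pos D
  have hWr : (0 : ℝ) < W := by exact_mod_cast hWpos
  have hφ : (0 : ℝ) < Nat.totient W := by exact_mod_cast Nat.totient_pos.2 hWpos
  set δ := coprimeDensity W with hδdef
  have hδ : 0 < δ := coprimeDensity_primorial_pos D
  have hφδ : (Nat.totient W : ℝ) = δ * W := by rw [hδdef, coprimeDensity]; field_simp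
  have hLtop : Tendsto (fun x : ℕ => Real.log ⌊(x : ℝ) ^ η⌋₊) atTop atTop :=
    Real.tendsto_log_atTop.comp (tendsto_natCast_atTop_atTop.comp
      (tendsto_nat_floor_atTop.comp ((tendsto_rpow_atTop hη).comp tendsto_natCast_atTop_atTop)))
  filter_upwards [hlevel.eventually_sum_primeLog hη hηθ hη1 (k := k) (l := l) (D := D) (by omega)
      hD2 hl 1,
    eventually_sum_sieveWeight hη hη1 (k := k) (l := l) (D := D) (by omega) hD2 hl 1,
    hLtop.eventually (eventually_mul_rieszSum_le hl hk hD2 hε0),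
    hLtop.eventually_ge_atTop 1, eventually_log_floor_rpow_ge hη hε0,
    tendsto_log_natCast.eventually_ge_atTop (max 1 (W / (ε * δ))), eventually_ge_atTop W,
    eventually_ge_atTop 1]
    with x hΘ hS hT hL1 hLη hlx hWx hx1 h hinj hdvd H hH Hc hh
  by_contra hcon
  push Not at hcon
  set R := ⌊(x : ℝ) ^ η⌋₊
  set L := Real.log (R : ℝ) with hLdef
  have hR : 0 < R := by
    rcases Nat.eq_zero_or_pos R with h0 | h0
    · rw [hLdef, h0] at hL1; simp at hL1; linarith
    · exact h0
  specialize hT R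
  set P := sievePrimes D R
  set T := rieszSum P (fun p => (k : ℝ) / (p - k)) L (2 * l)
  set Ts := rieszSum P (fun p => ((k : ℝ) - 1) / (p - k)) L (2 * l + 2)
  set N := (Finset.Ioc x (2 * x)).filter (fun n => n % W = 1)
  have hx0 : (0 : ℝ) < x := by exact_mod_cast hx1
  have hlx1 : 1 ≤ Real.log x := (le_max_left _ _).trans hlx
  have hlx2 : W / (ε * δ) ≤ Real.log x := (le_max_right _ _).trans hlx
  have hHx : H ≤ x := by
    have h1 : (H : ℝ) ≤ x := by
      have := Real.log_le_sub_one_of_pos hx0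
      nlinarith
    exact_mod_cast h1
  have hTs : L ^ (2 * l + 2) ≤ Ts := by
    refine pow_le_rieszSum (fun p hp => div_nonneg ?_ (sub_pos_of_mem_sievePrimes hD2 hp).le)
      (by linarith) _
    have : (2 : ℝ) ≤ k := by exact_mod_cast hk2
    linarith
  have hTsL : L ≤ Ts := (le_self_pow₀ hL1 (by omega)).trans hTs
  -- The common scale: the total weight is at most about M, and each tuple position yields at least
  -- about L M/(l+1)². Since T* ≥ L, also M ≥ δx/W, so errors of size x/log x are below εM.
  set M := x / W * δ * Ts / L with hM
  set e := (x : ℝ) / Real.log x ^ 1 with he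
  have hL0 : 0 < L := by linarith
  have hMlow : x / W * δ ≤ M := by
    rw [hM, le_div_iff₀ hL0]
    exact mul_le_mul_of_nonneg_left hTsL (by positivity)
  have hM0 : 0 < M := lt_of_lt_of_le (by positivity) hMlow
  have heM : e ≤ ε * M := by
    refine le_trans ?_ (mul_le_mul_of_nonneg_left hMlow hε0.le)
    rw [he, pow_one, div_le_iff₀ (by linarith)]
    have : W ≤ Real.log x * (ε * δ) := by rwa [div_le_iff₀ (by positivity)] at hlx2
    calc (x : ℝ) = x / W * W := by field_simp
      _ ≤ x / W * (Real.log x * (ε * δ)) := mul_le_mul_of_nonneg_left this (by positivity)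
      _ = _ := by ring
  have he0 : 0 ≤ e := by positivity
  set E := Real.exp (2 * k / (D : ℝ))
  have hTM : x / W * T ≤ (E + ε) * M := by
    rw [hM]
    have : T ≤ (E + ε) * δ * Ts / L := by rw [le_div_iff₀ hL0]; linarith
    refine (mul_le_mul_of_nonneg_left this (by positivity)).trans (le_of_eq ?_)
    ring
  set w := fun n => sieveWeight P L l h n
  have hcomb := log_mul_sum_primeLog_le (k := k) (x := x) (H := H) (W := W) hWpos hWx hHx h hh N
    (fun n hn => by
      simp only [N, Finset.mem_filter, Finset.mem_Ioc] at hn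
      exact ⟨hn.1.1, hn.1.2, hn.2⟩) w (fun n => sieveWeight_nonneg _ _ _ _ _)
    (fun n hn => hcon n (Finset.mem_filter.1 hn).1)
  have hcop : ∀ i, (1 + h i).Coprime W := fun i => by
    obtain ⟨m, hm⟩ := hdvd i
    rw [hm]
    simp
  set Θ := fun s => ∑ n ∈ N, primeLog (n + s) * w n
  have hΘlow : ∀ i, L * M / (l + 1) ^ 2 - ε * M ≤ Θ (h i) := by
    intro i
    have h1 := (abs_le.1 (hΘ h hinj (h i) ((hh i).trans hHx) (hcop i))).1
    have h2 := selbergForm_prime_ge hR hk2 hD2 hl h hinj i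
    have h3 := mul_le_mul_of_nonneg_left h2 (show 0 ≤ (x : ℝ) / Nat.totient W by positivity)
    have h4 : (x : ℝ) / Nat.totient W * ((δ / (l + 1)) ^ 2 * Ts) = L * M / (l + 1) ^ 2 := by
      rw [hφδ, hM]; field_simp
    change (x : ℝ) / Nat.totient W * ((δ / (l + 1)) ^ 2 * Ts) ≤ _ at h3
    rw [h4] at h3
    change -e ≤ Θ (h i) - _ at h1
    linarith
  have hS1 : ∑ n ∈ N, w n ≤ (E + ε) * M + ε * M := by
    have h1 := (abs_le.1 (hS h hinj)).2
    change ∑ n ∈ N, w n - x / W * T ≤ e at h1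
    linarith
  set O := (Finset.range (H + 1)).filter (fun s => (∀ i, s ≠ h i) ∧ (1 + s).Coprime W)
  have hOcard : (O.card : ℝ) ≤ H + 1 := by
    have : O.card ≤ H + 1 := (Finset.card_filter_le _ _).trans (Finset.card_range _).le
    exact_mod_cast this
  have hO : ∑ s ∈ O, Θ s ≤ Real.log x * (21 * k * c * ((E + ε) * M) + 2 * (ε * M)) := by
    have h1 : ∀ s ∈ O, Θ s ≤ x / Nat.totient W *
        selbergForm P k L l (fun p => (unitRoots h s p : ℝ) / (p - 1)) + e := by
      intro s hs
      rw [Finset.mem_filter, Finset.mem_range] at hs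
      have := (abs_le.1 (hΘ h hinj s (by omega) hs.2.2)).2
      change Θ s - _ ≤ e at this
      linarith
    have h2 := hH₁ H hH R L l h hinj hh
    refine (Finset.sum_le_sum h1).trans ?_
    rw [Finset.sum_add_distrib, ← Finset.mul_sum, Finset.sum_const, nsmul_eq_mul]
    have h3 := mul_le_mul_of_nonneg_left h2 (show 0 ≤ (x : ℝ) / Nat.totient W by positivity)
    have h4 : (x : ℝ) / Nat.totient W * (21 * k * δ * H * T) = 21 * k * H * (x / W * T) := by
      rw [hφδ]; field_simp
    change _ ≤ (x : ℝ) / Nat.totient W * (21 * k * δ * H * T) at h3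
    rw [h4] at h3
    have hEM : 0 ≤ (E + ε) * M := by positivity
    have h5 : 21 * k * (H : ℝ) * (x / W * T) ≤ 21 * k * (c * Real.log x) * ((E + ε) * M) :=
      (mul_le_mul_of_nonneg_left hTM (by positivity)).trans
        (mul_le_mul_of_nonneg_right (mul_le_mul_of_nonneg_left Hc (by positivity)) hEM)
    have h6 : O.card * e ≤ 2 * Real.log x * (ε * M) := by
      refine mul_le_mul ?_ heM he0 (by linarith)
      have := mul_le_mul_of_nonneg_right hc2 (zero_le_one.trans hlx1)
      linarith
    linarith
  have hl3 : Real.log x ≤ Real.log (3 * x) := Real.log_le_log hx0 (by linarith)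
  have hl30 : 0 < Real.log (3 * x) := by linarith
  refine false_of_sieve_bounds hk hΔ hΔ0 hΔ1 hε hc1 hDE hM0 (r := L / Real.log (3 * x))
    (by rw [le_div_iff₀ hl30]; exact hLη) (I := (∑ i, Θ (h i)) / Real.log (3 * x)) ?_ ?_
    (Real.exp_pos _)
  · rw [le_div_iff₀ hl30]
    have h1 : (k : ℝ) * (L * M / (l + 1) ^ 2 - ε * M) ≤ ∑ i, Θ (h i) := by
      have := Finset.sum_le_sum (s := Finset.univ) fun i _ => hΘlow i
      rwa [Finset.sum_const, Finset.card_univ, Fintype.card_fin, nsmul_eq_mul] at this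
    refine le_trans ?_ h1
    have h2 : ε * M * 1 ≤ ε * M * Real.log (3 * x) :=
      mul_le_mul_of_nonneg_left (by linarith) (by positivity)
    have h3 : (k * (L / Real.log (3 * x) * M / (l + 1) ^ 2) - k * (ε * M)) * Real.log (3 * x) =
        k * (L * M / (l + 1) ^ 2 - ε * M * Real.log (3 * x)) := by
      field_simp
    rw [h3]
    exact mul_le_mul_of_nonneg_left (by linarith) hk0.le
  · rw [div_le_iff₀ hl30]
    have hlx0 : 0 < Real.log x := by linarith
    refine le_of_mul_le_mul_left (hcomb.trans ?_) hlx0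
    have : Real.log x * ∑ n ∈ N, w n + ∑ s ∈ O, Θ s ≤
        Real.log x * ((E + ε) * M + ε * M + (21 * k * c * ((E + ε) * M) + 2 * (ε * M))) := by
      have := mul_le_mul_of_nonneg_left hS1 hlx0.le
      linarith
    refine (mul_le_mul_of_nonneg_left this hl30.le).trans (le_of_eq ?_)
    ring

/-! ### From tuples to limit points of prime gaps -/

theorem primeSeq_primeCounting {p : ℕ} (hp : p.Prime) : primeSeq (Nat.primeCounting p) = p := by
  rw [primeSeq, Nat.primeCounting, Nat.primeCounting', Nat.count_succ, if_pos hp,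
    Nat.add_sub_cancel]
  exact Nat.nth_count hp

theorem primeSeq_primeCounting_succ {p q : ℕ} (hq : q.Prime) (hpq : p < q)
    (hno : ∀ r, p < r → r < q → ¬ r.Prime) : primeSeq (Nat.primeCounting p + 1) = q := by
  rw [primeSeq, Nat.primeCounting, Nat.primeCounting', Nat.add_sub_cancel]
  have : Nat.count Nat.Prime (p + 1) = Nat.count Nat.Prime q := by
    rw [Nat.count_eq_card_filter_range, Nat.count_eq_card_filter_range]
    congr 1
    ext r
    simp only [Finset.mem_filter, Finset.mem_range]
    constructor
    · rintro ⟨a, b⟩; exact ⟨by omega, b⟩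
    · rintro ⟨a, b⟩
      refine ⟨?_, b⟩
      by_contra h
      exact hno r (by omega) a b
  rw [this]
  exact Nat.nth_count hq

theorem primeSeq_primeCounting_le {x : ℕ} (hx : 2 ≤ x) : primeSeq (Nat.primeCounting x) ≤ x := by
  have h1 : 0 < Nat.primeCounting x := by
    have : Nat.primeCounting 2 ≤ Nat.primeCounting x := Nat.monotone_primeCounting hx
    have e : Nat.primeCounting 2 = 1 := by decide
    omega
  have h2 : Nat.nth Nat.Prime (Nat.primeCounting x - 1) < x + 1 := by
    refine Nat.nth_lt_of_lt_count ?_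
    change _ < Nat.primeCounting x
    omega
  exact Nat.lt_succ_iff.1 h2

/-- If every two neighbouring tuple primes were separated by some other prime, that prime would lie
at a shift outside the tuple, and interleaving would bound the tuple primes by one more than the
others. -/
theorem exists_consecutive_primes {k n H : ℕ} (h : Fin k → ℕ) (hinj : Function.Injective h)
    (hh : ∀ i, h i ≤ H)
    (hlt : 1 + ((Finset.range (H + 1)).filter fun s => (∀ i, s ≠ h i) ∧ (n + s).Prime).card <
      (Finset.univ.filter fun i => (n + h i).Prime).card) :
    ∃ i j, h i < h j ∧ (n + h i).Prime ∧ (n + h j).Prime ∧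
      ∀ r, n + h i < r → r < n + h j → ¬ r.Prime := by
  by_contra hcon
  push Not at hcon
  set A := (Finset.univ.filter fun i => (n + h i).Prime).image h
  set B := (Finset.range (H + 1)).filter fun s => (∀ i, s ≠ h i) ∧ (n + s).Prime
  have hA : A.card = (Finset.univ.filter fun i => (n + h i).Prime).card :=
    Finset.card_image_of_injective _ hinj
  have : A.card ≤ B.card + 1 := by
    refine Finset.card_le_of_interleaved fun a ha b hb hab hno => ?_
    obtain ⟨i, hi, rfl⟩ := Finset.mem_image.1 ha
    obtain ⟨j, hj, rfl⟩ := Finset.mem_image.1 hb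
    obtain ⟨r, hr1, hr2, hr⟩ := hcon i j hab (Finset.mem_filter.1 hi).2 (Finset.mem_filter.1 hj).2
    obtain ⟨s, rfl⟩ : ∃ s, r = n + s := ⟨r - n, by omega⟩
    refine ⟨s, ?_, by omega, by omega⟩
    refine Finset.mem_filter.2 ⟨Finset.mem_range.2 ?_, fun m hm => ?_, hr⟩
    · have := hh j
      omega
    · refine hno s (Finset.mem_image.2 ⟨m, Finset.mem_filter.2 ⟨Finset.mem_univ _, ?_⟩, hm.symm⟩)
        ⟨by omega, by omega⟩
      rw [← hm]; exact hr
  omega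

/-- If no interval `[0, c]` consists of limit points of `u`, there is a rapidly decreasing sequence of
small points `β i` such that `u` eventually stays at distance at least `ε i` from `β i`. -/
theorem exists_avoided_sequence {u : ℕ → ℝ} (hu : ∀ c > 0, ¬ Icc 0 c ⊆ limitPoints u) {c : ℝ}
    (hc : 0 < c) :
    ∃ β ε : ℕ → ℝ, (∀ i, 0 < ε i ∧ ε i ≤ β i ∧ β i ≤ c ∧ ∀ᶠ n in atTop, ε i ≤ |u n - β i|) ∧
      ∀ i j, i < j → β j ≤ ε i / 4 := by
  have hbad : ∀ c : {c : ℝ // 0 < c}, ∃ (β : ℝ) (ε : {c : ℝ // 0 < c}),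
      (ε : ℝ) ≤ β ∧ β ≤ c ∧ ∀ᶠ n in atTop, (ε : ℝ) ≤ |u n - β| := by
    rintro ⟨c, hc⟩
    obtain ⟨t, ⟨ht0, htc⟩, ht⟩ := Set.not_subset.1 (hu c hc)
    obtain ⟨e, he, hev⟩ : ∃ e > 0, ∀ᶠ n in atTop, e ≤ |u n - t| := by
      rw [limitPoints, Set.mem_ofPred_eq, mapClusterPt_iff_frequently] at ht
      push Not at ht
      obtain ⟨s, hs, hsn⟩ := ht
      obtain ⟨e, he, hes⟩ := Metric.mem_nhds_iff.1 hs
      refine ⟨e, he, ?_⟩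
      filter_upwards [hsn] with n hn
      by_contra hlt
      exact hn (hes (by rw [Metric.mem_ball, Real.dist_eq]; linarith))
    -- When the avoided point is 0, move to a positive β ≤ e/2: the distance to it is at least e - β
    -- ≥ β, so the radius can be β itself.
    rcases ht0.eq_or_lt with h0 | h0
    · have hm : 0 < min c (e / 2) := lt_min hc (by linarith)
      refine ⟨min c (e / 2), ⟨min c (e / 2), hm⟩, le_rfl, min_le_left _ _, ?_⟩
      filter_upwards [hev] with n hn
      rw [← h0, sub_zero] at hn
      have h1 := abs_sub_abs_le_abs_sub (u n) (min c (e / 2))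
      rw [abs_of_pos hm] at h1
      have h2 := min_le_right c (e / 2)
      change min c (e / 2) ≤ _
      linarith
    · refine ⟨t, ⟨min e t, lt_min he h0⟩, min_le_right _ _, htc, ?_⟩
      filter_upwards [hev] with n hn
      exact (min_le_left _ _).trans hn
  choose b e heb hbc hev using hbad
  -- The next point is sought in [0, ε/4], which forces β_j ≤ ε_i/4 for all later j.
  let s : ℕ → {c : ℝ // 0 < c} := fun n => Nat.rec ⟨c, hc⟩
    (fun _ r => ⟨(e r : ℝ) / 4, by have := (e r).2; linarith⟩) n
  have hs : ∀ n, (s (n + 1)).1 = (e (s n) : ℝ) / 4 := fun n => rfl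
  have hanti : Antitone fun n => (s n).1 := by
    refine antitone_nat_of_succ_le fun n => ?_
    rw [hs]
    have h1 := heb (s n)
    have h2 := hbc (s n)
    have h3 := (e (s n)).2
    linarith
  refine ⟨fun i => b (s i), fun i => e (s i), fun i => ⟨(e (s i)).2, heb _, ?_, hev _⟩,
    fun i j hij => ?_⟩
  · exact (hbc (s i)).trans (hanti (Nat.zero_le i))
  · refine (hbc (s j)).trans ((hanti (Nat.succ_le_of_lt hij)).trans (hs i).le)

/-- The integers 2^a m with N ≤ m < 2N approximate any y ≥ N within a factor 1 - 1/N while having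
only bounded prime factors. Scaling a tuple by such a number creates no new congruences modulo
primes p > D. -/
theorem exists_two_pow_mul_le {N : ℕ} (hN : 0 < N) {y : ℝ} (hy : (N : ℝ) ≤ y) :
    ∃ a m : ℕ, N ≤ m ∧ m < 2 * N ∧ ((2 ^ a * m : ℕ) : ℝ) ≤ y ∧
      y * (1 - 1 / N) ≤ ((2 ^ a * m : ℕ) : ℝ) := by
  have hN0 : (0 : ℝ) < N := by exact_mod_cast hN
  obtain ⟨a, ha1, ha2⟩ := exists_nat_pow_near ((one_le_div hN0).2 hy) (show (1 : ℝ) < 2 by norm_num)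
  have h2a : (0 : ℝ) < 2 ^ a := by positivity
  rw [le_div_iff₀ hN0] at ha1
  rw [div_lt_iff₀ hN0, pow_succ] at ha2
  have hq : 0 ≤ y / 2 ^ a := by
    have : 0 ≤ y := hN0.le.trans hy
    positivity
  have hNm : N ≤ ⌊y / 2 ^ a⌋₊ := Nat.le_floor (by rw [le_div_iff₀ h2a]; linarith)
  refine ⟨a, ⌊y / 2 ^ a⌋₊, hNm, ?_, ?_, ?_⟩
  · rw [Nat.floor_lt hq, div_lt_iff₀ h2a]; push_cast; linarith
  · push_cast
    have := Nat.floor_le hq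
    rw [le_div_iff₀ h2a] at this
    linarith
  · push_cast
    have h1 := Nat.lt_floor_add_one (y / 2 ^ a)
    rw [div_lt_iff₀ h2a] at h1
    set m := ⌊y / 2 ^ a⌋₊
    have hm : (N : ℝ) ≤ m := by exact_mod_cast hNm
    have h3 : (0 : ℝ) ≤ 1 - 1 / N := by
      have : 1 / (N : ℝ) ≤ 1 := by
        rw [div_le_one hN0]; exact_mod_cast hN
      linarith
    refine (mul_le_mul_of_nonneg_right h1.le h3).trans ?_
    have h4 : ((m : ℝ) + 1) * (1 - 1 / N) ≤ m := by
      have : 1 ≤ (m : ℝ) / N := by rwa [one_le_div hN0]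
      have h5 : 0 < 1 / (N : ℝ) := by positivity
      have e : ((m : ℝ) + 1) * (1 - 1 / N) = m + 1 - m / N - 1 / N := by ring
      linarith
    nlinarith

/-- Otherwise iterating x ↦ 3x would make G(3^j x₀) at least (1+τ)^j, exponential in j, whereas
log(3^j x₀) is linear in j. -/
theorem frequently_le_mul_of_le_log {G : ℕ → ℝ} (hG : Tendsto G atTop atTop)
    (hlog : ∀ᶠ x in atTop, G x ≤ Real.log x) {τ : ℝ} (hτ : 0 < τ) :
    ∃ᶠ x in atTop, G (3 * x) ≤ (1 + τ) * G x := by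
  intro hcon
  obtain ⟨x₀, hx₀⟩ := eventually_atTop.1
    (hcon.and (hlog.and ((hG.eventually_ge_atTop 1).and (eventually_ge_atTop 1))))
  have hpos : 1 ≤ x₀ := (hx₀ x₀ le_rfl).2.2.2
  have hle : ∀ j : ℕ, x₀ ≤ 3 ^ j * x₀ := fun j =>
    Nat.le_mul_of_pos_left _ (by positivity)
  have hgrow : ∀ j : ℕ, (1 + τ) ^ j ≤ G (3 ^ j * x₀) := by
    intro j
    induction j with
    | zero => simpa using (hx₀ x₀ le_rfl).2.2.1
    | succ j ih =>
      have h1 := (hx₀ _ (hle j)).1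
      rw [not_le] at h1
      have e : 3 ^ (j + 1) * x₀ = 3 * (3 ^ j * x₀) := by rw [pow_succ]; ring
      rw [e, pow_succ]
      nlinarith
  have hup : ∀ j : ℕ, (1 + τ) ^ j ≤ j * Real.log 3 + Real.log x₀ := fun j => by
    refine ((hgrow j).trans (hx₀ _ (hle j)).2.1).trans (le_of_eq ?_)
    have : (x₀ : ℝ) ≠ 0 := by exact_mod_cast (by omega : x₀ ≠ 0)
    push_cast
    rw [Real.log_mul (by positivity) this, Real.log_pow]
  have h1 : Tendsto (fun j : ℕ => (j : ℝ) ^ 1 / (1 + τ) ^ j) atTop (nhds 0) :=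
    tendsto_pow_const_div_const_pow_of_one_lt 1 (by linarith)
  have h2 : Tendsto (fun j : ℕ => (j : ℝ) ^ 0 / (1 + τ) ^ j) atTop (nhds 0) :=
    tendsto_pow_const_div_const_pow_of_one_lt 0 (by linarith)
  have h3 := ((h1.mul_const (Real.log 3)).add (h2.mul_const (Real.log x₀)))
  rw [zero_mul, zero_mul, add_zero] at h3
  obtain ⟨j, hj⟩ := (h3.eventually_lt_const (show (0 : ℝ) < 1 by norm_num)).exists
  have hp : 0 < (1 + τ) ^ j := by positivity
  have := hup j
  rw [pow_one, pow_zero, div_mul_eq_mul_div, div_mul_eq_mul_div, ← add_div, div_lt_one hp] at hj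
  linarith

theorem le_of_prime_dvd_primorial {p D : ℕ} (hp : p.Prime) (h : p ∣ primorial D) : p ≤ D := by
  by_contra hlt
  have := coprime_primorial_of_mem (mem_sievePrimes.2 ⟨le_refl p, hp, not_le.1 hlt⟩)
  exact hp.one_lt.ne' (Nat.dvd_one.1 (this ▸ Nat.dvd_gcd dvd_rfl h))

theorem tuple_modEq_imp_eq {k D N a m : ℕ} (hD : 2 * N ≤ D) (hD2 : 2 ≤ D) (hm : 0 < m)
    (hmN : m < 2 * N) {b : Fin k → ℕ} (hb : Function.Injective b) (hbN : ∀ i, b i ≤ N) {p : ℕ}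
    (hp : p.Prime) (hDp : D < p) (i j : Fin k)
    (hij : primorial D * (2 ^ a * m) * b i ≡ primorial D * (2 ^ a * m) * b j [MOD p]) : i = j := by
  have hcop : p.Coprime (primorial D * (2 ^ a * m)) := by
    refine (Nat.Prime.coprime_iff_not_dvd hp).2 fun hd => ?_
    rcases (Nat.Prime.dvd_mul hp).1 hd with h | h
    · exact absurd (le_of_prime_dvd_primorial hp h) (by omega)
    · rcases (Nat.Prime.dvd_mul hp).1 h with h | h
      · exact absurd (Nat.le_of_dvd (by norm_num) (hp.dvd_of_dvd_pow h)) (by omega)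
      · exact absurd (Nat.le_of_dvd hm h) (by omega)
  have h1 := Nat.ModEq.cancel_left_of_coprime hcop hij
  refine hb (h1.eq_of_lt_of_lt ?_ ?_)
  · have := hbN i; omega
  · have := hbN j; omega

/-- Three errors lower the quotient, each by at most εi/4: rounding 2/N, the smaller shift βj, and
the relative variation τ of the normalisation, for which βi ≤ 1 is used. The quotient never exceeds
βi. -/
theorem abs_sub_lt_of_bounds {βi βj εi G₀ G₁ τ N hi hj : ℝ} (hG₀ : 0 < G₀) (hG1 : G₀ ≤ G₁)
    (hG2 : G₁ ≤ (1 + τ) * G₀) (hτ0 : 0 < τ) (hτ : τ ≤ εi / 4) (hN : 2 / N ≤ εi / 4)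
    (hβ1 : βi ≤ 1) (hεβ : εi ≤ βi) (hβj : βj ≤ εi / 4)
    (hi1 : hi ≤ βi * G₀) (hi2 : (βi - 2 / N) * G₀ ≤ hi) (hj0 : 0 ≤ hj) (hj1 : hj ≤ βj * G₀) :
    |(hi - hj) / G₁ - βi| < εi := by
  have hG₁ : 0 < G₁ := by linarith
  rw [abs_lt]
  constructor
  · rw [lt_sub_iff_add_lt, lt_div_iff₀ hG₁]
    have h1 : (-εi + βi) * G₁ ≤ (-εi + βi) * ((1 + τ) * G₀) :=
      mul_le_mul_of_nonneg_left hG2 (by linarith)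
    have h2 : (-εi + βi) * (1 + τ) < βi - 2 / N - βj := by nlinarith
    have h3 := mul_lt_mul_of_pos_right h2 hG₀
    linarith
  · have h1 : (hi - hj) / G₁ ≤ βi := by
      rw [div_le_iff₀ hG₁]
      have := mul_le_mul_of_nonneg_left hG1 (show 0 ≤ βi by linarith)
      linarith
    linarith

/-- If the primes have a level of distribution exceeding `1/2`, then the gaps between primes
normalized by a slowly increasing function have all sufficiently small nonnegative reals as limit
points. -/
theorem HasLevelOfDistribution.exists_Icc_subset_limitPoints {θ : ℝ} (hθ : 1 / 2 < θ)
    (hlevel : HasLevelOfDistribution θ) {G : ℕ → ℝ} (hmono : MonotoneOn G (Ici 2))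
    (hlim : Tendsto G atTop atTop) (hlog : ∀ n, 2 ≤ n → G n ≤ Real.log (primeSeq n)) :
    ∃ c : ℝ, 0 < c ∧
      Icc 0 c ⊆ limitPoints fun n => ((primeSeq (n + 1) : ℝ) - primeSeq n) / G n := by
  by_contra hcon
  push Not at hcon
  obtain ⟨k, hk, c, hc, D₀, hsieve⟩ := hlevel.exists_primes_in_tuple hθ
  obtain ⟨β, ε, hβε, hβlt⟩ := exists_avoided_sequence hcon (lt_min hc one_pos)
  have hβ1 : ∀ i, β i ≤ 1 := fun i => (hβε i).2.2.1.trans (min_le_right _ _)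
  have hβc : ∀ i, β i ≤ c := fun i => (hβε i).2.2.1.trans (min_le_left _ _)
  have hβ0 : ∀ i, 0 < β i := fun i => (hβε i).1.trans_le (hβε i).2.1
  have hεanti : Antitone ε := antitone_nat_of_succ_le fun i => by
    have := hβlt i (i + 1) (Nat.lt_succ_self i)
    linarith [(hβε i).1, (hβε (i + 1)).2.1]
  set e := ε k
  have he : 0 < e := (hβε k).1
  have hei : ∀ i : Fin k, e ≤ ε i := fun i => hεanti i.2.le
  -- With N e > 8 the integers ⌊N β_i⌋ are strictly decreasing in i, and the rounding error 2/N is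
  -- at most e/4, where e is at most every ε_i with i < k.
  obtain ⟨N, hN⟩ := exists_nat_gt (8 / e)
  have hN0 : (0 : ℝ) < N := lt_trans (by positivity) hN
  have hNpos : 0 < N := by exact_mod_cast hN0
  have hNe : 8 < N * e := by rwa [div_lt_iff₀ he] at hN
  have hN2 : 2 / (N : ℝ) ≤ e / 4 := by
    rw [div_le_iff₀ hN0]; linarith
  obtain ⟨D, hDD, hDN, hD2⟩ : ∃ D, D₀ ≤ D ∧ 2 * N ≤ D ∧ 2 ≤ D :=
    ⟨max D₀ (2 * N), le_max_left _ _, le_max_right _ _, le_max_of_le_right (by omega)⟩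
  obtain ⟨H₁, hev⟩ := hsieve D hDD
  set W := primorial D
  have hWpos : 0 < W := primorial_pos D
  have hW0 : (0 : ℝ) < W := by exact_mod_cast hWpos
  set τ := e / 4
  have hτ : 0 < τ := by positivity
  set b : Fin k → ℕ := fun i => ⌊(N : ℝ) * β i⌋₊
  have hbup : ∀ i : Fin k, (b i : ℝ) ≤ N * β i := fun i => Nat.floor_le (by have := hβ0 i; positivity)
  have hblow : ∀ i : Fin k, (N : ℝ) * β i - 1 < b i := fun i => Nat.sub_one_lt_floor _
  have hblt : ∀ i j : Fin k, i < j → b j < b i := fun i j hij => by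
    have h1 := hbup j
    have h2 := hblow i
    have h3 := hβlt i j hij
    have h4 := mul_le_mul_of_nonneg_left h3 hN0.le
    have h5 := mul_le_mul_of_nonneg_left (hβε i).2.1 hN0.le
    have h6 := mul_le_mul_of_nonneg_left (hei i) hN0.le
    have : (b j : ℝ) < b i := by linarith
    exact_mod_cast this
  have hbinj : Function.Injective b := fun i j hij => by
    rcases lt_trichotomy i j with h | h | h
    · exact absurd hij (hblt i j h).ne'
    · exact h
    · exact absurd hij (hblt j i h).ne
  have hbN : ∀ i, b i ≤ N := fun i => by
    have h1 := hbup i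
    have h2 := mul_le_mul_of_nonneg_left (hβ1 i) hN0.le
    have : (b i : ℝ) ≤ N := by linarith
    exact_mod_cast this
  set F : ℕ → ℝ := fun x => G (Nat.primeCounting x)
  have hF : Tendsto F atTop atTop := hlim.comp Nat.tendsto_primeCounting
  have hFlog : ∀ᶠ x in atTop, F x ≤ Real.log x := by
    filter_upwards [Nat.tendsto_primeCounting.eventually_ge_atTop 2, eventually_ge_atTop 2]
      with x hx hx2
    refine (hlog _ hx).trans (Real.log_le_log ?_ (by exact_mod_cast primeSeq_primeCounting_le hx2))
    exact_mod_cast (Nat.prime_nth_prime _).pos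
  have hHtop : Tendsto (fun x : ℕ => ⌊c * Real.log x⌋₊) atTop atTop :=
    tendsto_nat_floor_atTop.comp (tendsto_log_natCast.const_mul_atTop hc)
  have havoid : ∀ᶠ n in atTop, ∀ i : Fin k,
      ε i ≤ |((primeSeq (n + 1) : ℝ) - primeSeq n) / G n - β i| :=
    eventually_all.2 fun i => (hβε i).2.2.2
  obtain ⟨n₀, hn₀⟩ := eventually_atTop.1 havoid
  -- The slow variation of G between the indices of x and 3x holds only for infinitely many x, the
  -- other conditions for all large x; a single x suffices.
  obtain ⟨x, hx3, hxs, hxl, hxH, hxF, hxn⟩ :=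
    ((frequently_le_mul_of_le_log hF hFlog hτ).and_eventually
      (hev.and (hFlog.and ((hHtop.eventually_ge_atTop H₁).and
        ((hF.eventually_ge_atTop ((N : ℝ) * (N * W))).and
          (Nat.tendsto_primeCounting.eventually_ge_atTop (max n₀ 2))))))).exists
  set G₀ := F x
  set y := G₀ / (N * W)
  have hNW : (0 : ℝ) < N * W := by positivity
  have hyN : (N : ℝ) ≤ y := by rwa [le_div_iff₀ hNW]
  have hG₀ : 0 < G₀ := lt_of_lt_of_le (by positivity) hxF
  have hyG : (W : ℝ) * y * N = G₀ := by
    simp only [y]; field_simp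
  obtain ⟨a, m, hNm, hmN, hMup, hMlow⟩ := exists_two_pow_mul_le hNpos hyN
  set M := 2 ^ a * m
  -- Divisibility by W keeps 1 + h_i coprime to W, the factors M and b_i keep the shifts distinct
  -- modulo p > D, and W M N ≈ G₀ makes h_i ≈ β_i G₀.
  set h : Fin k → ℕ := fun i => W * M * b i
  have hhup : ∀ i : Fin k, (h i : ℝ) ≤ β i * G₀ := fun i => by
    simp only [h]
    push_cast
    calc (W : ℝ) * M * b i ≤ W * y * (N * β i) := by
          refine mul_le_mul (mul_le_mul_of_nonneg_left hMup hW0.le) (hbup i) (by positivity)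
            (by positivity)
      _ = β i * G₀ := by rw [← hyG]; ring
  have hhlow : ∀ i : Fin k, (β i - 2 / N) * G₀ ≤ h i := fun i => by
    simp only [h]
    push_cast
    have hu0 : 0 < 1 / (N : ℝ) := by positivity
    have hu1 : 1 / (N : ℝ) ≤ 1 := by
      rw [div_le_one hN0]; exact_mod_cast hNpos
    have hnb : (N : ℝ) * (β i - 1 / N) ≤ b i := by
      have : (N : ℝ) * (β i - 1 / N) = N * β i - 1 := by field_simp
      linarith [hblow i]
    have hs : β i - 2 / N ≤ (1 - 1 / N) * (β i - 1 / N) := by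
      have e2 : (2 : ℝ) / N = 2 * (1 / N) := by ring
      rw [e2]
      nlinarith [mul_nonneg hu0.le (sub_nonneg.2 (hβ1 i)), mul_self_nonneg (1 / (N : ℝ))]
    calc (β i - 2 / N) * G₀ ≤ (1 - 1 / N) * (β i - 1 / N) * G₀ :=
          mul_le_mul_of_nonneg_right hs hG₀.le
      _ = W * (y * (1 - 1 / N)) * (N * (β i - 1 / N)) := by rw [← hyG]; ring
      _ ≤ W * (y * (1 - 1 / N)) * b i := by
          refine mul_le_mul_of_nonneg_left hnb ?_
          have : 0 ≤ y := hN0.le.trans hyN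
          have : 0 ≤ 1 - 1 / (N : ℝ) := by linarith
          positivity
      _ ≤ W * M * b i :=
          mul_le_mul_of_nonneg_right (mul_le_mul_of_nonneg_left hMlow hW0.le) (Nat.cast_nonneg _)
  have hmod : ∀ p, p.Prime → D < p → ∀ i j, h i ≡ h j [MOD p] → i = j := fun p hp hDp i j hij =>
    tuple_modEq_imp_eq hDN hD2 (by omega) hmN hbinj hbN hp hDp i j hij
  have hlx : 0 ≤ Real.log x := Real.log_natCast_nonneg x
  have hhH : ∀ i, h i ≤ ⌊c * Real.log x⌋₊ := fun i => Nat.le_floor <|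
    (hhup i).trans (mul_le_mul (hβc i) hxl hG₀.le hc.le)
  obtain ⟨n, hn, hcount⟩ := hxs h hmod (fun i => (Dvd.intro _ rfl : W ∣ W * M).mul_right _) _ hxH
    (Nat.floor_le (by positivity)) hhH
  have hhinj : Function.Injective h := fun i j hij => by
    obtain ⟨p, hp1, hp2⟩ := Nat.exists_infinite_primes (D + 1)
    exact hmod p hp2 (by omega) i j (by rw [hij])
  obtain ⟨j, i, hij, hpj, hpi, hno⟩ := exists_consecutive_primes h hhinj hhH hcount
  -- The shifts decrease with the index, so the upper prime has the smaller index, and β_i with its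
  -- radius ε_i is what the gap contradicts.
  have hji : i < j := by
    rcases lt_trichotomy i j with h1 | h1 | h1
    · exact h1
    · rw [h1] at hij; exact absurd hij (lt_irrefl _)
    · exact absurd hij (not_lt.2 (Nat.mul_le_mul_left _ (hblt j i h1).le))
  rw [Finset.mem_Ioc] at hn
  set n₁ := Nat.primeCounting (n + h j)
  have hxn1 : Nat.primeCounting x ≤ n₁ := Nat.monotone_primeCounting (by omega)
  have hx2 : 2 ≤ Nat.primeCounting x := (le_max_right _ _).trans hxn
  have hx0 : x ≠ 0 := by
    rintro rfl
    simp at hx2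
  have hhx : h j ≤ x := by
    have h1 := hhup j
    have h2 := Real.log_le_sub_one_of_pos (show (0 : ℝ) < x by exact_mod_cast Nat.pos_of_ne_zero hx0)
    have h3 := mul_le_mul_of_nonneg_right (hβ1 j) hG₀.le
    have : (h j : ℝ) ≤ x := by linarith
    exact_mod_cast this
  have hn13 : n₁ ≤ Nat.primeCounting (3 * x) := Nat.monotone_primeCounting (by omega)
  have hG1 : G₀ ≤ G n₁ := hmono hx2 (hx2.trans hxn1) hxn1
  have hG2 : G n₁ ≤ (1 + τ) * G₀ :=
    (hmono (hx2.trans hxn1) ((hx2.trans hxn1).trans hn13) hn13).trans hx3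
  have hav := hn₀ n₁ (((le_max_left _ _).trans hxn).trans hxn1) i
  rw [primeSeq_primeCounting hpj, primeSeq_primeCounting_succ hpi (by omega) hno] at hav
  refine absurd hav (not_le.2 ?_)
  have e1 : ((n + h i : ℕ) : ℝ) - ((n + h j : ℕ) : ℝ) = h i - h j := by push_cast; ring
  rw [e1]
  have hq : τ ≤ ε i / 4 := by
    simp only [τ]
    linarith [hei i]
  exact abs_sub_lt_of_bounds hG₀ hG1 hG2 hτ hq (N := N) (hN2.trans hq) (hβ1 i)
    (hβε i).2.1 (hβlt i j hji) (hhup i) (hhlow i) (Nat.cast_nonneg _) (hhup j)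

theorem lt_primeSeq {n : ℕ} (hn : 1 ≤ n) : n < primeSeq n := by
  have := Nat.add_two_le_nth_prime (n - 1)
  rw [primeSeq]
  omega

theorem theorem4 (θ : ℝ) (hθ : 1 / 2 < θ) (hlevel : HasLevelOfDistribution θ)
    (g : ℕ → ℝ)
    (hg_pos : ∀ n : ℕ, 2 ≤ n → 0 < g n)
    (hg_lt : ∀ n : ℕ, 2 ≤ n → g n < Real.log n)
    (hg_mono : MonotoneOn g (Set.Ici 2))
    (hg_lim : Filter.Tendsto g Filter.atTop Filter.atTop) :
    ∃ c : ℝ, 0 < c ∧ Set.Icc 0 c ⊆ gapLimitPoints ∧ Set.Icc 0 c ⊆ gapLimitPointsWrt g := by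
  have hlogn : ∀ n : ℕ, 1 ≤ n → Real.log n ≤ Real.log (primeSeq n) := fun n hn =>
    Real.log_le_log (by exact_mod_cast hn) (by exact_mod_cast (lt_primeSeq hn).le)
  obtain ⟨c₁, hc₁, h₁⟩ := hlevel.exists_Icc_subset_limitPoints hθ
    (G := fun n => Real.log (primeSeq n)) (fun m _ n _ hmn => by
      refine Real.log_le_log (by exact_mod_cast (Nat.prime_nth_prime _).pos) ?_
      exact_mod_cast (Nat.nth_strictMono Nat.infinite_setOfPred_prime).monotone
        (Nat.sub_le_sub_right hmn 1))
    (tendsto_atTop_mono' _ (eventually_atTop.2 ⟨1, hlogn⟩) tendsto_log_natCast)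
    (fun n _ => le_rfl)
  obtain ⟨c₂, hc₂, h₂⟩ := hlevel.exists_Icc_subset_limitPoints hθ hg_mono hg_lim
    (fun n hn => (hg_lt n hn).le.trans (hlogn n (by omega)))
  exact ⟨min c₁ c₂, lt_min hc₁ hc₂, (Icc_subset_Icc_right (min_le_left _ _)).trans h₁,
    (Icc_subset_Icc_right (min_le_right _ _)).trans h₂⟩
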